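/- **Setting.** All manifolds are smooth, Hausdorff, second countable, finite dimensional and without boundary. Let $X$ be an oriented manifold of dimension $n+1$, let $\pi_{X,Y}:Y\to X$ be a smooth locally trivial fiber bundle with $N$-dimensional fiber, and let $\pi_{Y,B}:B\to Y$ be a smooth locally trivial fiber bundle with $K$-dimensional fiber ($n,N,K\ge 0$). For $y\in Y_x$ put $V_yY=\ker T_y\pi_{X,Y}$ and $J^1_yY=\{\gamma\in L(T_xX,T_yY): T\pi_{X,Y}\circ\gamma=\mathrm{id}\}$. The dual jet bundle $J^1Y^\star\to Y$ has as fiber the affine maps $J^1_yY\to\Lambda^{n+1}T_x^*X$, identified with $$Z_y=\{z\in\Lambda^{n+1}T^*_yY:\ \mathbf i_v\mathbf i_w z=0 \text{ for all } v,w\in V_yY\},\qquad z\mapsto(\gamma\mapsto\gamma^*z).$$ The restricted dual jet bundle $\Pi\to Y$ has fiber $\Pi_y=L(L(T_xX,V_yY),\Lambda^{n+1}T_x^*X)$, and $\mu:J^1Y^\star\to\Pi$ maps an affine map to its linear part. On $J^1Y^\star$ let $\Theta(z)(u_0,\dots,u_n)=z(T\pi_{Y,J^1Y^\star}u_0,\dots,T\pi_{Y,J^1Y^\star}u_n)$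 and $\Omega=-\mathbf d\Theta$. Put $$\mathfrak Z=J^1Y^\star\times_YB,\qquad \mathfrak P=\Pi\times_YB,\qquad \mathfrak m:\mathfrak Z\to\mathfrak P,\ \ \mathfrak m(z,b)=(\mu(z),b),$$ and let $\Theta_{\mathfrak Z},\Omega_{\mathfrak Z}$ be the pull-backs of $\Theta,\Omega$ to $\mathfrak Z$. A generalized energy section is a smooth section $\mathsf e:\mathfrak P\to\mathfrak Z$ of $\mathfrak m$; put $\Theta_{\mathsf e}=\mathsf e^*\Theta_{\mathfrak Z}$ and $\Omega_{\mathsf e}=\mathsf e^*\Omega_{\mathfrak Z}$. Local coordinates $(x^\mu,y^A,b^\alpha)$ of $B\to Y\to X$ (i.e. $x^\mu$ on $X$, $(x^\mu,y^A)$ on $Y$, $(x^\mu,y^A,b^\alpha)$ on $B$) induce coordinates $(x^\mu,y^A,p_A^\mu,b^\alpha)$ on $\mathfrak P$, where $p_A^\mu$ is defined on $\varpi\in\Pi_y$ by $\varpi(dx^\mu\otimes\partial_{y^A})=p_A^\mu\,d^{n+1}x$. In these coordinates the function $e_{loc}(x^\mu,y^A,p^\mu_A,b^\alpha)$ is defined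 by writing the $J^1Y^\star$-component of $\mathsf e$ as $-e_{loc}\,d^{n+1}x+p_A^\mu\,dy^A\wedge d^nx_\mu$, with $d^nx_\mu=\mathbf i_{\partial_\mu}d^{n+1}x$. Let $U\subset X$ be open with compact closure $\bar U$, and let $\psi:\bar U\to\mathfrak P$ be a smooth section of $\mathfrak P\to X$, i.e. near every point of $\bar U$ it extends to a smooth section on an open subset of $X$. A variation of $\psi$ is a family $(\psi_\varepsilon)_{|\varepsilon|<\varepsilon_0}$ of sections over $\bar U$, smooth in $(\varepsilon,x)$ in the same sense, with $\psi_0=\psi$ and $\phi_\varepsilon|_{\partial U}=\phi|_{\partial U}$, where $\phi_\varepsilon,\phi$ are the sections of $Y\to X$ induced by $\psi_\varepsilon,\psi$. **Theorem (covariant Pontryagin principle).** The following three conditions on $\psi$ are equivalent. 1. $\psi$ is a critical point of $\delta\int_U\psi^*\Theta_{\mathsf e}=0$: for every variation $(\psi_\varepsilon)$ of $\psi$, the derivative $\frac{d}{d\varepsilon}\big|_{\varepsilon=0}\int_U\psi_\varepsilon^*\Theta_{\mathsf e}$ exists and is zero. 2. $\psi^*(\mathbf i_V\Omega_{\mathsf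 e})=0$ on $U$ for every smooth vector field $V$ on $\mathfrak P$ that is vertical with respect to $\mathfrak P\to X$. 3. In all local coordinates as above, writing $\psi(x^\mu)=(x^\mu,\psi^A(x),\psi_A^\mu(x),\psi^\alpha(x))$, the following equations hold at all points of $U$ that $\psi$ maps into the coordinate domain, the derivatives of $e_{loc}$ being taken at $\psi(x)$: $$\frac{\partial\psi^A}{\partial x^\mu}=\frac{\partial e_{loc}}{\partial p_A^\mu}\ \ (\text{all }\mu,A),\qquad \sum_{\mu}\frac{\partial\psi_A^\mu}{\partial x^\mu}=-\frac{\partial e_{loc}}{\partial y^A}\ \ (\text{all }A),\qquad \frac{\partial e_{loc}}{\partial b^\alpha}=0\ \ (\text{all }\alpha).$$ -/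

import Mathlib

open Set Filter Topology MeasureTheory Bundle
open scoped Manifold ContDiff

noncomputable section

namespace CovPontryagin

/-- The coordinate space `ℝ^d`. -/
abbrev Euc (d : ℕ) : Type := EuclideanSpace ℝ (Fin d)

/-- The `i`-th coordinate vector of `ℝ^d`. -/
abbrev stdVec {d : ℕ} (i : Fin d) : Euc d := EuclideanSpace.single i (1 : ℝ)

/-! ### Differential forms on manifolds -/

section Forms

variable {E : Type*} [NormedAddCommGroup E] [NormedSpace ℝ E] {H : Type*} [TopologicalSpace H]
  (I : ModelWithCorners ℝ E H) {M : Type*} [TopologicalSpace M] [ChartedSpace H M]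
  {E' : Type*} [NormedAddCommGroup E'] [NormedSpace ℝ E'] {H' : Type*} [TopologicalSpace H']
  (I' : ModelWithCorners ℝ E' H') {M' : Type*} [TopologicalSpace M'] [ChartedSpace H' M']

/-- A (not necessarily smooth) differential form of degree `k` on `M`. -/
abbrev DiffForm (M : Type*) [TopologicalSpace M] [ChartedSpace H M] (k : ℕ) : Type _ :=
  (p : M) → TangentSpace I p [⋀^Fin k]→L[ℝ] ℝ

variable {I I'}

/-- The pull-back `f^* α` of a differential form. -/
def formPullback {k : ℕ} (f : M → M') (α : DiffForm I' M' k) : DiffForm I M k :=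
  fun p => (α (f p)).compContinuousLinearMap (mfderiv I I' f p)

/-- The contraction `i_V α` of a differential form with a vector field. -/
def interior {k : ℕ} (V : (p : M) → TangentSpace I p) (α : DiffForm I M (k + 1)) :
    DiffForm I M k :=
  fun p => ContinuousAlternatingMap.curryLeft (E := E) (α p) (V p)

/-- The exterior derivative `d α`: at `p`, the form is expressed in the preferred chart at `p`,
differentiated there, and the result is pulled back by the chart. -/
def extDer {k : ℕ} (α : DiffForm I M k) : DiffForm I M (k + 1) :=
  fun p =>
    (extDerivWithin
      (fun u : E => ((α ((extChartAt I p).symm u)).compContinuousLinearMap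
        (mfderivWithin 𝓘(ℝ, E) I (extChartAt I p).symm (range I) u) : E [⋀^Fin k]→L[ℝ] ℝ))
      (range I) (extChartAt I p p)).compContinuousLinearMap
        (mfderiv I 𝓘(ℝ, E) (extChartAt I p) p)

/-- `f` is, on the (not necessarily open) set `S`, a smooth map with `pr ∘ f = q`, in the sense that
near every point of `S` it extends to a smooth map `g` on an open set with `pr ∘ g = q`. -/
def IsSmoothLiftOn (I : ModelWithCorners ℝ E H) (I' : ModelWithCorners ℝ E' H') {X : Type*}
    (pr : M' → X) (q : M → X) (f : M → M') (S : Set M) : Prop :=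
  ∀ m ∈ S, ∃ W : Set M, IsOpen W ∧ m ∈ W ∧ ∃ g : M → M',
    ContMDiffOn I I' ∞ g W ∧ (∀ w ∈ W, pr (g w) = q w) ∧ EqOn f g (S ∩ W)

end Forms

/-! ### The bundle `Λ^q T^* M` -/

section ExteriorBundle

/-- The fiber at `y` of the bundle `Λ^q T^* M`. -/
def ExtFiber (d q : ℕ) (M : Type*) [TopologicalSpace M] [ChartedSpace (Euc d) M] (y : M) : Type :=
  TangentSpace (𝓡 d) y [⋀^Fin q]→L[ℝ] ℝ

/-- The model fiber of the bundle `Λ^q T^* M`. -/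
abbrev ExtModel (d q : ℕ) : Type := Euc d [⋀^Fin q]→L[ℝ] ℝ

variable {d q : ℕ} {M : Type*} [TopologicalSpace M] [ChartedSpace (Euc d) M]

/-- An element of the fiber of `Λ^q T^* M`, as an alternating form on the tangent space. -/
def ExtFiber.toForm {y : M} (z : ExtFiber d q M y) : TangentSpace (𝓡 d) y [⋀^Fin q]→L[ℝ] ℝ := z

instance (y : M) : AddCommGroup (ExtFiber d q M y) :=
  inferInstanceAs (AddCommGroup (TangentSpace (𝓡 d) y [⋀^Fin q]→L[ℝ] ℝ))

instance (y : M) : Module ℝ (ExtFiber d q M y) :=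
  inferInstanceAs (Module ℝ (TangentSpace (𝓡 d) y [⋀^Fin q]→L[ℝ] ℝ))

instance (y : M) : TopologicalSpace (ExtFiber d q M y) :=
  inferInstanceAs (TopologicalSpace (TangentSpace (𝓡 d) y [⋀^Fin q]→L[ℝ] ℝ))

/-- The total space of the bundle `Λ^q T^* M`. -/
abbrev ExtBundle (d q : ℕ) (M : Type*) [TopologicalSpace M] [ChartedSpace (Euc d) M] : Type _ :=
  TotalSpace (ExtModel d q) (ExtFiber d q M)

variable [IsManifold (𝓡 d) ∞ M]

-- The vector bundle structure is that of the bundle of alternating maps from the tangent bundle to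
-- the trivial line bundle.
instance : TopologicalSpace (ExtBundle d q M) :=
  inferInstanceAs (TopologicalSpace (TotalSpace (Euc d [⋀^Fin q]→L[ℝ] ℝ)
    (fun y : M => TangentSpace (𝓡 d) y [⋀^Fin q]→L[ℝ] (Bundle.Trivial M ℝ) y)))

instance : FiberBundle (ExtModel d q) (ExtFiber d q M) :=
  inferInstanceAs (FiberBundle (Euc d [⋀^Fin q]→L[ℝ] ℝ)
    (fun y : M => TangentSpace (𝓡 d) y [⋀^Fin q]→L[ℝ] (Bundle.Trivial M ℝ) y))

instance : VectorBundle ℝ (ExtModel d q) (ExtFiber d q M) :=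
  inferInstanceAs (VectorBundle ℝ (Euc d [⋀^Fin q]→L[ℝ] ℝ)
    (fun y : M => TangentSpace (𝓡 d) y [⋀^Fin q]→L[ℝ] (Bundle.Trivial M ℝ) y))

end ExteriorBundle

/-! ### Oriented manifolds and integration of top-degree forms -/

section Integration

variable {m : ℕ} {X : Type*} [TopologicalSpace X] [ChartedSpace (Euc m) X]
  [IsManifold (𝓡 m) ∞ X]

variable (X) in
/-- An orientation of the `m`-dimensional manifold `X`, given by a continuous nowhere vanishing form
of degree `m`. Only the sign of this form on frames is ever used. -/
structure ManifoldOrientation where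
  /-- the orienting form -/
  form : DiffForm (𝓡 m) X m
  ne_zero : ∀ x, form x ≠ 0
  continuous_form : Continuous (fun x => (⟨x, form x⟩ : ExtBundle m m X))

/-- The value of a form of degree `m` on the coordinate frame `∂_1, …, ∂_m` of the chart `χ`, at the
point with coordinates `u`. -/
def coordValue (χ : OpenPartialHomeomorph X (Euc m)) (α : DiffForm (𝓡 m) X m) (u : Euc m) : ℝ :=
  α (χ.symm u) (fun i => mfderiv (𝓡 m) (𝓡 m) χ.symm u (stdVec i))

variable (m X) in
/-- A smooth partition of unity subordinate to the preferred charts of `X`. -/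
def chartPartition [T2Space X] [SigmaCompactSpace X] : SmoothPartitionOfUnity X (𝓡 m) X univ :=
  Classical.choose (SmoothPartitionOfUnity.exists_isSubordinate_chartAt_source (𝓡 m) X)

/-- The integral `∫_U α` of a form of top degree over an open subset `U` with compact closure of the
oriented manifold `X`: by a partition of unity subordinate to charts it is reduced to Lebesgue
integrals in charts, each with the sign of the chart with respect to the orientation. -/
def formIntegral [T2Space X] [SigmaCompactSpace X] (o : ManifoldOrientation (m := m) X) (U : Set X)
    (α : DiffForm (𝓡 m) X m) : ℝ :=
  ∑ᶠ c : X, ∫ u in (chartAt (Euc m) c).target ∩ (chartAt (Euc m) c).symm ⁻¹' U,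
    chartPartition m X c ((chartAt (Euc m) c).symm u)
      * (SignType.sign (coordValue (chartAt (Euc m) c) o.form u) : ℝ)
      * coordValue (chartAt (Euc m) c) α u

end Integration

/-! ### Fiber bundles and adapted coordinates -/

section FiberBundles

/-- A smooth, locally trivial fiber bundle `proj : M → X` with typical fiber `F`, where
`dim M = d`, `dim X = m` and `dim F = k`. -/
structure SmoothFiberBundle (d m k : ℕ) (M X F : Type*)
    [TopologicalSpace M] [ChartedSpace (Euc d) M] [TopologicalSpace X] [ChartedSpace (Euc m) X]
    [TopologicalSpace F] [ChartedSpace (Euc k) F] where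
  /-- the projection -/
  proj : C^∞⟮𝓡 d, M; 𝓡 m, X⟯
  locally_trivial : ∀ x : X, ∃ t : Trivialization F proj, x ∈ t.baseSet ∧
    ContMDiffOn (𝓡 d) ((𝓡 m).prod (𝓡 k)) ∞ t t.source ∧
    ContMDiffOn ((𝓡 m).prod (𝓡 k)) (𝓡 d) ∞ t.toOpenPartialHomeomorph.symm t.target

variable {d m k : ℕ} {M X F : Type*}
  [TopologicalSpace M] [ChartedSpace (Euc d) M] [TopologicalSpace X] [ChartedSpace (Euc m) X]
  [TopologicalSpace F] [ChartedSpace (Euc k) F]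

/-- A system of local coordinates `(x^μ, y^A)` of the bundle: a chart `base` of `X` with coordinates
`x^μ`, and a chart `chart` of the total space whose first component is `base ∘ proj`. -/
structure AdaptedChart (p : SmoothFiberBundle d m k M X F) where
  /-- the coordinates `x^μ` on the base -/
  base : OpenPartialHomeomorph X (Euc m)
  /-- the coordinates `(x^μ, y^A)` on the total space -/
  chart : OpenPartialHomeomorph M (Euc m × Euc k)
  base_smooth : ContMDiffOn (𝓡 m) (𝓡 m) ∞ base base.source
  base_symm_smooth : ContMDiffOn (𝓡 m) (𝓡 m) ∞ base.symm base.target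
  chart_smooth : ContMDiffOn (𝓡 d) 𝓘(ℝ, Euc m × Euc k) ∞ chart chart.source
  chart_symm_smooth : ContMDiffOn 𝓘(ℝ, Euc m × Euc k) (𝓡 d) ∞ chart.symm chart.target
  proj_mem : ∀ y ∈ chart.source, p.proj y ∈ base.source
  chart_fst : ∀ y ∈ chart.source, (chart y).1 = base (p.proj y)

variable {p : SmoothFiberBundle d m k M X F}

theorem SmoothFiberBundle.exists_adaptedChart [IsManifold (𝓡 m) ∞ X] [IsManifold (𝓡 k) ∞ F]
    (p : SmoothFiberBundle d m k M X F) (y : M) :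
    ∃ c : AdaptedChart p, y ∈ c.chart.source := by
  obtain ⟨t, hy, ht, ht'⟩ := p.locally_trivial (p.proj y)
  let χ := chartAt (Euc m) (p.proj y)
  let ϕ := chartAt (Euc k) (t y).2
  have hχ : ContMDiffOn (𝓡 m) (𝓡 m) ∞ χ χ.source := contMDiffOn_chart
  have hχ' : ContMDiffOn (𝓡 m) (𝓡 m) ∞ χ.symm χ.target := contMDiffOn_chart_symm
  have hϕ : ContMDiffOn (𝓡 k) (𝓡 k) ∞ ϕ ϕ.source := contMDiffOn_chart
  have hϕ' : ContMDiffOn (𝓡 k) (𝓡 k) ∞ ϕ.symm ϕ.target := contMDiffOn_chart_symm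
  have hmem : ∀ z, z ∈ (t.toOpenPartialHomeomorph.trans (χ.prod ϕ)).source →
      z ∈ t.source ∧ (t z).1 ∈ χ.source ∧ (t z).2 ∈ ϕ.source := by
    intro z hz
    rw [OpenPartialHomeomorph.trans_source] at hz
    exact ⟨hz.1, hz.2.1, hz.2.2⟩
  refine ⟨⟨χ, t.toOpenPartialHomeomorph.trans (χ.prod ϕ), hχ, hχ', ?_, ?_, ?_, ?_⟩, ?_⟩
  · have h1 : ContMDiffOn (𝓡 d) (𝓡 m) ∞ (fun z => χ (t z).1)
        (t.toOpenPartialHomeomorph.trans (χ.prod ϕ)).source :=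
      hχ.comp ((contMDiff_fst.contMDiffOn (s := univ)).comp
        (ht.mono fun z hz => (hmem z hz).1) (fun _ _ => mem_univ _)) fun z hz => (hmem z hz).2.1
    have h2 : ContMDiffOn (𝓡 d) (𝓡 k) ∞ (fun z => ϕ (t z).2)
        (t.toOpenPartialHomeomorph.trans (χ.prod ϕ)).source :=
      hϕ.comp ((contMDiff_snd.contMDiffOn (s := univ)).comp
        (ht.mono fun z hz => (hmem z hz).1) (fun _ _ => mem_univ _)) fun z hz => (hmem z hz).2.2
    exact h1.prodMk_space h2
  · have hsrc : ∀ u ∈ (t.toOpenPartialHomeomorph.trans (χ.prod ϕ)).target,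
        u.1 ∈ χ.target ∧ u.2 ∈ ϕ.target ∧ (χ.symm u.1, ϕ.symm u.2) ∈ t.target := by
      intro u hu
      rw [OpenPartialHomeomorph.trans_target] at hu
      exact ⟨hu.1.1, hu.1.2, hu.2⟩
    have h1 : ContMDiffOn 𝓘(ℝ, Euc m × Euc k) (𝓡 m) ∞ (fun u : Euc m × Euc k => χ.symm u.1)
        (t.toOpenPartialHomeomorph.trans (χ.prod ϕ)).target :=
      hχ'.comp contDiff_fst.contMDiff.contMDiffOn fun u hu => (hsrc u hu).1
    have h2 : ContMDiffOn 𝓘(ℝ, Euc m × Euc k) (𝓡 k) ∞ (fun u : Euc m × Euc k => ϕ.symm u.2)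
        (t.toOpenPartialHomeomorph.trans (χ.prod ϕ)).target :=
      hϕ'.comp contDiff_snd.contMDiff.contMDiffOn fun u hu => (hsrc u hu).2.1
    exact ht'.comp (h1.prodMk h2) fun u hu => (hsrc u hu).2.2
  · intro z hz
    have h := hmem z hz
    rw [← t.coe_fst h.1]
    exact h.2.1
  · intro z hz
    have h := hmem z hz
    change χ (t z).1 = χ (p.proj z)
    rw [t.coe_fst h.1]
  · have hy' : y ∈ t.source := t.mem_source.2 hy
    rw [OpenPartialHomeomorph.trans_source]
    refine ⟨hy', ?_, ?_⟩
    · change (t y).1 ∈ χ.source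
      rw [t.coe_fst hy']
      exact mem_chart_source _ _
    · exact mem_chart_source _ _

theorem AdaptedChart.base_mdiff (c : AdaptedChart p) :
    c.base.MDifferentiable (𝓡 m) (𝓡 m) :=
  ⟨c.base_smooth.mdifferentiableOn (by simp), c.base_symm_smooth.mdifferentiableOn (by simp)⟩

theorem AdaptedChart.chart_mdiff (c : AdaptedChart p) :
    c.chart.MDifferentiable (𝓡 d) 𝓘(ℝ, Euc m × Euc k) :=
  ⟨c.chart_smooth.mdifferentiableOn (by simp), c.chart_symm_smooth.mdifferentiableOn (by simp)⟩

end FiberBundles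
/-! ### The restricted dual jet bundle -/

section LinearAlgebra

variable (m k : ℕ)

/-- The space of the momentum coordinates `(p_A^μ)`, written as `P μ A`. -/
abbrev Mom : Type := Fin m → Fin k → ℝ

/-- The standard volume form `dx^1 ∧ … ∧ dx^m` of `ℝ^m`. -/
def stdVol : Euc m [⋀^Fin m]→L[ℝ] ℝ where
  toAlternatingMap := (Matrix.detRowAlternating (n := Fin m) (R := ℝ)).compLinearMap
    (EuclideanSpace.equiv (Fin m) ℝ).toLinearMap
  cont := by
    change Continuous fun v : Fin m → Euc m => Matrix.det (Matrix.of fun i j => v i j)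
    refine Continuous.matrix_det ?_
    refine continuous_matrix fun i j => ?_
    simp only [Matrix.of_apply]
    fun_prop

variable {m k}

theorem stdVol_std : stdVol m (fun i => stdVec i) = 1 := by
  change Matrix.det (fun i j => (stdVec i : Euc m) j) = 1
  rw [← Matrix.det_one (n := Fin m) (R := ℝ)]
  congr 1
  ext i j
  simp [Matrix.one_apply, eq_comm]

theorem eq_smul_stdVol (θ : Euc m [⋀^Fin m]→L[ℝ] ℝ) :
    θ = θ (fun i => stdVec i) • stdVol m := by
  apply ContinuousAlternatingMap.toAlternatingMap_injective
  have h := AlternatingMap.eq_smul_basis_det (EuclideanSpace.basisFun (Fin m) ℝ).toBasis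
  have hb : ⇑(EuclideanSpace.basisFun (Fin m) ℝ).toBasis = fun i => (stdVec i : Euc m) := by
    ext i; simp
  have h1 := h θ.toAlternatingMap
  have h2 := h (stdVol m).toAlternatingMap
  rw [hb] at h1 h2
  have h3 : (stdVol m).toAlternatingMap (fun i => stdVec i) = 1 := stdVol_std
  rw [h3, one_smul] at h2
  rw [h1, ← h2]
  rfl

/-- The linear map `dx^μ ⊗ ∂_A`. -/
def elemMap (μ : Fin m) (A : Fin k) : Euc m →L[ℝ] Euc k :=
  (EuclideanSpace.proj μ : Euc m →L[ℝ] ℝ).smulRight (stdVec A)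

set_option synthInstance.maxHeartbeats 400000 in
/-- The coordinates `P μ A = ϖ (dx^μ ⊗ ∂_A) (∂_1, …, ∂_m)` on
`L(L(ℝ^m, ℝ^k), Λ^m ℝ^m)`; the inverse sends `P` to
`ℓ ↦ (∑ P μ A ℓ^A_μ) dx^1 ∧ … ∧ dx^m`. -/
def momEquiv (m k : ℕ) :
    ((Euc m →L[ℝ] Euc k) →L[ℝ] (Euc m [⋀^Fin m]→L[ℝ] ℝ)) ≃L[ℝ] Mom m k where
  toFun ϖ μ A := ϖ (elemMap μ A) (fun i => stdVec i)
  map_add' a b := by ext; simp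
  map_smul' r a := by ext; simp
  invFun P := ∑ μ, ∑ A, P μ A •
    ((EuclideanSpace.proj A ∘L ContinuousLinearMap.apply ℝ (Euc k) (stdVec μ : Euc m) :
      (Euc m →L[ℝ] Euc k) →L[ℝ] ℝ)).smulRight (stdVol m)
  left_inv ϖ := by
    ext1 ℓ
    have hℓ : ℓ = ∑ μ, ∑ A, (ℓ (stdVec μ)) A • (elemMap μ A : Euc m →L[ℝ] Euc k) := by
      ext1 v
      have hv : v = ∑ μ, v μ • (stdVec μ : Euc m) := by
        ext j; simp [Pi.single_apply]
      conv_lhs => rw [hv]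
      ext j
      simp [elemMap, Pi.single_apply, mul_comm]
    conv_rhs => rw [hℓ]
    simp only [map_sum, map_smul, sum_apply, smul_apply,
      ContinuousLinearMap.smulRight_apply, ContinuousLinearMap.comp_apply,
      ContinuousLinearMap.apply_apply, PiLp.proj_apply]
    refine Finset.sum_congr rfl fun μ _ => Finset.sum_congr rfl fun A _ => ?_
    conv_rhs => rw [eq_smul_stdVol (ϖ (elemMap μ A))]
    rw [smul_smul, smul_smul, mul_comm]
  right_inv P := by
    ext μ A
    have h : ∀ (x : Fin m) (B : Fin k), (if μ = x then (stdVec A : Euc k) else 0).ofLp B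
        = if μ = x then (if B = A then 1 else 0) else 0 := by
      intro x B
      split_ifs <;> simp_all
    simp [elemMap, stdVol_std, h]
  continuous_toFun := by
    refine continuous_pi fun μ => continuous_pi fun A => ?_
    have h1 : Continuous fun ϖ : (Euc m →L[ℝ] Euc k) →L[ℝ] (Euc m [⋀^Fin m]→L[ℝ] ℝ) =>
      ϖ (elemMap μ A) := (ContinuousLinearMap.apply ℝ _ (elemMap μ A)).continuous
    exact (ContinuousAlternatingMap.apply ℝ (Euc m) ℝ (fun i => stdVec i)).continuous.comp h1
  continuous_invFun :=
    haveI : ContinuousAdd ((Euc m →L[ℝ] Euc k) →L[ℝ] (Euc m [⋀^Fin m]→L[ℝ] ℝ)) :=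
      ContinuousLinearMap.topologicalAddGroup.toContinuousAdd
    continuous_finsetSum _ fun μ _ => continuous_finsetSum _ fun A _ =>
      Continuous.smul (f := fun P : Mom m k => P μ A)
        ((continuous_apply A).comp (continuous_apply μ)) continuous_const

end LinearAlgebra

section ChartTransition

variable {d : ℕ} {M : Type*} [TopologicalSpace M] [ChartedSpace (Euc d) M]
  {E : Type*} [NormedAddCommGroup E] [NormedSpace ℝ E]

theorem smooth_transition (e e' : OpenPartialHomeomorph M E)
    (h : ContMDiffOn (𝓡 d) 𝓘(ℝ, E) ∞ e e.source)
    (hs : ContMDiffOn 𝓘(ℝ, E) (𝓡 d) ∞ e.symm e.target)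
    (h' : ContMDiffOn (𝓡 d) 𝓘(ℝ, E) ∞ e' e'.source)
    (he : e.MDifferentiable (𝓡 d) 𝓘(ℝ, E)) (he' : e'.MDifferentiable (𝓡 d) 𝓘(ℝ, E)) (w : E) :
    ∃ g : M → E, ContMDiffOn (𝓡 d) 𝓘(ℝ, E) ∞ g (e.source ∩ e'.source) ∧
      ∀ y (hy : y ∈ e.source) (hy' : y ∈ e'.source),
        g y = he'.mfderiv hy' ((he.mfderiv hy).symm w) := by
  refine ⟨fun y => fderiv ℝ (e' ∘ e.symm) (e y) w, ?_, ?_⟩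
  · have hopen : IsOpen (e.symm.trans e').source := (e.symm.trans e').open_source
    have h1 : ContDiffOn ℝ ∞ (e' ∘ e.symm) (e.symm.trans e').source := by
      rw [← contMDiffOn_iff_contDiffOn]
      rw [OpenPartialHomeomorph.trans_source]
      exact h'.comp (hs.mono inter_subset_left) fun u hu => hu.2
    have h2 : ContDiffOn ℝ ∞ (fun u => fderiv ℝ (e' ∘ e.symm) u w) (e.symm.trans e').source :=
      (h1.fderiv_of_isOpen hopen (by simp)).clm_apply contDiffOn_const
    refine h2.contMDiffOn.comp (h.mono inter_subset_left) ?_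
    intro y hy
    rw [mem_preimage, OpenPartialHomeomorph.trans_source]
    refine ⟨e.map_source hy.1, ?_⟩
    rw [mem_preimage, e.left_inv hy.1]
    exact hy.2
  · intro y hy hy'
    have h1 : MDifferentiableAt 𝓘(ℝ, E) (𝓡 d) e.symm (e y) :=
      he.mdifferentiableAt_symm (e.map_source hy)
    have h2 : MDifferentiableAt (𝓡 d) 𝓘(ℝ, E) e' (e.symm (e y)) := by
      rw [e.left_inv hy]; exact he'.mdifferentiableAt hy'
    have h3 := mfderiv_comp (e y) h2 h1
    rw [mfderiv_eq_fderiv] at h3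
    change fderiv ℝ (e' ∘ e.symm) (e y) w = _
    rw [h3]
    change mfderiv (𝓡 d) 𝓘(ℝ, E) e' (e.symm (e y)) (mfderiv 𝓘(ℝ, E) (𝓡 d) e.symm (e y) w) =
      mfderiv (𝓡 d) 𝓘(ℝ, E) e' y (mfderiv 𝓘(ℝ, E) (𝓡 d) e.symm (e y) w)
    rw [e.left_inv hy]

end ChartTransition

section RestrictedDualJet

variable {d m k : ℕ} {M X F : Type*}
  [TopologicalSpace M] [ChartedSpace (Euc d) M] [TopologicalSpace X] [ChartedSpace (Euc m) X]
  [TopologicalSpace F] [ChartedSpace (Euc k) F]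

/-- The vertical subspace `V_y M = ker (T_y proj)`. -/
abbrev VerticalSpace (p : SmoothFiberBundle d m k M X F) (y : M) :
    Submodule ℝ (TangentSpace (𝓡 d) y) :=
  LinearMap.ker (mfderiv (𝓡 d) (𝓡 m) p.proj y).toLinearMap

/-- The fiber `Π_y = L(L(T_x X, V_y M), Λ^m T_x^* X)`, `x = proj y`, of the restricted dual jet
bundle, where `m = dim X`. -/
def RestrictedDualJet (p : SmoothFiberBundle d m k M X F) (y : M) : Type :=
  (TangentSpace (𝓡 m) (p.proj y) →L[ℝ] VerticalSpace p y) →L[ℝ]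
    (TangentSpace (𝓡 m) (p.proj y) [⋀^Fin m]→L[ℝ] ℝ)

variable {p : SmoothFiberBundle d m k M X F}

instance (y : M) : AddCommGroup (RestrictedDualJet p y) :=
  inferInstanceAs (AddCommGroup ((TangentSpace (𝓡 m) (p.proj y) →L[ℝ] VerticalSpace p y) →L[ℝ]
    (TangentSpace (𝓡 m) (p.proj y) [⋀^Fin m]→L[ℝ] ℝ)))

instance (y : M) : Module ℝ (RestrictedDualJet p y) :=
  inferInstanceAs (Module ℝ ((TangentSpace (𝓡 m) (p.proj y) →L[ℝ] VerticalSpace p y) →L[ℝ]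
    (TangentSpace (𝓡 m) (p.proj y) [⋀^Fin m]→L[ℝ] ℝ)))

instance (y : M) : TopologicalSpace (RestrictedDualJet p y) :=
  inferInstanceAs (TopologicalSpace ((TangentSpace (𝓡 m) (p.proj y) →L[ℝ] VerticalSpace p y) →L[ℝ]
    (TangentSpace (𝓡 m) (p.proj y) [⋀^Fin m]→L[ℝ] ℝ)))

namespace AdaptedChart

variable (c : AdaptedChart p) {y : M}

/-- The differential at `proj y` of the base chart. -/
def baseDeriv (hy : y ∈ c.chart.source) : TangentSpace (𝓡 m) (p.proj y) ≃L[ℝ] Euc m :=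
  c.base_mdiff.mfderiv (c.proj_mem y hy)

/-- The differential at `y` of the chart of the total space. -/
def chartDeriv (hy : y ∈ c.chart.source) : TangentSpace (𝓡 d) y ≃L[ℝ] Euc m × Euc k :=
  c.chart_mdiff.mfderiv hy

theorem chartDeriv_fst (hy : y ∈ c.chart.source) (v : TangentSpace (𝓡 d) y) :
    (c.chartDeriv hy v).1 = c.baseDeriv hy (mfderiv (𝓡 d) (𝓡 m) p.proj y v) := by
  have h1 : MDifferentiableAt (𝓡 d) 𝓘(ℝ, Euc m × Euc k) c.chart y :=
    c.chart_mdiff.mdifferentiableAt hy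
  have h2 : MDifferentiableAt (𝓡 d) (𝓡 m) p.proj y :=
    p.proj.contMDiff.mdifferentiableAt (by simp)
  have h3 : MDifferentiableAt (𝓡 m) (𝓡 m) c.base (p.proj y) :=
    c.base_mdiff.mdifferentiableAt (c.proj_mem y hy)
  have h4 : (fun z => (c.chart z).1) =ᶠ[𝓝 y] fun z => c.base (p.proj z) := by
    filter_upwards [c.chart.open_source.mem_nhds hy] with z hz using c.chart_fst z hz
  have h5 := h4.mfderiv_eq (I := 𝓡 d) (I' := 𝓡 m)
  have h6 : mfderiv (𝓡 d) (𝓡 m) (fun z => c.base (p.proj z)) y =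
      (mfderiv (𝓡 m) (𝓡 m) c.base (p.proj y)).comp (mfderiv (𝓡 d) (𝓡 m) p.proj y) :=
    mfderiv_comp y h3 h2
  have h7 : mfderiv (𝓡 d) (𝓡 m) (fun z => (c.chart z).1) y =
      (ContinuousLinearMap.fst ℝ (Euc m) (Euc k)).comp
        (mfderiv (𝓡 d) 𝓘(ℝ, Euc m × Euc k) c.chart y) := by
    have h8 := (ContinuousLinearMap.fst ℝ (Euc m) (Euc k)).hasMFDerivAt (x := c.chart y)
    exact (h8.comp y h1.hasMFDerivAt).mfderiv
  have h9 := congrArg (fun L : Euc d →L[ℝ] Euc m => L v) (h7.symm.trans (h5.trans h6))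
  exact h9

/-- The vertical part `V_y M ≃ ℝ^k` of the differential of the chart. -/
def vertDeriv (hy : y ∈ c.chart.source) : VerticalSpace p y ≃L[ℝ] Euc k where
  toFun v := (c.chartDeriv hy v).2
  map_add' v w := by simp
  map_smul' r v := by simp
  invFun w := ⟨(c.chartDeriv hy).symm (0, w), by
    have h := c.chartDeriv_fst hy ((c.chartDeriv hy).symm (0, w))
    rw [ContinuousLinearEquiv.apply_symm_apply] at h
    exact (c.baseDeriv hy).injective (h.symm.trans (map_zero _).symm)⟩
  left_inv v := by
    have hv : mfderiv (𝓡 d) (𝓡 m) p.proj y v = 0 := v.2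
    have h := c.chartDeriv_fst hy v
    rw [hv, map_zero] at h
    ext1
    change (c.chartDeriv hy).symm (0, (c.chartDeriv hy v).2) = v
    rw [← h, Prod.mk.eta, ContinuousLinearEquiv.symm_apply_apply]
  right_inv w := by
    change (c.chartDeriv hy ((c.chartDeriv hy).symm (0, w))).2 = w
    rw [ContinuousLinearEquiv.apply_symm_apply]
  continuous_toFun :=
    continuous_snd.comp ((c.chartDeriv hy).continuous.comp continuous_subtype_val)
  continuous_invFun := by
    refine Continuous.subtype_mk ?_ _
    exact (c.chartDeriv hy).symm.continuous.comp (by fun_prop)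

/-- The linear coordinates `p_A^μ` on the fiber `Π_y` given by an adapted chart: the coordinate
`(μ, A)` of `ϖ` is `ϖ (dx^μ ⊗ ∂_A) (∂_1, …, ∂_m)`. -/
def momCoord (hy : y ∈ c.chart.source) : RestrictedDualJet p y ≃L[ℝ] Mom m k :=
  (((c.baseDeriv hy).arrowCongr (c.vertDeriv hy)).arrowCongr
    ((c.baseDeriv hy).continuousAlternatingMapCongrLeft (F := ℝ) (ι := Fin m))).trans
      (momEquiv m k)

theorem momCoord_apply (hy : y ∈ c.chart.source) (ϖ : RestrictedDualJet p y) (μ : Fin m)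
    (A : Fin k) :
    c.momCoord hy ϖ μ A =
      (show (TangentSpace (𝓡 m) (p.proj y) →L[ℝ] VerticalSpace p y) →L[ℝ]
        (TangentSpace (𝓡 m) (p.proj y) [⋀^Fin m]→L[ℝ] ℝ) from ϖ)
        (((c.vertDeriv hy).symm : Euc k →L[ℝ] VerticalSpace p y).comp
          ((elemMap μ A).comp (c.baseDeriv hy : TangentSpace (𝓡 m) (p.proj y) →L[ℝ] Euc m)))
        (fun i => (c.baseDeriv hy).symm (stdVec i)) := rfl

theorem momCoord_symm_apply (hy : y ∈ c.chart.source) (P : Mom m k)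
    (ℓ : TangentSpace (𝓡 m) (p.proj y) →L[ℝ] VerticalSpace p y)
    (v : Fin m → TangentSpace (𝓡 m) (p.proj y)) :
    (show (TangentSpace (𝓡 m) (p.proj y) →L[ℝ] VerticalSpace p y) →L[ℝ]
        (TangentSpace (𝓡 m) (p.proj y) [⋀^Fin m]→L[ℝ] ℝ) from (c.momCoord hy).symm P) ℓ v =
      (∑ μ, ∑ A, P μ A * (c.vertDeriv hy (ℓ ((c.baseDeriv hy).symm (stdVec μ)))) A)
        * stdVol m (fun i => c.baseDeriv hy (v i)) := by
  change ((momEquiv m k).symm P (((c.vertDeriv hy) : VerticalSpace p y →L[ℝ] Euc k).comp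
    (ℓ.comp ((c.baseDeriv hy).symm : Euc m →L[ℝ] TangentSpace (𝓡 m) (p.proj y)))))
      (fun i => c.baseDeriv hy (v i)) = _
  change (∑ μ, ∑ A, P μ A •
    ((EuclideanSpace.proj A ∘L ContinuousLinearMap.apply ℝ (Euc k) (stdVec μ : Euc m) :
      (Euc m →L[ℝ] Euc k) →L[ℝ] ℝ)).smulRight (stdVol m) :
        (Euc m →L[ℝ] Euc k) →L[ℝ] (Euc m [⋀^Fin m]→L[ℝ] ℝ)) _ _ = _
  simp [Finset.sum_mul, mul_assoc]

end AdaptedChart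

end RestrictedDualJet

section RestrictedDualJetBundle

/-- The local trivialization over `s` of a family of vector spaces given by linear isomorphisms of
the fibers over `s` with a fixed vector space. -/
def pretrivOfEquiv {B : Type*} [TopologicalSpace B] {V : Type*} [NormedAddCommGroup V]
    [NormedSpace ℝ V] {E : B → Type*} [∀ y, AddCommGroup (E y)] [∀ y, Module ℝ (E y)]
    [∀ y, TopologicalSpace (E y)] (s : Set B) (hs : IsOpen s) (φ : ∀ y, y ∈ s → E y ≃L[ℝ] V) :
    Pretrivialization V (Bundle.TotalSpace.proj : TotalSpace V E → B) where
  toFun z := (z.1, open Classical in if h : z.1 ∈ s then φ z.1 h z.2 else 0)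
  invFun q := ⟨q.1, open Classical in if h : q.1 ∈ s then (φ q.1 h).symm q.2 else 0⟩
  source := Bundle.TotalSpace.proj ⁻¹' s
  target := s ×ˢ univ
  map_source' z hz := ⟨hz, mem_univ _⟩
  map_target' q hq := hq.1
  left_inv' := by
    rintro ⟨y, v⟩ (hy : y ∈ s)
    simp [hy]
  right_inv' := by
    rintro ⟨y, v⟩ ⟨hy, -⟩
    have hy : y ∈ s := hy
    simp [hy]
  open_target := hs.prod isOpen_univ
  baseSet := s
  open_baseSet := hs
  source_eq := rfl
  target_eq := rfl
  proj_toFun _ _ := rfl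

variable {d m k : ℕ} {M X F : Type*}
  [TopologicalSpace M] [ChartedSpace (Euc d) M] [TopologicalSpace X] [ChartedSpace (Euc m) X]
  [TopologicalSpace F] [ChartedSpace (Euc k) F]
  {p : SmoothFiberBundle d m k M X F}

/-- The trivialization of the restricted dual jet bundle by the momentum coordinates of an adapted
chart. -/
def momPretriv (c : AdaptedChart p) :
    Pretrivialization (Mom m k)
      (Bundle.TotalSpace.proj : TotalSpace (Mom m k) (RestrictedDualJet p) → M) :=
  pretrivOfEquiv c.chart.source c.chart.open_source fun _ hy => c.momCoord hy

theorem momPretriv_apply (c : AdaptedChart p) {y : M} (hy : y ∈ c.chart.source)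
    (ϖ : RestrictedDualJet p y) :
    momPretriv c ⟨y, ϖ⟩ = (y, c.momCoord hy ϖ) := by
  change (y, _) = _
  rw [dif_pos hy]

theorem momPretriv_symm (c : AdaptedChart p) {y : M} (hy : y ∈ c.chart.source) (P : Mom m k) :
    (momPretriv c).symm y P = (c.momCoord hy).symm P := by
  have h := (momPretriv c).symm_apply_apply_mk (b := y) hy ((c.momCoord hy).symm P)
  rwa [momPretriv_apply c hy, ContinuousLinearEquiv.apply_symm_apply] at h

theorem exists_smooth_coordChange (c c' : AdaptedChart p) :
    ∃ f : M → Mom m k →L[ℝ] Mom m k,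
      ContMDiffOn (𝓡 d) 𝓘(ℝ, Mom m k →L[ℝ] Mom m k) ∞ f (c.chart.source ∩ c'.chart.source) ∧
      ∀ y (hy : y ∈ c.chart.source) (hy' : y ∈ c'.chart.source) (P : Mom m k),
        f y P = c'.momCoord hy' ((c.momCoord hy).symm P) := by
  choose a ha ha' using fun μ : Fin m => smooth_transition c.base c'.base c.base_smooth
    c.base_symm_smooth c'.base_smooth c.base_mdiff c'.base_mdiff (stdVec μ)
  choose a₂ ha₂ ha₂' using fun μ : Fin m => smooth_transition c'.base c.base c'.base_smooth
    c'.base_symm_smooth c.base_smooth c'.base_mdiff c.base_mdiff (stdVec μ)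
  choose b hb hb' using fun A : Fin k => smooth_transition c'.chart c.chart c'.chart_smooth
    c'.chart_symm_smooth c.chart_smooth c'.chart_mdiff c.chart_mdiff (0, stdVec A)
  let S := c.chart.source ∩ c'.chart.source
  have hproj : ContMDiffOn (𝓡 d) (𝓡 m) ∞ p.proj S := p.proj.contMDiff.contMDiffOn
  have hmaps : MapsTo p.proj S (c.base.source ∩ c'.base.source) :=
    fun y hy => ⟨c.proj_mem y hy.1, c'.proj_mem y hy.2⟩
  let unit : Fin m → Fin k → Fin m → Fin k → (Mom m k →L[ℝ] Mom m k) := fun ν B μ A =>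
    ((ContinuousLinearMap.proj A : (Fin k → ℝ) →L[ℝ] ℝ).comp
      (ContinuousLinearMap.proj μ : Mom m k →L[ℝ] (Fin k → ℝ))).smulRight
        (Pi.single ν (Pi.single B 1))
  let coef : Fin m → Fin k → Fin m → Fin k → M → ℝ := fun ν B μ A y =>
    (a μ (p.proj y)) ν * (b B y).2 A * stdVol m (fun i => a₂ i (p.proj y))
  refine ⟨fun y => ∑ ν, ∑ B, ∑ μ, ∑ A, coef ν B μ A y • unit ν B μ A, ?_, ?_⟩
  · have hcoef : ∀ ν B μ A, ContMDiffOn (𝓡 d) 𝓘(ℝ, ℝ) ∞ (coef ν B μ A) S := by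
      intro ν B μ A
      have h1 : ContMDiffOn (𝓡 d) 𝓘(ℝ, ℝ) ∞ (fun y => (a μ (p.proj y)) ν) S :=
        ((EuclideanSpace.proj ν : Euc m →L[ℝ] ℝ).contMDiff.contMDiffOn (s := univ)).comp
          ((ha μ).comp hproj hmaps) (fun _ _ => mem_univ _)
      have h2 : ContMDiffOn (𝓡 d) 𝓘(ℝ, ℝ) ∞ (fun y => (b B y).2 A) S :=
        (((EuclideanSpace.proj A : Euc k →L[ℝ] ℝ).comp
          (ContinuousLinearMap.snd ℝ (Euc m) (Euc k))).contMDiff.contMDiffOn (s := univ)).comp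
          ((hb B).mono fun y hy => ⟨hy.2, hy.1⟩) (fun _ _ => mem_univ _)
      have h3 : ContMDiffOn (𝓡 d) 𝓘(ℝ, ℝ) ∞
          (fun y => stdVol m (fun i => a₂ i (p.proj y))) S := by
        have h4 : ContMDiffOn (𝓡 d) 𝓘(ℝ, Fin m → Euc m) ∞
            (fun y => fun i => a₂ i (p.proj y)) S := by
          rw [contMDiffOn_pi_space]
          intro i
          exact (ha₂ i).comp hproj fun y hy => ⟨(hmaps hy).2, (hmaps hy).1⟩
        have h5 : ContDiff ℝ ∞ (fun v : Fin m → Euc m => stdVol m v) :=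
          (stdVol m).toContinuousMultilinearMap.contDiff
        exact h5.contMDiff.contMDiffOn (s := univ) |>.comp h4 (fun _ _ => mem_univ _)
      exact (h1.mul h2).mul h3
    refine contMDiffOn_finsetSum fun ν _ => contMDiffOn_finsetSum fun B _ =>
      contMDiffOn_finsetSum fun μ _ => contMDiffOn_finsetSum fun A _ => ?_
    exact (hcoef ν B μ A).smul contMDiffOn_const
  · intro y hy hy' P
    ext ν B
    rw [c'.momCoord_apply hy']
    rw [c.momCoord_symm_apply hy]
    have e1 : ∀ i, a₂ i (p.proj y) = c.baseDeriv hy ((c'.baseDeriv hy').symm (stdVec i)) :=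
      fun i => ha₂' i _ (c'.proj_mem y hy') (c.proj_mem y hy)
    have e2 : ∀ i, a i (p.proj y) = c'.baseDeriv hy' ((c.baseDeriv hy).symm (stdVec i)) :=
      fun i => ha' i _ (c.proj_mem y hy) (c'.proj_mem y hy')
    have e3 : (b B y).2 = c.vertDeriv hy ((c'.vertDeriv hy').symm (stdVec B)) :=
      congrArg Prod.snd (hb' B y hy' hy)
    have e4 : ∀ μ, ((c'.vertDeriv hy').symm : Euc k →L[ℝ] VerticalSpace p y).comp
        ((elemMap ν B).comp (c'.baseDeriv hy' : TangentSpace (𝓡 m) (p.proj y) →L[ℝ] Euc m))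
          ((c.baseDeriv hy).symm (stdVec μ)) =
        (a μ (p.proj y)) ν • (c'.vertDeriv hy').symm (stdVec B) := by
      intro μ
      rw [e2]
      simp [elemMap]
    simp only [e4, map_smul, ← e1, ← e3]
    simp only [coef, unit, sum_apply, smul_apply, ContinuousLinearMap.smulRight_apply,
      ContinuousLinearMap.comp_apply, ContinuousLinearMap.proj_apply, Finset.sum_apply,
      Pi.smul_apply, smul_eq_mul, PiLp.smul_apply]
    rw [Finset.sum_eq_single ν, Finset.sum_eq_single B]
    · simp only [Pi.single_eq_same, Finset.sum_mul]
      refine Finset.sum_congr rfl fun μ _ => Finset.sum_congr rfl fun A _ => ?_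
      ring
    · intro B' _ hB
      simp [Pi.single_eq_of_ne hB.symm]
    · simp
    · intro ν' _ hν
      simp [Pi.single_eq_of_ne hν.symm]
    · simp

variable [IsManifold (𝓡 m) ∞ X] [IsManifold (𝓡 k) ∞ F]

variable (p) in
/-- The restricted dual jet bundle `Π → M` as a vector bundle: its local trivializations are the
momentum coordinates of the adapted charts. -/
def restrictedDualJetPrebundle :
    VectorPrebundle ℝ (Mom m k) (RestrictedDualJet p) where
  pretrivializationAtlas := range momPretriv
  pretrivialization_linear' := by
    rintro _ ⟨c, rfl⟩
    refine ⟨fun y hy => ?_⟩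
    have hy : y ∈ c.chart.source := hy
    constructor
    · intro v w; rw [momPretriv_apply c hy, momPretriv_apply c hy, momPretriv_apply c hy, map_add]
    · intro r v; rw [momPretriv_apply c hy, momPretriv_apply c hy, map_smul]
  pretrivializationAt y := momPretriv (p.exists_adaptedChart y).choose
  mem_base_pretrivializationAt y := (p.exists_adaptedChart y).choose_spec
  pretrivialization_mem_atlas y := mem_range_self _
  exists_coordChange := by
    rintro _ ⟨c, rfl⟩ _ ⟨c', rfl⟩
    obtain ⟨f, hf, hf'⟩ := exists_smooth_coordChange c c'
    refine ⟨f, hf.continuousOn, fun y hy P => ?_⟩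
    rw [hf' y hy.1 hy.2, momPretriv_symm c hy.1, momPretriv_apply c' hy.2]
  totalSpaceMk_isInducing y := by
    have hy := (p.exists_adaptedChart y).choose_spec
    have h : (momPretriv (p.exists_adaptedChart y).choose ∘ TotalSpace.mk y) =
        fun ϖ => (y, AdaptedChart.momCoord _ hy ϖ) := by
      ext1 ϖ
      exact momPretriv_apply _ hy ϖ
    rw [h]
    exact isInducing_const_prod.mpr (AdaptedChart.momCoord _ hy).toHomeomorph.isInducing

instance : (restrictedDualJetPrebundle p).IsContMDiff (𝓡 d) ∞ where
  exists_contMDiffCoordChange := by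
    rintro _ ⟨c, rfl⟩ _ ⟨c', rfl⟩
    obtain ⟨f, hf, hf'⟩ := exists_smooth_coordChange c c'
    refine ⟨f, hf, fun y hy P => ?_⟩
    rw [hf' y hy.1 hy.2, momPretriv_symm c hy.1, momPretriv_apply c' hy.2]

instance : TopologicalSpace (TotalSpace (Mom m k) (RestrictedDualJet p)) :=
  (restrictedDualJetPrebundle p).totalSpaceTopology

instance : FiberBundle (Mom m k) (RestrictedDualJet p) :=
  (restrictedDualJetPrebundle p).toFiberBundle

instance : VectorBundle ℝ (Mom m k) (RestrictedDualJet p) :=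
  (restrictedDualJetPrebundle p).toVectorBundle

instance : ContMDiffVectorBundle ∞ (Mom m k) (RestrictedDualJet p) (𝓡 d) :=
  (restrictedDualJetPrebundle p).contMDiffVectorBundle (𝓡 d)

end RestrictedDualJetBundle

/-! ### The dual jet bundle and its canonical forms -/

section DualJet

variable {d m k : ℕ} {M X F : Type*}
  [TopologicalSpace M] [ChartedSpace (Euc d) M] [TopologicalSpace X] [ChartedSpace (Euc m) X]
  [TopologicalSpace F] [ChartedSpace (Euc k) F]

/-- The condition that `z ∈ Λ^m T_y^* M`, `m = dim X`, belongs to `Z_y = J^1_y M^⋆`: it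
vanishes as soon as two of its arguments are vertical, i.e. `i_v i_w z = 0` for `v, w ∈ V_y M`. -/
def IsDualJet (p : SmoothFiberBundle d m k M X F) {y : M} (z : ExtFiber d m M y) : Prop :=
  ∀ (u : Fin m → TangentSpace (𝓡 d) y) (i j : Fin m), i ≠ j →
    u i ∈ VerticalSpace p y → u j ∈ VerticalSpace p y → z.toForm u = 0

/-- The fiber `Z_y = J^1_y M^⋆` of the dual jet bundle. -/
def DualJet (p : SmoothFiberBundle d m k M X F) (y : M) : Type :=
  {z : ExtFiber d m M y // IsDualJet p z}

/-- The condition that `γ : T_x X → T_y M`, `x = proj y`, is an element of the fiber `J^1_y M` of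
the first jet bundle. -/
def IsJet (p : SmoothFiberBundle d m k M X F) {y : M}
    (γ : TangentSpace (𝓡 m) (p.proj y) →L[ℝ] TangentSpace (𝓡 d) y) : Prop :=
  (mfderiv (𝓡 d) (𝓡 m) p.proj y).comp γ = ContinuousLinearMap.id ℝ _

/-- The relation `μ(z) = ϖ`, where `μ : J^1 M^⋆ → Π` maps an affine map on `J^1_y M` to its linear
part, and `z ∈ Z_y` is identified with the affine map `γ ↦ γ^* z` from `J^1_y M` to
`Λ^m T_x^* X`. -/
def IsLinearPart (p : SmoothFiberBundle d m k M X F) {y : M} (z : ExtFiber d m M y)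
    (ϖ : RestrictedDualJet p y) : Prop :=
  ∀ γ : TangentSpace (𝓡 m) (p.proj y) →L[ℝ] TangentSpace (𝓡 d) y, IsJet p γ →
    ∀ ℓ : TangentSpace (𝓡 m) (p.proj y) →L[ℝ] VerticalSpace p y,
      z.toForm.compContinuousLinearMap (γ + (VerticalSpace p y).subtypeL.comp ℓ)
        - z.toForm.compContinuousLinearMap γ =
      (show (TangentSpace (𝓡 m) (p.proj y) →L[ℝ] VerticalSpace p y) →L[ℝ]
        (TangentSpace (𝓡 m) (p.proj y) [⋀^Fin m]→L[ℝ] ℝ) from ϖ) ℓ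

variable (M) [IsManifold (𝓡 d) ∞ M]

/-- The canonical form `Θ` on `Λ^q T^* M`, `Θ(z)(u_1, …, u_q) = z(Tπ u_1, …, Tπ u_q)`. The
canonical form of the dual jet bundle is its restriction to `Z ⊂ Λ^m T^* M`. -/
def canonicalForm (q : ℕ) :
    DiffForm ((𝓡 d).prod 𝓘(ℝ, ExtModel d q)) (ExtBundle d q M) q :=
  fun z => z.2.toForm.compContinuousLinearMap
    (mfderiv ((𝓡 d).prod 𝓘(ℝ, ExtModel d q)) (𝓡 d)
      (Bundle.TotalSpace.proj : ExtBundle d q M → M) z)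

/-- The canonical multisymplectic form `Ω = -dΘ`. -/
def multisymplecticForm (q : ℕ) :
    DiffForm ((𝓡 d).prod 𝓘(ℝ, ExtModel d q)) (ExtBundle d q M) (q + 1) :=
  fun z => - extDer (canonicalForm M q) z

end DualJet

/-! ### The generalized Pontryagin bundles, energy sections and Cartan forms -/

section Pontryagin

variable {n N K : ℕ} {X Y B FY FB : Type*}
  [TopologicalSpace X] [ChartedSpace (Euc (n + 1)) X] [IsManifold (𝓡 (n + 1)) ∞ X]
  [TopologicalSpace Y] [ChartedSpace (Euc (n + 1 + N)) Y] [IsManifold (𝓡 (n + 1 + N)) ∞ Y]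
  [TopologicalSpace B] [ChartedSpace (Euc (n + 1 + N + K)) B]
  [IsManifold (𝓡 (n + 1 + N + K)) ∞ B]
  [TopologicalSpace FY] [ChartedSpace (Euc N) FY] [IsManifold (𝓡 N) ∞ FY]
  [TopologicalSpace FB] [ChartedSpace (Euc K) FB]
  (πY : SmoothFiberBundle (n + 1 + N) (n + 1) N Y X FY)
  (πB : SmoothFiberBundle (n + 1 + N + K) (n + 1 + N) K B Y FB)

/-- The restricted generalized Pontryagin bundle `𝔓 = Π ×_Y B`, realized as the pull-back to `B` of
the restricted dual jet bundle `Π → Y`. A point is a pair `(b, ϖ)` with `ϖ ∈ Π_y`, `y = π_{Y,B}(b)`.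
-/
abbrev RPontryagin : Type _ :=
  TotalSpace (Mom (n + 1) N) ((πB.proj : B → Y) *ᵖ (RestrictedDualJet πY))

/-- The manifold model of `𝔓`. -/
abbrev modelP (n N K : ℕ) :=
  (𝓡 (n + 1 + N + K)).prod 𝓘(ℝ, Mom (n + 1) N)

/-- The bundle `Λ^{n+1} T^* Y ×_Y B`, which contains the generalized Pontryagin bundle
`ℨ = J^1 Y^⋆ ×_Y B = Z ×_Y B` as a submanifold. -/
abbrev ExtPontryagin : Type _ :=
  TotalSpace (ExtModel (n + 1 + N) (n + 1))
    ((πB.proj : B → Y) *ᵖ (ExtFiber (n + 1 + N) (n + 1) Y))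

/-- The manifold model of `Λ^{n+1} T^* Y ×_Y B`. -/
abbrev modelZ (n N K : ℕ) :=
  (𝓡 (n + 1 + N + K)).prod 𝓘(ℝ, ExtModel (n + 1 + N) (n + 1))

variable {πY πB}

/-- The projection `𝔓 → Y`. -/
def projY (P : RPontryagin πY πB) : Y := πB.proj P.proj

/-- The projection `𝔓 → X`. -/
def projX (P : RPontryagin πY πB) : X := πY.proj (πB.proj P.proj)

/-- The `Π`-component of a point of `𝔓 = Π ×_Y B`. -/
def mom (P : RPontryagin πY πB) : RestrictedDualJet πY (projY P) := P.2

variable (πY πB) in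
/-- A generalized energy section: a smooth section `e : 𝔓 → ℨ` of the line bundle
`𝔪 : ℨ → 𝔓`, `𝔪(z, b) = (μ(z), b)`. It has the form `e(ϖ, b) = (z, b)` with `z ∈ Z_y`
and `μ(z) = ϖ`. Smoothness of `e` is smoothness as a map into `Λ^{n+1} T^* Y ×_Y B`, of which
`ℨ` is an embedded submanifold. -/
structure EnergySection where
  /-- the component `z ∈ Z_y = J^1_y Y^⋆`, `y = π_{Y,B}(b)`, of `e(ϖ, b) = (z, b)` -/
  comp : (P : RPontryagin πY πB) → DualJet πY (projY P)
  isSection : ∀ P, IsLinearPart πY (comp P).1 (mom P)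
  smooth : ContMDiff (modelP n N K) (modelZ n N K) ∞
    (fun P => (⟨P.proj, (comp P).1⟩ : ExtPontryagin (n := n) (N := N) πB))

/-- The energy section as a map from `𝔓` to `ℨ ⊂ Λ^{n+1} T^* Y ×_Y B`. -/
def EnergySection.toFun (e : EnergySection πY πB) (P : RPontryagin πY πB) :
    ExtPontryagin (n := n) (N := N) πB :=
  ⟨P.proj, (e.comp P).1⟩

variable (πB) in
/-- The canonical form `Θ_ℨ = π_{J^1Y^⋆,ℨ}^* Θ`. -/
def thetaZ : DiffForm (modelZ n N K) (ExtPontryagin (n := n) (N := N) πB) (n + 1) :=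
  formPullback (Bundle.Pullback.lift (πB.proj : B → Y)) (canonicalForm Y (n + 1))

variable (πB) in
/-- The canonical form `Ω_ℨ = π_{J^1Y^⋆,ℨ}^* Ω`. -/
def omegaZ : DiffForm (modelZ n N K) (ExtPontryagin (n := n) (N := N) πB) (n + 2) :=
  formPullback (Bundle.Pullback.lift (πB.proj : B → Y)) (multisymplecticForm Y (n + 1))

namespace EnergySection

variable (e : EnergySection πY πB)

/-- The Cartan form `Θ_e = e^* Θ_ℨ`. -/
def theta : DiffForm (modelP n N K) (RPontryagin πY πB) (n + 1) :=
  formPullback e.toFun (thetaZ πB)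

/-- The Cartan form `Ω_e = e^* Ω_ℨ`. -/
def omega : DiffForm (modelP n N K) (RPontryagin πY πB) (n + 2) :=
  formPullback e.toFun (omegaZ πB)

end EnergySection

end Pontryagin

/-! ### The three conditions on a section of `𝔓 → X` -/

section Conditions

variable {n N K : ℕ} {X Y B FY FB : Type*}
  [TopologicalSpace X] [ChartedSpace (Euc (n + 1)) X] [IsManifold (𝓡 (n + 1)) ∞ X]
  [TopologicalSpace Y] [ChartedSpace (Euc (n + 1 + N)) Y] [IsManifold (𝓡 (n + 1 + N)) ∞ Y]
  [TopologicalSpace B] [ChartedSpace (Euc (n + 1 + N + K)) B]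
  [IsManifold (𝓡 (n + 1 + N + K)) ∞ B]
  [TopologicalSpace FY] [ChartedSpace (Euc N) FY] [IsManifold (𝓡 N) ∞ FY]
  [TopologicalSpace FB] [ChartedSpace (Euc K) FB]
  {πY : SmoothFiberBundle (n + 1 + N) (n + 1) N Y X FY}
  {πB : SmoothFiberBundle (n + 1 + N + K) (n + 1 + N) K B Y FB}

/-- `ψ` is a smooth local section of `𝔓 → X` on the set `S` (its values off `S` are irrelevant):
near every point of `S` it extends to a smooth section on an open set. -/
def IsSmoothSectionOn (ψ : X → RPontryagin πY πB) (S : Set X) : Prop :=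
  IsSmoothLiftOn (𝓡 (n + 1)) (modelP n N K) projX id ψ S

/-- A smooth variation `(ψ_ε)`, `|ε| < ε₀`, of `ψ` among smooth sections on the closure of `U`:
`ψ_0 = ψ`, and the induced sections `φ_ε` of `Y → X` agree with `φ` on `∂U`. -/
structure IsVariation (U : Set X) (ψ : X → RPontryagin πY πB) (ε₀ : ℝ)
    (Ψ : ℝ → X → RPontryagin πY πB) : Prop where
  pos : 0 < ε₀
  smooth : IsSmoothLiftOn (𝓘(ℝ, ℝ).prod (𝓡 (n + 1))) (modelP n N K) projX Prod.snd
    (fun q : ℝ × X => Ψ q.1 q.2) (Ioo (-ε₀) ε₀ ×ˢ closure U)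
  initial : EqOn (Ψ 0) ψ (closure U)
  boundary : ∀ ε ∈ Ioo (-ε₀) ε₀, ∀ x ∈ frontier U, projY (Ψ ε x) = projY (ψ x)

/-- The action `∫_U ψ^* Θ_e`. -/
def action [T2Space X] [SigmaCompactSpace X] (o : ManifoldOrientation (m := n + 1) X)
    (e : EnergySection πY πB) (U : Set X) (ψ : X → RPontryagin πY πB) : ℝ :=
  formIntegral o U (formPullback ψ e.theta)

/-- `ψ` is a critical point of the variational principle `δ ∫_U ψ^* Θ_e = 0`: for all
variations `ψ_ε`, the derivative of `∫_U ψ_ε^* Θ_e` at `ε = 0` exists and vanishes. -/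
def IsCritical [T2Space X] [SigmaCompactSpace X] (o : ManifoldOrientation (m := n + 1) X)
    (e : EnergySection πY πB) (U : Set X) (ψ : X → RPontryagin πY πB) : Prop :=
  ∀ (ε₀ : ℝ) (Ψ : ℝ → X → RPontryagin πY πB), IsVariation U ψ ε₀ Ψ →
    HasDerivAt (fun ε => action o e U (Ψ ε)) 0 0

/-- `V` is a smooth vector field on `𝔓`, vertical for the projection `𝔓 → X`. -/
def IsVerticalField
    (V : (P : RPontryagin πY πB) → TangentSpace (modelP n N K) P) : Prop :=
  ContMDiff (modelP n N K) (modelP n N K).tangent ∞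
    (fun P => (⟨P, V P⟩ : TangentBundle (modelP n N K) (RPontryagin πY πB))) ∧
  ∀ P, mfderiv (modelP n N K) (𝓡 (n + 1)) projX P (V P) = 0

/-- `ψ^* (i_V Ω_e) = 0` on `U` for all vertical vector fields `V`. -/
def SatisfiesPullbackEq (e : EnergySection πY πB) (U : Set X) (ψ : X → RPontryagin πY πB) :
    Prop :=
  ∀ V : (P : RPontryagin πY πB) → TangentSpace (modelP n N K) P, IsVerticalField V →
    ∀ x ∈ U, formPullback (I := 𝓡 (n + 1)) ψ (interior V e.omega) x = 0

variable (πY πB) in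
/-- Local coordinates `(x^μ, y^A, b^α)` of `B → Y → X`: an adapted chart `(x^μ, y^A)` of `Y → X` and
a chart of `B` whose first component is the chart of `Y`. -/
structure AdaptedCoords where
  /-- the coordinates `(x^μ, y^A)` of `Y → X` -/
  chartY : AdaptedChart πY
  /-- the coordinates `((x^μ, y^A), b^α)` of `B` -/
  chart : OpenPartialHomeomorph B ((Euc (n + 1) × Euc N) × Euc K)
  chart_smooth : ContMDiffOn (𝓡 (n + 1 + N + K)) 𝓘(ℝ, (Euc (n + 1) × Euc N) × Euc K) ∞
    chart chart.source
  chart_symm_smooth : ContMDiffOn 𝓘(ℝ, (Euc (n + 1) × Euc N) × Euc K) (𝓡 (n + 1 + N + K)) ∞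
    chart.symm chart.target
  proj_mem : ∀ b ∈ chart.source, πB.proj b ∈ chartY.chart.source
  chart_fst : ∀ b ∈ chart.source, (chart b).1 = chartY.chart (πB.proj b)

namespace AdaptedCoords

variable (κ : AdaptedCoords πY πB)

/-- The momentum coordinates `p_A^μ` of a point of `𝔓` lying over the domain of the chart. -/
def momCoords (P : RPontryagin πY πB) : Mom (n + 1) N :=
  (momPretriv κ.chartY ⟨projY P, mom P⟩).2

/-- The point of `𝔓` with coordinates `(x^μ, y^A, b^α) = v`, where `v` lies in the target of the
chart, and `(p_A^μ) = P`. -/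
def point {v : (Euc (n + 1) × Euc N) × Euc K} (hv : v ∈ κ.chart.target) (P : Mom (n + 1) N) :
    RPontryagin πY πB :=
  ⟨κ.chart.symm v, (κ.chartY.momCoord (κ.proj_mem _ (κ.chart.map_target hv))).symm P⟩

/-- The local expression `e_loc(x^μ, y^A, p_A^μ, b^α)` of the energy section, i.e. minus the
coordinate `π` of `e`. The coordinate `π` of
`z = π d^{n+1}x + p_A^μ dy^A ∧ d^n x_μ` is `z(∂/∂x^0, …, ∂/∂x^n)`. -/
def eLoc (e : EnergySection πY πB) (v : (Euc (n + 1) × Euc N) × Euc K) (P : Mom (n + 1) N) : ℝ :=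
  open Classical in
  if hv : v ∈ κ.chart.target then
    - (e.comp (κ.point hv P)).1.toForm (fun μ =>
        (κ.chartY.chartDeriv (κ.proj_mem _ (κ.chart.map_target hv))).symm (stdVec μ, 0))
  else 0

end AdaptedCoords

/-- The local equations for `ψ` in the coordinates `κ`, at the point `x` of the base. -/
structure LocalEquationsAt (e : EnergySection πY πB) (ψ : X → RPontryagin πY πB)
    (κ : AdaptedCoords πY πB) (x : X) : Prop where
  /-- `∂ψ^A/∂x^μ = ∂e_loc/∂p_A^μ` -/
  field : ∀ (μ : Fin (n + 1)) (A : Fin N),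
    fderiv ℝ (fun u => (κ.chartY.chart (projY (ψ (κ.chartY.base.symm u)))).2 A)
        (κ.chartY.base x) (stdVec μ) =
      fderiv ℝ (fun P => κ.eLoc e (κ.chart (ψ x).proj) P) (κ.momCoords (ψ x))
        (Pi.single μ (Pi.single A 1))
  /-- `∑_μ ∂ψ_A^μ/∂x^μ = -∂e_loc/∂y^A` -/
  momentum : ∀ A : Fin N,
    ∑ μ : Fin (n + 1), fderiv ℝ (fun u => κ.momCoords (ψ (κ.chartY.base.symm u)) μ A)
        (κ.chartY.base x) (stdVec μ) =
      - fderiv ℝ (fun y => κ.eLoc e (((κ.chart (ψ x).proj).1.1, y), (κ.chart (ψ x).proj).2)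
          (κ.momCoords (ψ x))) (κ.chart (ψ x).proj).1.2 (stdVec A)
  /-- `∂e_loc/∂b^α = 0` -/
  control : ∀ α : Fin K,
    fderiv ℝ (fun b => κ.eLoc e ((κ.chart (ψ x).proj).1, b) (κ.momCoords (ψ x)))
      (κ.chart (ψ x).proj).2 (stdVec α) = 0

/-- `ψ` satisfies the local equations on `U`, in all local coordinates. -/
def SatisfiesLocalEq (e : EnergySection πY πB) (U : Set X) (ψ : X → RPontryagin πY πB) : Prop :=
  ∀ κ : AdaptedCoords πY πB, ∀ x ∈ U, (ψ x).proj ∈ κ.chart.source → LocalEquationsAt e ψ κ x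

end Conditions

end CovPontryagin

end

open CovPontryagin

/-! Everything rests on the local form Θ_e = -e_loc d^{n+1}x + p_A^μ dy^A ∧ d^n x_μ. The first
coefficient is the definition of e_loc. The second is the section property: μ(e(ϖ, b)) = ϖ
prescribes the linear part of the affine map given by the dual jet. Terms with two or more factors
dy^A are excluded because the values of e lie in Z. No expansion in a basis of forms is needed. It
is enough to know Θ_e on lifts w_μ of the coordinate frame ∂_μ (`thetaC_frame`), and on such lifts
with one entry replaced by a vertical vector (`thetaC_frame_update`). Naturality of the exterior
derivative gives Ω_e = -dΘ_e in coordinates (`omegaC_eq`), and for vertical V with components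
(V_A^μ, V^A, V^α) one finds in `omegaC_frame` that Ω_e(V, w_0, …, w_n) = de_loc(V) - V_A^μ (w_μ)^A +
(w_μ)_A^μ V^A. This is the Euler-Lagrange expression.

The pull-back condition and the local equations are then the same thing. With w_μ = ∂_μψ the
expression is linear in V, and its coefficients in the p, y and b directions are the three groups of
equations (`eulerLagrange_eq_zero_iff`). A form of top degree vanishes at a point as soon as it
vanishes on one coordinate frame, and every vertical vector extends to a global vertical field
(`exists_verticalField`).

Criticality is related to the pull-back condition by the first variation formula
(`IsVariation.hasDerivAt_action`): the derivative of the action is -∫_U ψ^*(i_V Ω_e), where V is the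
velocity of the variation. In coordinates the derivative of the density is minus the Euler-Lagrange
expression plus the divergence of the flux p_A^μ V^A, and V^A = 0 on ∂U. As U is an arbitrary
relatively compact open set, its frontier may be irregular and may even have positive measure, so
Stokes' theorem does not apply. Instead, a function vanishing on the frontier stays Lipschitz when
it is cut down to the set and extended by zero, and a directional derivative of a compactly
supported Lipschitz function has integral zero (`setIntegral_fderiv_eq_zero_of_frontier`). This is
used in coordinates, after multiplication by a partition of unity ρ_i. The resulting terms p_A^μ V^A
∂_μρ_i live in different charts; `fluxForm` expresses them intrinsically and linearly in dρ_i, so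
they cancel because ∑ dρ_i = 0 on U.

Since the velocity of a variation is vertical, the pull-back condition implies criticality at once.
Conversely, if i_W Ω_e does not vanish along ψ at some point, moving ψ in a fixed coordinate
direction with a small bump function makes the first variation nonzero
(`satisfiesPullbackEq_of_isCritical`). -/

noncomputable section

set_option linter.unusedSectionVars false

namespace CovPontryagin

/-! ### Smooth dependence of pulled-back alternating forms on the form and the map -/

section AlternatingSmooth

variable {E E' V : Type*} [NormedAddCommGroup E] [NormedSpace ℝ E] [FiniteDimensional ℝ E]
  [NormedAddCommGroup E'] [NormedSpace ℝ E'] [FiniteDimensional ℝ E']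
  [NormedAddCommGroup V] [NormedSpace ℝ V] {k : ℕ}

instance finiteDimensional_continuousMultilinearMap :
    FiniteDimensional ℝ (ContinuousMultilinearMap ℝ (fun _ : Fin k => E) ℝ) :=
  Module.Finite.of_injective
    (⟨⟨fun f : ContinuousMultilinearMap ℝ (fun _ : Fin k => E) ℝ => f.toMultilinearMap,
      fun _ _ => rfl⟩, fun _ _ => rfl⟩ :
      ContinuousMultilinearMap ℝ (fun _ : Fin k => E) ℝ →ₗ[ℝ] MultilinearMap ℝ (fun _ : Fin k => E) ℝ)
    ContinuousMultilinearMap.toMultilinearMap_injective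

instance finiteDimensional_continuousAlternatingMap :
    FiniteDimensional ℝ (E [⋀^Fin k]→L[ℝ] ℝ) :=
  Module.Finite.of_injective
    (ContinuousAlternatingMap.toContinuousMultilinearMapCLM ℝ (E := E) (F := ℝ) (ι := Fin k) (𝕜 := ℝ)
      ).toLinearMap ContinuousAlternatingMap.toContinuousMultilinearMap_injective

/-- Alternating maps embed in multilinear maps, and in finite dimensions a linear retraction is
automatically continuous. It lets smoothness statements be proved for multilinear maps and
transferred back. -/
theorem exists_leftInverse_toContinuousMultilinearMap :
    ∃ L : ContinuousMultilinearMap ℝ (fun _ : Fin k => E) ℝ →L[ℝ] (E [⋀^Fin k]→L[ℝ] ℝ),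
      ∀ f : E [⋀^Fin k]→L[ℝ] ℝ, L f.toContinuousMultilinearMap = f := by
  obtain ⟨L, hL⟩ := LinearMap.exists_leftInverse_of_injective
    (ContinuousAlternatingMap.toContinuousMultilinearMapCLM ℝ (E := E) (F := ℝ) (ι := Fin k) (𝕜 := ℝ)
      ).toLinearMap (LinearMap.ker_eq_bot.2
        ContinuousAlternatingMap.toContinuousMultilinearMap_injective)
  exact ⟨LinearMap.toContinuousLinearMap L, fun f => LinearMap.congr_fun hL f⟩

theorem contDiff_compContinuousLinearMap {r : WithTop ℕ∞} :
    ContDiff ℝ r (fun q : (E [⋀^Fin k]→L[ℝ] ℝ) × (E' →L[ℝ] E) =>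
      q.1.compContinuousLinearMap q.2) := by
  obtain ⟨L, hL⟩ := exists_leftInverse_toContinuousMultilinearMap (E := E') (k := k)
  have h : ContDiff ℝ r (fun q : (E [⋀^Fin k]→L[ℝ] ℝ) × (E' →L[ℝ] E) =>
      L (ContinuousMultilinearMap.compContinuousLinearMapContinuousMultilinear ℝ
        (fun _ : Fin k => E') (fun _ => E) ℝ (fun _ => q.2) q.1.toContinuousMultilinearMap)) := by
    refine L.contDiff.comp (ContDiff.clm_apply ?_ ?_)
    · exact (ContinuousMultilinearMap.contDiff _).comp (contDiff_pi.2 fun _ => contDiff_snd)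
    · exact (ContinuousAlternatingMap.toContinuousMultilinearMapCLM ℝ
        (E := E) (F := ℝ) (ι := Fin k) (𝕜 := ℝ)).contDiff.comp contDiff_fst
  convert h using 2 with q
  exact (hL _).symm

theorem contDiff_apply_alternating {r : WithTop ℕ∞} (w : Fin k → E) :
    ContDiff ℝ r (fun f : E [⋀^Fin k]→L[ℝ] ℝ => f w) :=
  (ContinuousAlternatingMap.apply ℝ E ℝ w).contDiff

end AlternatingSmooth

/-! ### Smoothness of the bundle of exterior forms -/

section ExtBundleSmooth

variable {d q : ℕ} {M : Type*} [TopologicalSpace M] [ChartedSpace (Euc d) M] [IsManifold (𝓡 d) ∞ M]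

/-- Coordinate changes of Λ^q T^*M are pull-backs by coordinate changes of TM, hence smooth
functions of smooth transition maps. -/
instance contMDiffVectorBundle_extFiber :
    ContMDiffVectorBundle ∞ (ExtModel d q) (ExtFiber d q M) (𝓡 d) := by
  have : (Bundle.ContinuousAlternatingMap.vectorPrebundle ℝ (Fin q) (Euc d)
      (TangentSpace (𝓡 d) (M := M)) ℝ (Bundle.Trivial M ℝ)).IsContMDiff (𝓡 d) ∞ := by
    refine ⟨?_⟩
    rintro _ ⟨e₁, e₂, he₁, he₂, rfl⟩ _ ⟨e₁', e₂', he₁', he₂', rfl⟩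
    refine ⟨Pretrivialization.continuousAlternatingMapCoordChange ℝ (Fin q) e₁ e₁' e₂ e₂', ?_,
      Pretrivialization.continuousAlternatingMapCoordChange_apply⟩
    -- Forms are contravariant in the tangent factor, so its transition runs from the new
    -- trivialization to the old one.
    have h₁ := contMDiffOn_coordChangeL (IB := 𝓡 d) e₁' e₁ (n := ∞)
    have h₂ := contMDiffOn_coordChangeL (IB := 𝓡 d) e₂ e₂' (n := ∞)
    have h₃ : ContDiff ℝ ∞ (fun s : (Euc d →L[ℝ] Euc d) × (ℝ →L[ℝ] ℝ) =>
        (ContinuousLinearMap.compContinuousAlternatingMapCLM (ι := Fin q) ℝ (Euc d) ℝ ℝ s.2).comp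
          (ContinuousAlternatingMap.compContinuousLinearMapCLM (ι := Fin q) (F := ℝ) s.1)) := by
      rw [contDiff_clm_apply_iff]
      intro L
      -- An endomorphism of the line is multiplication by its value at 1, so post-composition
      -- becomes a scalar factor.
      have h₄ : ContDiff ℝ ∞ (fun s : (Euc d →L[ℝ] Euc d) × (ℝ →L[ℝ] ℝ) =>
          s.2 1 • L.compContinuousLinearMap s.1) :=
        (contDiff_snd.clm_apply contDiff_const).smul
          (contDiff_compContinuousLinearMap.comp (contDiff_const.prodMk contDiff_fst))
      convert h₄ using 2 with s
      ext v
      change s.2 (L (s.1 ∘ v)) = s.2 1 * L (s.1 ∘ v)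
      rw [mul_comm, ← smul_eq_mul, ← map_smul, smul_eq_mul, mul_one]
    refine (h₃.contMDiff.comp_contMDiffOn
      ((h₁.mono ?_).prodMk_space (h₂.mono ?_))).congr fun b hb => ?_
    · exact fun b hb => ⟨hb.2.1, hb.1.1⟩
    · exact fun b hb => ⟨hb.1.2, hb.2.2⟩
    · rfl
  exact (Bundle.ContinuousAlternatingMap.vectorPrebundle ℝ (Fin q) (Euc d)
      (TangentSpace (𝓡 d) (M := M)) ℝ (Bundle.Trivial M ℝ)).contMDiffVectorBundle (𝓡 d)

end ExtBundleSmooth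

/-! ### Differential forms in charts and naturality of the exterior derivative -/

section FormCharts

variable {E : Type*} [NormedAddCommGroup E] [NormedSpace ℝ E] [FiniteDimensional ℝ E]
  {H : Type*} [TopologicalSpace H]
  {I : ModelWithCorners ℝ E H} [I.Boundaryless] {M : Type*} [TopologicalSpace M] [ChartedSpace H M]
  [IsManifold I ∞ M]
  {V : Type*} [NormedAddCommGroup V] [NormedSpace ℝ V] [FiniteDimensional ℝ V] {k : ℕ}

/-- The expression of a differential form in the preferred chart at `z₀`. -/
def chartForm (α : DiffForm I M k) (z₀ : M) (u : E) : E [⋀^Fin k]→L[ℝ] ℝ :=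
  (α ((extChartAt I z₀).symm u)).compContinuousLinearMap
    (mfderivWithin 𝓘(ℝ, E) I (extChartAt I z₀).symm (range I) u)

/-- The pull-back of a differential form to a vector space. -/
def pullbackVec (f : V → M) (α : DiffForm I M k) (v : V) : V [⋀^Fin k]→L[ℝ] ℝ :=
  formPullback (I := 𝓘(ℝ, V)) f α v

/-- Near v the map f is the inverse chart after its own chart expression. The chain rule then turns
the pull-back from a manifold into a pull-back between vector spaces. -/
theorem pullbackVec_eq_chartForm (α : DiffForm I M k) (z₀ : M) {f : V → M} {v : V}
    (hf : MDifferentiableAt 𝓘(ℝ, V) I f v) (hv : f v ∈ (extChartAt I z₀).source) :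
    pullbackVec f α v =
      (chartForm α z₀ (extChartAt I z₀ (f v))).compContinuousLinearMap
        (fderiv ℝ (extChartAt I z₀ ∘ f) v) := by
  have h1 : MDifferentiableAt I 𝓘(ℝ, E) (extChartAt I z₀) (f v) :=
    (contMDiffAt_extChartAt' (n := ∞) (by rwa [extChartAt_source] at hv)).mdifferentiableAt (by simp)
  have h2 : MDifferentiableWithinAt 𝓘(ℝ, E) I (extChartAt I z₀).symm (range I)
      (extChartAt I z₀ (f v)) :=
    (contMDiffWithinAt_extChartAt_symm_range (n := ∞) z₀ ((extChartAt I z₀).map_source hv)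
      ).mdifferentiableWithinAt (by simp)
  rw [I.range_eq_univ, mdifferentiableWithinAt_univ] at h2
  have h3 := (h1.comp v hf)
  have h4 : (extChartAt I z₀).symm ∘ (extChartAt I z₀ ∘ f) =ᶠ[𝓝 v] f := by
    filter_upwards [hf.continuousAt.preimage_mem_nhds
      ((isOpen_extChartAt_source z₀).mem_nhds hv)] with w hw
    exact (extChartAt I z₀).left_inv hw
  have h5 := h4.mfderiv_eq (I := 𝓘(ℝ, V)) (I' := I)
  have h6 := mfderiv_comp v (I := 𝓘(ℝ, V)) (I' := 𝓘(ℝ, E)) (I'' := I)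
    (g := (extChartAt I z₀).symm) h2 h3
  rw [mfderiv_eq_fderiv] at h6
  have h7 := h5.symm.trans h6
  unfold pullbackVec formPullback chartForm
  rw [h7, I.range_eq_univ, mfderivWithin_univ]
  ext w
  -- The form is evaluated at two base points that are only propositionally equal. All tangent
  -- spaces have the same underlying space E, so substitution identifies the values.
  have h8 : ∀ z z' : M, z = z' → ∀ u : Fin k → E, (α z : E [⋀^Fin k]→L[ℝ] ℝ) u =
    (α z' : E [⋀^Fin k]→L[ℝ] ℝ) u := by
    rintro z _ rfl u; rfl
  exact h8 _ _ ((extChartAt I z₀).left_inv hv).symm _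

theorem contDiffAt_extChartAt_comp (z₀ : M) {f : V → M} {v : V}
    (hf : ContMDiffAt 𝓘(ℝ, V) I ∞ f v) (hv : f v ∈ (extChartAt I z₀).source) :
    ContDiffAt ℝ ∞ (extChartAt I z₀ ∘ f) v := by
  rw [← contMDiffAt_iff_contDiffAt]
  exact (contMDiffAt_extChartAt' (n := ∞) (by rwa [extChartAt_source] at hv)).comp v hf

/-- The exterior derivative is natural. -/
theorem extDeriv_pullbackVec (α : DiffForm I M k) {f : V → M} {S : Set V} (hS : IsOpen S) {v : V}
    (hv : v ∈ S) (hf : ContMDiffOn 𝓘(ℝ, V) I ∞ f S)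
    (hα : DifferentiableAt ℝ (chartForm α (f v)) (extChartAt I (f v) (f v))) :
    extDeriv (pullbackVec f α) v =
      pullbackVec f (extDer α) v := by
  have hfv : ContMDiffAt 𝓘(ℝ, V) I ∞ f v := hf.contMDiffAt (hS.mem_nhds hv)
  have hsrc : ∀ᶠ v' in 𝓝 v, f v' ∈ (extChartAt I (f v)).source :=
    hfv.continuousAt.preimage_mem_nhds (extChartAt_source_mem_nhds (f v))
  have h1 : (pullbackVec f α) =ᶠ[𝓝 v]
      fun v' => (chartForm α (f v) ((extChartAt I (f v) ∘ f) v')).compContinuousLinearMap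
        (fderiv ℝ (extChartAt I (f v) ∘ f) v') := by
    filter_upwards [hsrc, hS.mem_nhds hv] with w hw hwS
    exact pullbackVec_eq_chartForm α (f v)
      ((hf.contMDiffAt (hS.mem_nhds hwS)).mdifferentiableAt (by simp)) hw
  have h0 : ContDiffAt ℝ ∞ (extChartAt I (f v) ∘ f) v :=
    contDiffAt_extChartAt_comp (f v) (f := f) hfv (mem_extChartAt_source _)
  rw [h1.extDeriv_eq]
  have h4 := extDeriv_pullback (f := extChartAt I (f v) ∘ f) (x := v) (r := ∞) hα h0
    (by rw [minSmoothness_of_isRCLikeNormedField]; exact WithTop.coe_le_coe.2 le_top)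
  refine h4.trans ?_
  have h2 := mfderiv_comp v (I := 𝓘(ℝ, V)) (I' := I) (I'' := 𝓘(ℝ, E))
    (g := extChartAt I (f v)) (mdifferentiableAt_extChartAt (mem_chart_source H (f v)))
      (hfv.mdifferentiableAt (by simp))
  rw [mfderiv_eq_fderiv] at h2
  rw [h2]
  unfold pullbackVec formPullback extDer
  rw [I.range_eq_univ, extDerivWithin_univ]
  have h3 : (fun u : E => ((α ((extChartAt I (f v)).symm u)).compContinuousLinearMap
        (mfderivWithin 𝓘(ℝ, E) I (extChartAt I (f v)).symm univ u) : E [⋀^Fin k]→L[ℝ] ℝ)) =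
      chartForm α (f v) := by
    unfold chartForm
    rw [I.range_eq_univ]
  rw [h3]
  rfl

theorem contDiffOn_pullbackVec (α : DiffForm I M k) {f : V → M} {S : Set V} (hS : IsOpen S)
    (hf : ContMDiffOn 𝓘(ℝ, V) I ∞ f S)
    (hα : ∀ z₀ : M, ContDiffOn ℝ ∞ (chartForm α z₀) (extChartAt I z₀).target) :
    ContDiffOn ℝ ∞ (pullbackVec f α) S := by
  intro v hv
  refine ContDiffAt.contDiffWithinAt ?_
  have hfv : ContMDiffAt 𝓘(ℝ, V) I ∞ f v := hf.contMDiffAt (hS.mem_nhds hv)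
  have hsrc : ∀ᶠ v' in 𝓝 v, f v' ∈ (extChartAt I (f v)).source :=
    hfv.continuousAt.preimage_mem_nhds (extChartAt_source_mem_nhds (f v))
  have h1 : (pullbackVec f α) =ᶠ[𝓝 v]
      fun v' => (chartForm α (f v) ((extChartAt I (f v) ∘ f) v')).compContinuousLinearMap
        (fderiv ℝ (extChartAt I (f v) ∘ f) v') := by
    filter_upwards [hsrc, hS.mem_nhds hv] with w hw hwS
    exact pullbackVec_eq_chartForm α (f v)
      ((hf.contMDiffAt (hS.mem_nhds hwS)).mdifferentiableAt (by simp)) hw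
  refine ContDiffAt.congr_of_eventuallyEq ?_ h1
  have h2 := contDiffAt_extChartAt_comp (f v) (f := f) hfv (mem_extChartAt_source _)
  have h3 : ContDiffAt ℝ ∞ (chartForm α (f v)) ((extChartAt I (f v) ∘ f) v) :=
    (hα (f v)).contDiffAt (extChartAt_target_mem_nhds (f v))
  exact contDiff_compContinuousLinearMap.contDiffAt.comp v
    ((h3.comp v h2).prodMk (h2.fderiv_right (m := ∞) (by simp)))

theorem formPullback_comp {E' : Type*} [NormedAddCommGroup E'] [NormedSpace ℝ E'] {H' : Type*}
    [TopologicalSpace H'] {I' : ModelWithCorners ℝ E' H'} {M' : Type*} [TopologicalSpace M']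
    [ChartedSpace H' M'] {E₀ : Type*} [NormedAddCommGroup E₀] [NormedSpace ℝ E₀] {H₀ : Type*}
    [TopologicalSpace H₀] {I₀ : ModelWithCorners ℝ E₀ H₀} {M₀ : Type*} [TopologicalSpace M₀]
    [ChartedSpace H₀ M₀] (α : DiffForm I M k) {f : M₀ → M'} {g : M' → M} {x : M₀}
    (hg : MDifferentiableAt I' I g (f x)) (hf : MDifferentiableAt I₀ I' f x) :
    formPullback (I := I₀) f (formPullback (I := I') g α) x =
      formPullback (I := I₀) (g ∘ f) α x := by
  unfold formPullback
  rw [mfderiv_comp x hg hf]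
  rfl

theorem formPullback_congr {E₀ : Type*} [NormedAddCommGroup E₀] [NormedSpace ℝ E₀] {H₀ : Type*}
    [TopologicalSpace H₀] {I₀ : ModelWithCorners ℝ E₀ H₀} {M₀ : Type*} [TopologicalSpace M₀]
    [ChartedSpace H₀ M₀] (α : DiffForm I M k) {f g : M₀ → M} {x : M₀}
    (h : f =ᶠ[𝓝 x] g) :
    formPullback (I := I₀) f α x = formPullback (I := I₀) g α x := by
  unfold formPullback
  rw [h.mfderiv_eq]
  have h8 : ∀ z z' : M, z = z' → ∀ u : Fin k → E, (α z : E [⋀^Fin k]→L[ℝ] ℝ) u =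
    (α z' : E [⋀^Fin k]→L[ℝ] ℝ) u := by
    rintro z _ rfl u; rfl
  ext w
  exact h8 _ _ h.self_of_nhds _

end FormCharts

/-! ### The canonical form is tautological in bundle charts -/

section CanonicalForm

variable {d q : ℕ} {M : Type*} [TopologicalSpace M] [ChartedSpace (Euc d) M] [IsManifold (𝓡 d) ∞ M]

/-- The fibre coordinate of z is its pull-back by the inverse chart of the base. -/
theorem extBundle_trivializationAt_apply (y₀ : M) (z : ExtBundle d q M) (hz : z.proj ∈ (chartAt (Euc d) y₀).source) :
    trivializationAt (ExtModel d q) (ExtFiber d q M) y₀ z =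
      (z.proj, (z.2.toForm : Euc d [⋀^Fin q]→L[ℝ] ℝ).compContinuousLinearMap
        (mfderivWithin 𝓘(ℝ, Euc d) (𝓡 d) (extChartAt (𝓡 d) y₀).symm (range (𝓡 d))
          (extChartAt (𝓡 d) y₀ z.proj))) := by
  have h := FiberBundle.trivializationAt_continuousAlternatingMap_apply (𝕜 := ℝ) (ι := Fin q)
    (F₁ := Euc d) (E₁ := TangentSpace (𝓡 d) (M := M)) (F₂ := ℝ) (E₂ := Bundle.Trivial M ℝ) y₀ z
  refine h.trans ?_
  rw [ContinuousAlternatingMap.inCoordinates, TangentBundle.symmL_trivializationAt hz]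
  ext1
  · rfl
  · ext v
    simp
    rfl

theorem extBundle_extChartAt_apply (z₀ z : ExtBundle d q M)
    (hz : z.proj ∈ (chartAt (Euc d) z₀.proj).source) :
    extChartAt ((𝓡 d).prod 𝓘(ℝ, ExtModel d q)) z₀ z =
      (extChartAt (𝓡 d) z₀.proj z.proj, (z.2.toForm : Euc d [⋀^Fin q]→L[ℝ] ℝ).compContinuousLinearMap
        (mfderivWithin 𝓘(ℝ, Euc d) (𝓡 d) (extChartAt (𝓡 d) z₀.proj).symm (range (𝓡 d))
          (extChartAt (𝓡 d) z₀.proj z.proj))) := by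
  rw [FiberBundle.extChartAt]
  change (extChartAt (𝓡 d) z₀.proj (trivializationAt (ExtModel d q) (ExtFiber d q M) z₀.proj z).1,
    (trivializationAt (ExtModel d q) (ExtFiber d q M) z₀.proj z).2) = _
  rw [extBundle_trivializationAt_apply _ _ hz]
  rfl

/-- In a bundle chart the projection is (x, ζ) ↦ x and the fibre coordinate ζ is already the form
read in the chart, so Θ at (x, ζ) is ζ applied to the base components. This makes the smoothness of
Θ evident. -/
theorem chartForm_canonicalForm (z₀ : ExtBundle d q M) {u : Euc d × ExtModel d q}
    (hu : u ∈ (extChartAt ((𝓡 d).prod 𝓘(ℝ, ExtModel d q)) z₀).target) :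
    chartForm (canonicalForm M q) z₀ u =
      u.2.compContinuousLinearMap (ContinuousLinearMap.fst ℝ (Euc d) (ExtModel d q)) := by
  set J := (𝓡 d).prod 𝓘(ℝ, ExtModel d q)
  have hbase : ∀ w ∈ (extChartAt J z₀).target,
      ((extChartAt J z₀).symm w).proj ∈ (chartAt (Euc d) z₀.proj).source ∧
      w = extChartAt J z₀ ((extChartAt J z₀).symm w) := by
    intro w hw
    refine ⟨?_, ((extChartAt J z₀).right_inv hw).symm⟩
    have h1 : (extChartAt J z₀).symm w ∈ (extChartAt J z₀).source :=
      (extChartAt J z₀).map_target hw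
    rw [FiberBundle.extChartAt] at h1
    exact h1.1.1
  have hbase' : ∀ w ∈ (extChartAt J z₀).target,
      ((extChartAt J z₀).symm w).proj = (extChartAt (𝓡 d) z₀.proj).symm w.1 := by
    intro w hw
    obtain ⟨h1, h2⟩ := hbase w hw
    rw [extBundle_extChartAt_apply _ _ h1] at h2
    have h3 : w.1 = extChartAt (𝓡 d) z₀.proj ((extChartAt J z₀).symm w).proj := congrArg Prod.fst h2
    rw [h3]
    exact ((extChartAt (𝓡 d) z₀.proj).left_inv (by rwa [extChartAt_source])).symm
  obtain ⟨hz, huz⟩ := hbase u hu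
  have h6 : (extChartAt J z₀).target ∈ 𝓝 u := (isOpen_extChartAt_target z₀).mem_nhds hu
  have h7 : (Bundle.TotalSpace.proj : ExtBundle d q M → M) ∘ (extChartAt J z₀).symm =ᶠ[𝓝 u]
      (extChartAt (𝓡 d) z₀.proj).symm ∘ Prod.fst := by
    filter_upwards [h6] with w hw using hbase' w hw
  have hu1 : u.1 ∈ (extChartAt (𝓡 d) z₀.proj).target := by
    rw [FiberBundle.extChartAt_target] at hu
    exact hu.1.1
  have h8 : MDifferentiableAt 𝓘(ℝ, Euc d) (𝓡 d) (extChartAt (𝓡 d) z₀.proj).symm u.1 :=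
    ((contMDiffOn_extChartAt_symm (n := ∞) z₀.proj).contMDiffAt
      ((isOpen_extChartAt_target z₀.proj).mem_nhds hu1)).mdifferentiableAt (by simp)
  have h9 : MDifferentiableAt 𝓘(ℝ, Euc d × ExtModel d q) J (extChartAt J z₀).symm u :=
    ((contMDiffOn_extChartAt_symm (n := ∞) z₀).contMDiffAt h6).mdifferentiableAt (by simp)
  have h10 : MDifferentiableAt J (𝓡 d) (Bundle.TotalSpace.proj : ExtBundle d q M → M)
      ((extChartAt J z₀).symm u) :=
    (contMDiff_proj (n := ∞) (ExtFiber d q M)).mdifferentiableAt (by simp)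
  have h11 := (h10.hasMFDerivAt.comp u h9.hasMFDerivAt).congr_of_eventuallyEq h7.symm
  have h12 : HasMFDerivAt 𝓘(ℝ, Euc d × ExtModel d q) (𝓡 d)
      ((extChartAt (𝓡 d) z₀.proj).symm ∘ Prod.fst) u
      ((mfderiv 𝓘(ℝ, Euc d) (𝓡 d) (extChartAt (𝓡 d) z₀.proj).symm u.1).comp
        (ContinuousLinearMap.fst ℝ (Euc d) (ExtModel d q))) :=
    h8.hasMFDerivAt.comp u (ContinuousLinearMap.fst ℝ (Euc d) (ExtModel d q)).hasMFDerivAt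
  have h13 := hasMFDerivAt_unique h11 h12
  -- The second component of u, as the fibre coordinate of the point it represents, is that point's
  -- form composed with the differential of the inverse base chart.
  have h14 : u.2 = (((extChartAt J z₀).symm u).2.toForm : Euc d [⋀^Fin q]→L[ℝ] ℝ
      ).compContinuousLinearMap (mfderiv 𝓘(ℝ, Euc d) (𝓡 d) (extChartAt (𝓡 d) z₀.proj).symm u.1) := by
    rw [extBundle_extChartAt_apply _ _ hz] at huz
    have h15 := congrArg Prod.snd huz
    have h16 : extChartAt (𝓡 d) z₀.proj ((extChartAt J z₀).symm u).proj = u.1 :=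
      (congrArg Prod.fst huz).symm
    dsimp only at h15
    rw [h16, ModelWithCorners.range_eq_univ, mfderivWithin_univ] at h15
    exact h15
  rw [h14]
  unfold chartForm canonicalForm
  rw [ModelWithCorners.range_eq_univ, mfderivWithin_univ]
  ext w
  have h16 : ∀ i, (mfderiv J (𝓡 d) (Bundle.TotalSpace.proj : ExtBundle d q M → M)
      ((extChartAt J z₀).symm u)) (mfderiv 𝓘(ℝ, Euc d × ExtModel d q) J (extChartAt J z₀).symm u (w i))
      = mfderiv 𝓘(ℝ, Euc d) (𝓡 d) (extChartAt (𝓡 d) z₀.proj).symm u.1 (w i).1 := fun i =>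
    congrArg (fun L : (Euc d × ExtModel d q) →L[ℝ] Euc d => L (w i)) h13
  exact congrArg (((extChartAt J z₀).symm u).2.toForm : Euc d [⋀^Fin q]→L[ℝ] ℝ) (funext h16)

theorem contDiffOn_chartForm_canonicalForm (z₀ : ExtBundle d q M) :
    ContDiffOn ℝ ∞ (chartForm (canonicalForm M q) z₀)
      (extChartAt ((𝓡 d).prod 𝓘(ℝ, ExtModel d q)) z₀).target :=
  (contDiff_compContinuousLinearMap.comp (contDiff_snd.prodMk contDiff_const)
    ).contDiffOn.congr fun _ hu => chartForm_canonicalForm z₀ hu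

end CanonicalForm

/-! ### Smoothness of the canonical map from a pulled-back bundle -/

section PullbackLift

variable {d d' : ℕ} {M M' : Type*} [TopologicalSpace M] [ChartedSpace (Euc d) M]
  [TopologicalSpace M'] [ChartedSpace (Euc d') M']
  {F : Type*} [NormedAddCommGroup F] [NormedSpace ℝ F] {E : M → Type*} [∀ y, AddCommGroup (E y)]
  [∀ y, Module ℝ (E y)] [TopologicalSpace (TotalSpace F E)] [∀ y, TopologicalSpace (E y)]
  [FiberBundle F E]

theorem contMDiff_pullbackLift (f : C^∞⟮𝓡 d', M'; 𝓡 d, M⟯) :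
    ContMDiff ((𝓡 d').prod 𝓘(ℝ, F)) ((𝓡 d).prod 𝓘(ℝ, F)) ∞
      (Pullback.lift (f : M' → M) : TotalSpace F ((f : M' → M) *ᵖ E) → TotalSpace F E) := by
  intro z
  rw [contMDiffAt_totalSpace]
  refine ⟨?_, ?_⟩
  · exact (f.contMDiff.comp (contMDiff_proj ((f : M' → M) *ᵖ E))) z
  · exact ((contMDiffAt_totalSpace (F := F) (E := ((f : M' → M) *ᵖ E)) (f := id) (x₀ := z)).1
      contMDiffAt_id).2

end PullbackLift

/-! ### Coordinates on the restricted Pontryagin bundle -/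

section Coordinates

variable {n N K : ℕ} {X Y B FY FB : Type*}
  [TopologicalSpace X] [ChartedSpace (Euc (n + 1)) X] [IsManifold (𝓡 (n + 1)) ∞ X]
  [TopologicalSpace Y] [ChartedSpace (Euc (n + 1 + N)) Y] [IsManifold (𝓡 (n + 1 + N)) ∞ Y]
  [TopologicalSpace B] [ChartedSpace (Euc (n + 1 + N + K)) B]
  [IsManifold (𝓡 (n + 1 + N + K)) ∞ B]
  [TopologicalSpace FY] [ChartedSpace (Euc N) FY] [IsManifold (𝓡 N) ∞ FY]
  [TopologicalSpace FB] [ChartedSpace (Euc K) FB]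
  {πY : SmoothFiberBundle (n + 1 + N) (n + 1) N Y X FY}
  {πB : SmoothFiberBundle (n + 1 + N + K) (n + 1 + N) K B Y FB}

/-- The coordinate space of `𝔓`, with points `(((x, y), b), p)`. -/
abbrev CoordP (n N K : ℕ) : Type := ((Euc (n + 1) × Euc N) × Euc K) × Mom (n + 1) N

namespace AdaptedCoords

variable (κ : AdaptedCoords πY πB)

/-- The coordinates of a point of `𝔓`. -/
def toCoord (P : RPontryagin πY πB) : CoordP n N K := (κ.chart P.proj, κ.momCoords P)

/-- The point of `𝔓` with given coordinates. -/
def ofCoord (q : CoordP n N K) : RPontryagin πY πB :=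
  ⟨κ.chart.symm q.1, open Classical in
    if h : q.1 ∈ κ.chart.target then
      (κ.chartY.momCoord (κ.proj_mem _ (κ.chart.map_target h))).symm q.2
    else (0 : RestrictedDualJet πY (πB.proj (κ.chart.symm q.1)))⟩

theorem ofCoord_eq_point {q : CoordP n N K} (h : q.1 ∈ κ.chart.target) :
    κ.ofCoord q = κ.point h q.2 := by
  unfold ofCoord point
  exact congrArg (TotalSpace.mk _) (dif_pos h)

theorem ofCoord_proj_mem {q : CoordP n N K} (h : q.1 ∈ κ.chart.target) :
    (κ.ofCoord q).proj ∈ κ.chart.source := κ.chart.map_target h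

theorem toCoord_fst_mem {P : RPontryagin πY πB} (h : P.proj ∈ κ.chart.source) :
    (κ.toCoord P).1 ∈ κ.chart.target := κ.chart.map_source h

theorem momCoords_eq {P : RPontryagin πY πB} (h : P.proj ∈ κ.chart.source) :
    κ.momCoords P = κ.chartY.momCoord (κ.proj_mem _ h) P.2 :=
  congrArg Prod.snd (momPretriv_apply κ.chartY (κ.proj_mem _ h) P.2)

theorem toCoord_ofCoord {q : CoordP n N K} (h : q.1 ∈ κ.chart.target) :
    κ.toCoord (κ.ofCoord q) = q := by
  ext1
  · exact κ.chart.right_inv h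
  · change κ.momCoords (κ.ofCoord q) = q.2
    rw [κ.ofCoord_eq_point h]
    refine (κ.momCoords_eq (P := κ.point h q.2) (κ.chart.map_target h)).trans ?_
    exact ContinuousLinearEquiv.apply_symm_apply _ _

/-- The trivialization of `𝔓 → B` by momentum coordinates. -/
def momTriv : Trivialization (Mom (n + 1) N)
    (π (Mom (n + 1) N) ((πB.proj : B → Y) *ᵖ (RestrictedDualJet πY))) :=
  ((restrictedDualJetPrebundle πY).trivializationOfMemPretrivializationAtlas
    (e := momPretriv κ.chartY) (mem_range_self _)).pullback πB.proj

/-- The momentum coordinates of every adapted chart belong to the defining atlas of Π, so their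
smoothness comes from the bundle structure. -/
instance momTriv_mem : MemTrivializationAtlas κ.momTriv :=
  ⟨⟨_, ⟨⟨_, ⟨mem_range_self κ.chartY, rfl⟩⟩⟩, rfl⟩⟩

theorem momTriv_apply (P : RPontryagin πY πB) : κ.momTriv P = (P.proj, κ.momCoords P) := rfl

theorem mem_momTriv_source {P : RPontryagin πY πB} (h : P.proj ∈ κ.chart.source) :
    P ∈ κ.momTriv.source := by
  rw [Trivialization.mem_source]
  exact κ.proj_mem _ h

theorem ofCoord_toCoord {P : RPontryagin πY πB} (h : P.proj ∈ κ.chart.source) :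
    κ.ofCoord (κ.toCoord P) = P := by
  have h1 := κ.toCoord_ofCoord (κ.toCoord_fst_mem h)
  have h2 : (κ.ofCoord (κ.toCoord P)).proj = P.proj := κ.chart.left_inv h
  -- The two points lie over base points that are only propositionally equal; injectivity of a
  -- trivialization avoids transporting fibre elements.
  refine κ.momTriv.injOn (κ.mem_momTriv_source (by rw [h2]; exact h)) (κ.mem_momTriv_source h) ?_
  change κ.momTriv _ = κ.momTriv _
  have h3 : κ.momCoords (κ.ofCoord (κ.toCoord P)) = κ.momCoords P :=
    congrArg (fun q : CoordP n N K => q.2) h1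
  rw [momTriv_apply, momTriv_apply, h2, h3]

theorem isOpen_source : IsOpen {P : RPontryagin πY πB | P.proj ∈ κ.chart.source} :=
  κ.chart.open_source.preimage (FiberBundle.continuous_proj _ _)

theorem isOpen_target : IsOpen {q : CoordP n N K | q.1 ∈ κ.chart.target} :=
  κ.chart.open_target.preimage continuous_fst

theorem contMDiffOn_toCoord :
    ContMDiffOn (modelP n N K) 𝓘(ℝ, CoordP n N K) ∞ κ.toCoord
      {P : RPontryagin πY πB | P.proj ∈ κ.chart.source} := by
  have h1 : ContMDiffOn (modelP n N K) 𝓘(ℝ, (Euc (n + 1) × Euc N) × Euc K) ∞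
      (fun P : RPontryagin πY πB => κ.chart P.proj) {P | P.proj ∈ κ.chart.source} :=
    κ.chart_smooth.comp (contMDiff_proj _).contMDiffOn fun P hP => hP
  have h2 : ContMDiffOn (modelP n N K) 𝓘(ℝ, Mom (n + 1) N) ∞
      (fun P : RPontryagin πY πB => (κ.momTriv P).2) {P | P.proj ∈ κ.chart.source} :=
    contMDiff_snd.comp_contMDiffOn
      ((κ.momTriv.contMDiffOn (IB := 𝓡 (n + 1 + N + K)) (n := ∞)).mono
        fun P hP => κ.mem_momTriv_source hP)
  exact h1.prodMk_space h2

theorem contMDiffOn_ofCoord :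
    ContMDiffOn 𝓘(ℝ, CoordP n N K) (modelP n N K) ∞ κ.ofCoord
      {q : CoordP n N K | q.1 ∈ κ.chart.target} := by
  have h1 : ContMDiffOn 𝓘(ℝ, CoordP n N K) ((𝓡 (n + 1 + N + K)).prod 𝓘(ℝ, Mom (n + 1) N)) ∞
      (fun q : CoordP n N K => (κ.chart.symm q.1, q.2)) {q | q.1 ∈ κ.chart.target} :=
    (κ.chart_symm_smooth.comp contDiff_fst.contMDiff.contMDiffOn fun q hq => hq).prodMk
      contDiff_snd.contMDiff.contMDiffOn
  have hm : ∀ q : CoordP n N K, q.1 ∈ κ.chart.target → (κ.chart.symm q.1, q.2) ∈ κ.momTriv.target := by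
    intro q hq
    rw [Trivialization.mem_target]
    exact κ.proj_mem _ (κ.chart.map_target hq)
  refine ((κ.momTriv.contMDiffOn_symm (IB := 𝓡 (n + 1 + N + K)) (n := ∞)).comp h1 hm).congr ?_
  intro q hq
  have hq' : q.1 ∈ κ.chart.target := hq
  have h2 : κ.momTriv (κ.ofCoord q) = (κ.chart.symm q.1, q.2) := by
    rw [momTriv_apply]
    exact congrArg (Prod.mk _) (congrArg (fun q : CoordP n N K => q.2) (κ.toCoord_ofCoord hq'))
  change κ.ofCoord q = κ.momTriv.toOpenPartialHomeomorph.symm (κ.chart.symm q.1, q.2)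
  rw [← h2]
  exact (κ.momTriv.toOpenPartialHomeomorph.left_inv
    (κ.mem_momTriv_source (κ.ofCoord_proj_mem hq'))).symm

theorem projY_ofCoord_mem {q : CoordP n N K} (h : q.1 ∈ κ.chart.target) :
    projY (κ.ofCoord q) ∈ κ.chartY.chart.source := κ.proj_mem _ (κ.ofCoord_proj_mem h)

theorem chartY_projY {P : RPontryagin πY πB} (h : P.proj ∈ κ.chart.source) :
    κ.chartY.chart (projY P) = (κ.toCoord P).1.1 := (κ.chart_fst _ h).symm

theorem base_projX {P : RPontryagin πY πB} (h : P.proj ∈ κ.chart.source) :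
    κ.chartY.base (projX P) = (κ.toCoord P).1.1.1 := by
  rw [← κ.chartY_projY h]
  exact (κ.chartY.chart_fst _ (κ.proj_mem _ h)).symm

theorem projX_mem {P : RPontryagin πY πB} (h : P.proj ∈ κ.chart.source) :
    projX P ∈ κ.chartY.base.source := κ.chartY.proj_mem _ (κ.proj_mem _ h)

theorem chartY_projY_ofCoord {q : CoordP n N K} (h : q.1 ∈ κ.chart.target) :
    κ.chartY.chart (projY (κ.ofCoord q)) = q.1.1 := by
  rw [κ.chartY_projY (κ.ofCoord_proj_mem h), κ.toCoord_ofCoord h]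

theorem base_projX_ofCoord {q : CoordP n N K} (h : q.1 ∈ κ.chart.target) :
    κ.chartY.base (projX (κ.ofCoord q)) = q.1.1.1 := by
  rw [κ.base_projX (κ.ofCoord_proj_mem h), κ.toCoord_ofCoord h]

end AdaptedCoords

theorem contMDiff_projX :
    ContMDiff (modelP n N K) (𝓡 (n + 1)) ∞ (projX : RPontryagin πY πB → X) :=
  πY.proj.contMDiff.comp (πB.proj.contMDiff.comp (contMDiff_proj _))

theorem contMDiff_projY :
    ContMDiff (modelP n N K) (𝓡 (n + 1 + N)) ∞ (projY : RPontryagin πY πB → Y) :=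
  πB.proj.contMDiff.comp (contMDiff_proj _)

/-- A chart adapted to B → Y carries base coordinates from a chart of Y that need not be adapted to
Y → X. Applying the transition map τ to those coordinates alone repairs this and leaves the b^α
unchanged. -/
theorem exists_adaptedCoords [IsManifold (𝓡 K) ∞ FB] (b : B) :
    ∃ κ : AdaptedCoords πY πB, b ∈ κ.chart.source := by
  obtain ⟨c, hc⟩ := πY.exists_adaptedChart (πB.proj b)
  obtain ⟨c', hc'⟩ := πB.exists_adaptedChart b
  let τ : OpenPartialHomeomorph (Euc (n + 1 + N)) (Euc (n + 1) × Euc N) := c'.base.symm.trans c.chart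
  let σ : OpenPartialHomeomorph (Euc (n + 1 + N) × Euc K) ((Euc (n + 1) × Euc N) × Euc K) :=
    τ.prod (OpenPartialHomeomorph.refl (Euc K))
  have hτ : ContDiffOn ℝ ∞ τ τ.source := by
    rw [← contMDiffOn_iff_contDiffOn]
    exact c.chart_smooth.comp (c'.base_symm_smooth.mono fun u hu => hu.1) fun u hu => hu.2
  have hτ' : ContDiffOn ℝ ∞ τ.symm τ.target := by
    rw [← contMDiffOn_iff_contDiffOn]
    refine c'.base_smooth.comp (c.chart_symm_smooth.mono fun u hu => ?_) fun u hu => ?_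
    · rw [OpenPartialHomeomorph.trans_target] at hu
      exact hu.1
    · rw [OpenPartialHomeomorph.trans_target] at hu
      exact hu.2
  have hσ : ContDiffOn ℝ ∞ σ σ.source :=
    (hτ.comp contDiff_fst.contDiffOn fun u hu => hu.1).prodMk contDiff_snd.contDiffOn
  have hσ' : ContDiffOn ℝ ∞ σ.symm σ.target :=
    (hτ'.comp contDiff_fst.contDiffOn fun u hu => hu.1).prodMk contDiff_snd.contDiffOn
  have hmem : ∀ z ∈ (c'.chart.trans σ).source,
      z ∈ c'.chart.source ∧ πB.proj z ∈ c.chart.source := by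
    intro z hz
    rw [OpenPartialHomeomorph.trans_source] at hz
    have h1 : c.chart.source.Mem (c'.base.symm (c'.chart z).1) := hz.2.1.2
    rw [c'.chart_fst z hz.1, c'.base.left_inv (c'.proj_mem z hz.1)] at h1
    exact ⟨hz.1, h1⟩
  refine ⟨⟨c, c'.chart.trans σ, ?_, ?_, fun z hz => (hmem z hz).2, ?_⟩, ?_⟩
  · exact hσ.contMDiffOn.comp (c'.chart_smooth.mono fun z hz => hz.1) fun z hz => hz.2
  · refine c'.chart_symm_smooth.comp (hσ'.contMDiffOn.mono fun z hz => ?_) fun z hz => ?_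
    · rw [OpenPartialHomeomorph.trans_target] at hz
      exact hz.1
    · rw [OpenPartialHomeomorph.trans_target] at hz
      exact hz.2
  · intro z hz
    change c.chart (c'.base.symm (c'.chart z).1) = _
    rw [c'.chart_fst z (hmem z hz).1, c'.base.left_inv (c'.proj_mem z (hmem z hz).1)]
  · rw [OpenPartialHomeomorph.trans_source]
    refine ⟨hc', ⟨?_, ?_⟩, mem_univ _⟩
    · change (c'.chart b).1 ∈ c'.base.target
      rw [c'.chart_fst b hc']
      exact c'.base.map_source (c'.proj_mem b hc')
    · change c'.base.symm (c'.chart b).1 ∈ c.chart.source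
      rw [c'.chart_fst b hc', c'.base.left_inv (c'.proj_mem b hc')]
      exact hc

end Coordinates

/-! ### Multilinear maps that vanish on two vertical arguments -/

section Algebra

variable {m k : ℕ}

/-- In the expansion of f(a + b) only the terms with at most one entry from b survive. With b
vertical, this is why a dual jet is affine in the vertical parts of its arguments. -/
theorem multilinear_map_add_eq {E : Type*} [AddCommGroup E] [Module ℝ E]
    (f : MultilinearMap ℝ (fun _ : Fin m => E) ℝ) (a b : Fin m → E)
    (h : ∀ w : Fin m → E, (∃ i j, i ≠ j ∧ w i = b i ∧ w j = b j) → f w = 0) :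
    f (a + b) = f a + ∑ i, f (Function.update a i (b i)) := by
  rw [MultilinearMap.map_add_eq_map_add_linearDeriv_add, MultilinearMap.linearDeriv_apply]
  rw [add_eq_left]
  refine Finset.sum_eq_zero fun s hs => h _ ?_
  have h2 : 1 < s.card := (Finset.mem_filter.1 hs).2
  obtain ⟨i, hi, j, hj, hij⟩ := Finset.one_lt_card.1 h2
  exact ⟨i, j, hij, Finset.piecewise_eq_of_mem _ _ _ hi, Finset.piecewise_eq_of_mem _ _ _ hj⟩

end Algebra

/-! ### The Cartan form in coordinates -/

section LocalCartan

variable {n N K : ℕ} {X Y B FY FB : Type*}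
  [TopologicalSpace X] [ChartedSpace (Euc (n + 1)) X] [IsManifold (𝓡 (n + 1)) ∞ X]
  [TopologicalSpace Y] [ChartedSpace (Euc (n + 1 + N)) Y] [IsManifold (𝓡 (n + 1 + N)) ∞ Y]
  [TopologicalSpace B] [ChartedSpace (Euc (n + 1 + N + K)) B]
  [IsManifold (𝓡 (n + 1 + N + K)) ∞ B]
  [TopologicalSpace FY] [ChartedSpace (Euc N) FY] [IsManifold (𝓡 N) ∞ FY]
  [TopologicalSpace FB] [ChartedSpace (Euc K) FB]
  {πY : SmoothFiberBundle (n + 1 + N) (n + 1) N Y X FY}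
  {πB : SmoothFiberBundle (n + 1 + N + K) (n + 1 + N) K B Y FB}

namespace EnergySection

variable (e : EnergySection πY πB)

/-- The `J^1 Y^⋆`-component of an energy section. -/
def jet (P : RPontryagin πY πB) : ExtBundle (n + 1 + N) (n + 1) Y :=
  Pullback.lift (πB.proj : B → Y) (e.toFun P)

theorem contMDiff_jet :
    ContMDiff (modelP n N K) ((𝓡 (n + 1 + N)).prod 𝓘(ℝ, ExtModel (n + 1 + N) (n + 1))) ∞ e.jet :=
  (contMDiff_pullbackLift πB.proj).comp e.smooth

/-- The forms on ℨ are themselves pulled back from the bundle of forms on Y, so the two pull-backs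
merge into one along the form component of the energy section. -/
theorem formPullback_lift_toFun {k : ℕ}
    (α : DiffForm ((𝓡 (n + 1 + N)).prod 𝓘(ℝ, ExtModel (n + 1 + N) (n + 1)))
      (ExtBundle (n + 1 + N) (n + 1) Y) k) :
    formPullback (I := modelP n N K) e.toFun
      (formPullback (I := modelZ n N K) (Pullback.lift (πB.proj : B → Y)) α) =
      formPullback (I := modelP n N K) e.jet α := by
  funext P
  exact formPullback_comp α
    ((contMDiff_pullbackLift (E := ExtFiber (n + 1 + N) (n + 1) Y) πB.proj).mdifferentiableAt
      (by simp)) (ContMDiff.mdifferentiableAt e.smooth (by simp))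

theorem theta_eq : e.theta = formPullback (I := modelP n N K) e.jet (canonicalForm Y (n + 1)) :=
  e.formPullback_lift_toFun _

theorem omega_eq :
    e.omega = formPullback (I := modelP n N K) e.jet (multisymplecticForm Y (n + 1)) :=
  e.formPullback_lift_toFun _

end EnergySection

namespace AdaptedCoords

variable (κ : AdaptedCoords πY πB) (e : EnergySection πY πB)

/-- The Cartan form `Θ_e` in coordinates. -/
def thetaC (q : CoordP n N K) : CoordP n N K [⋀^Fin (n + 1)]→L[ℝ] ℝ :=
  pullbackVec (I := modelP n N K) κ.ofCoord e.theta q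

/-- The Cartan form `Ω_e` in coordinates. -/
def omegaC (q : CoordP n N K) : CoordP n N K [⋀^Fin (n + 2)]→L[ℝ] ℝ :=
  pullbackVec (I := modelP n N K) κ.ofCoord e.omega q

theorem contMDiffAt_ofCoord {q : CoordP n N K} (hq : q.1 ∈ κ.chart.target) :
    ContMDiffAt 𝓘(ℝ, CoordP n N K) (modelP n N K) ∞ κ.ofCoord q :=
  κ.contMDiffOn_ofCoord.contMDiffAt (κ.isOpen_target.mem_nhds hq)

theorem pullbackVec_formPullback_jet {k : ℕ}
    (α : DiffForm ((𝓡 (n + 1 + N)).prod 𝓘(ℝ, ExtModel (n + 1 + N) (n + 1)))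
      (ExtBundle (n + 1 + N) (n + 1) Y) k) {q : CoordP n N K} (hq : q.1 ∈ κ.chart.target) :
    pullbackVec (I := modelP n N K) κ.ofCoord (formPullback (I := modelP n N K) e.jet α) q =
      pullbackVec (e.jet ∘ κ.ofCoord) α q :=
  formPullback_comp α (e.contMDiff_jet.mdifferentiableAt (by simp))
    ((κ.contMDiffAt_ofCoord hq).mdifferentiableAt (by simp))

theorem thetaC_eq {q : CoordP n N K} (hq : q.1 ∈ κ.chart.target) :
    κ.thetaC e q = pullbackVec (e.jet ∘ κ.ofCoord) (canonicalForm Y (n + 1)) q := by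
  rw [thetaC, e.theta_eq, κ.pullbackVec_formPullback_jet e _ hq]

theorem contMDiffOn_jet_ofCoord :
    ContMDiffOn 𝓘(ℝ, CoordP n N K) ((𝓡 (n + 1 + N)).prod 𝓘(ℝ, ExtModel (n + 1 + N) (n + 1))) ∞
      (e.jet ∘ κ.ofCoord) {q : CoordP n N K | q.1 ∈ κ.chart.target} :=
  e.contMDiff_jet.comp_contMDiffOn κ.contMDiffOn_ofCoord

theorem contDiffOn_thetaC :
    ContDiffOn ℝ ∞ (κ.thetaC e) {q : CoordP n N K | q.1 ∈ κ.chart.target} :=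
  (contDiffOn_pullbackVec _ κ.isOpen_target (κ.contMDiffOn_jet_ofCoord e)
    contDiffOn_chartForm_canonicalForm).congr fun _ hq => κ.thetaC_eq e hq

/-- Ω_e is defined as the pull-back of -dΘ. That it is also minus the derivative of the pull-back of
Θ is naturality of d. -/
theorem omegaC_eq {q : CoordP n N K} (hq : q.1 ∈ κ.chart.target) :
    κ.omegaC e q = - extDeriv (κ.thetaC e) q := by
  have h1 : κ.thetaC e =ᶠ[𝓝 q] pullbackVec (e.jet ∘ κ.ofCoord) (canonicalForm Y (n + 1)) := by
    filter_upwards [κ.isOpen_target.mem_nhds hq] with q' hq' using κ.thetaC_eq e hq'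
  rw [h1.extDeriv_eq, extDeriv_pullbackVec _ κ.isOpen_target hq (κ.contMDiffOn_jet_ofCoord e),
    omegaC, e.omega_eq, κ.pullbackVec_formPullback_jet e _ hq]
  · rfl
  · exact ((contDiffOn_chartForm_canonicalForm _).contDiffAt
      (extChartAt_target_mem_nhds _)).differentiableAt (by simp)

theorem mfderiv_projY_ofCoord {q : CoordP n N K} (hq : q.1 ∈ κ.chart.target) (w : CoordP n N K) :
    mfderiv 𝓘(ℝ, CoordP n N K) (𝓡 (n + 1 + N)) (projY ∘ κ.ofCoord) q w =
      (κ.chartY.chartDeriv (κ.projY_ofCoord_mem hq)).symm w.1.1 := by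
  have h0 : HasMFDerivAt 𝓘(ℝ, CoordP n N K) (𝓡 (n + 1 + N)) (projY ∘ κ.ofCoord) q
      (mfderiv 𝓘(ℝ, CoordP n N K) (𝓡 (n + 1 + N)) (projY ∘ κ.ofCoord) q) :=
    (((contMDiff_projY (πY := πY) (πB := πB)).contMDiffAt.comp q
      (κ.contMDiffAt_ofCoord hq)).mdifferentiableAt (by simp)).hasMFDerivAt
  have h1 : MDifferentiableAt (𝓡 (n + 1 + N)) 𝓘(ℝ, Euc (n + 1) × Euc N) κ.chartY.chart
      (projY (κ.ofCoord q)) := κ.chartY.chart_mdiff.mdifferentiableAt (κ.projY_ofCoord_mem hq)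
  have h2 := h1.hasMFDerivAt.comp q h0
  have h3 : κ.chartY.chart ∘ (projY ∘ κ.ofCoord) =ᶠ[𝓝 q] fun q' : CoordP n N K => q'.1.1 := by
    filter_upwards [κ.isOpen_target.mem_nhds hq] with q' hq' using κ.chartY_projY_ofCoord hq'
  have h4 := h2.congr_of_eventuallyEq h3.symm
  have h5 : HasMFDerivAt 𝓘(ℝ, CoordP n N K) 𝓘(ℝ, Euc (n + 1) × Euc N)
      (fun q' : CoordP n N K => q'.1.1) q
      ((ContinuousLinearMap.fst ℝ (Euc (n + 1) × Euc N) (Euc K)).comp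
        (ContinuousLinearMap.fst ℝ ((Euc (n + 1) × Euc N) × Euc K) (Mom (n + 1) N))) :=
    ((ContinuousLinearMap.fst ℝ (Euc (n + 1) × Euc N) (Euc K)).comp
      (ContinuousLinearMap.fst ℝ ((Euc (n + 1) × Euc N) × Euc K) (Mom (n + 1) N))).hasMFDerivAt
  -- In the adapted charts the projection 𝔓 → Y is a coordinate projection, which determines its
  -- differential.
  have h6 := hasMFDerivAt_unique h4 h5
  rw [ContinuousLinearEquiv.eq_symm_apply]
  exact congrArg (fun L : CoordP n N K →L[ℝ] Euc (n + 1) × Euc N => L w) h6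

/-- The `J^1 Y^⋆`-component of the energy section as an alternating form in coordinates. -/
def jetC {q : CoordP n N K} (hq : q.1 ∈ κ.chart.target) :
    (Euc (n + 1) × Euc N) [⋀^Fin (n + 1)]→L[ℝ] ℝ :=
  (e.comp (κ.ofCoord q)).1.toForm.compContinuousLinearMap
    ((κ.chartY.chartDeriv (κ.projY_ofCoord_mem hq)).symm :
      Euc (n + 1) × Euc N →L[ℝ] TangentSpace (𝓡 (n + 1 + N)) (projY (κ.ofCoord q)))

theorem thetaC_apply {q : CoordP n N K} (hq : q.1 ∈ κ.chart.target)
    (w : Fin (n + 1) → CoordP n N K) :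
    κ.thetaC e q w = κ.jetC e hq (fun i => (w i).1.1) := by
  rw [κ.thetaC_eq e hq]
  have h0 : MDifferentiableAt 𝓘(ℝ, CoordP n N K)
      ((𝓡 (n + 1 + N)).prod 𝓘(ℝ, ExtModel (n + 1 + N) (n + 1))) (e.jet ∘ κ.ofCoord) q :=
    ((κ.contMDiffOn_jet_ofCoord e).contMDiffAt (κ.isOpen_target.mem_nhds hq)).mdifferentiableAt
      (by simp)
  have h1 : MDifferentiableAt ((𝓡 (n + 1 + N)).prod 𝓘(ℝ, ExtModel (n + 1 + N) (n + 1)))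
      (𝓡 (n + 1 + N)) (Bundle.TotalSpace.proj : ExtBundle (n + 1 + N) (n + 1) Y → Y)
      ((e.jet ∘ κ.ofCoord) q) :=
    (contMDiff_proj (n := ∞) (ExtFiber (n + 1 + N) (n + 1) Y)).mdifferentiableAt (by simp)
  have h2 := mfderiv_comp q h1 h0
  have h3 : ∀ i, mfderiv ((𝓡 (n + 1 + N)).prod 𝓘(ℝ, ExtModel (n + 1 + N) (n + 1)))
      (𝓡 (n + 1 + N)) (Bundle.TotalSpace.proj : ExtBundle (n + 1 + N) (n + 1) Y → Y)
      ((e.jet ∘ κ.ofCoord) q) (mfderiv 𝓘(ℝ, CoordP n N K)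
        ((𝓡 (n + 1 + N)).prod 𝓘(ℝ, ExtModel (n + 1 + N) (n + 1))) (e.jet ∘ κ.ofCoord) q (w i)) =
      (κ.chartY.chartDeriv (κ.projY_ofCoord_mem hq)).symm (w i).1.1 := by
    intro i
    rw [← κ.mfderiv_projY_ofCoord hq]
    exact congrArg (fun L : CoordP n N K →L[ℝ] Euc (n + 1 + N) => L (w i)) h2.symm
  exact congrArg ((e.comp (κ.ofCoord q)).1.toForm :
    Euc (n + 1 + N) [⋀^Fin (n + 1)]→L[ℝ] ℝ) (funext h3)

/-- A vector of Y with zero x-components is vertical, so this is the defining condition of Z in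
coordinates. -/
theorem jetC_eq_zero {q : CoordP n N K} (hq : q.1 ∈ κ.chart.target)
    (w : Fin (n + 1) → Euc (n + 1) × Euc N) {i j : Fin (n + 1)} (hij : i ≠ j)
    (hi : (w i).1 = 0) (hj : (w j).1 = 0) : κ.jetC e hq w = 0 := by
  have hv : ∀ u : Euc (n + 1) × Euc N, u.1 = 0 →
      (κ.chartY.chartDeriv (κ.projY_ofCoord_mem hq)).symm u ∈
        VerticalSpace πY (projY (κ.ofCoord q)) := by
    intro u hu
    have h := ((κ.chartY.vertDeriv (κ.projY_ofCoord_mem hq)).symm u.2).2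
    have h2 : u = (0, u.2) := Prod.ext hu rfl
    rw [h2]
    exact h
  exact (e.comp (κ.ofCoord q)).2 _ i j hij (hv _ hi) (hv _ hj)

theorem jetC_std {q : CoordP n N K} (hq : q.1 ∈ κ.chart.target) :
    κ.jetC e hq (fun μ => (stdVec μ, 0)) = - κ.eLoc e q.1 q.2 := by
  have hf : ∀ ϖ ϖ' : RestrictedDualJet πY (πB.proj (κ.chart.symm q.1)), ϖ = ϖ' →
      ∀ v : Fin (n + 1) → TangentSpace (𝓡 (n + 1 + N)) (πB.proj (κ.chart.symm q.1)),
      (e.comp ⟨κ.chart.symm q.1, ϖ⟩).1.toForm v = (e.comp ⟨κ.chart.symm q.1, ϖ'⟩).1.toForm v := by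
    rintro ϖ _ rfl v; rfl
  unfold eLoc
  rw [dif_pos hq, neg_neg]
  exact hf _ _ (dif_pos hq) _

/-- This is the condition μ ∘ e = id of a section of 𝔪. It is tested on the jet γ that is horizontal
for the coordinates and on the vertical increment ℓ; evaluation on the coordinate frame produces the
momentum coordinates. -/
theorem jetC_linearPart {q : CoordP n N K} (hq : q.1 ∈ κ.chart.target)
    (ℓ : Euc (n + 1) →L[ℝ] Euc N) :
    κ.jetC e hq (fun μ => (stdVec μ, ℓ (stdVec μ))) - κ.jetC e hq (fun μ => (stdVec μ, 0)) =
      ∑ μ, ∑ A, q.2 μ A * (ℓ (stdVec μ)) A := by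
  have hy := κ.projY_ofCoord_mem hq
  set c := κ.chartY
  set y := projY (κ.ofCoord q)
  let γ : TangentSpace (𝓡 (n + 1)) (πY.proj y) →L[ℝ] TangentSpace (𝓡 (n + 1 + N)) y :=
    ((c.chartDeriv hy).symm : Euc (n + 1) × Euc N →L[ℝ] TangentSpace (𝓡 (n + 1 + N)) y).comp
      ((ContinuousLinearMap.inl ℝ (Euc (n + 1)) (Euc N)).comp
        (c.baseDeriv hy : TangentSpace (𝓡 (n + 1)) (πY.proj y) →L[ℝ] Euc (n + 1)))
  let ℓ' : TangentSpace (𝓡 (n + 1)) (πY.proj y) →L[ℝ] VerticalSpace πY y :=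
    ((c.vertDeriv hy).symm : Euc N →L[ℝ] VerticalSpace πY y).comp
      (ℓ.comp (c.baseDeriv hy : TangentSpace (𝓡 (n + 1)) (πY.proj y) →L[ℝ] Euc (n + 1)))
  -- The differential of the chart intertwines Tπ with the projection to the x-components, and γ is
  -- built to have x-components equal to those of its argument.
  have hγ : IsJet πY γ := by
    ext1 v
    apply (c.baseDeriv hy).injective
    have h := c.chartDeriv_fst hy (γ v)
    refine h.symm.trans ?_
    change (c.chartDeriv hy ((c.chartDeriv hy).symm (c.baseDeriv hy v, 0))).1 = c.baseDeriv hy v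
    rw [ContinuousLinearEquiv.apply_symm_apply]
  have h1 := e.isSection (κ.ofCoord q) γ hγ ℓ'
  have hmom : mom (κ.ofCoord q) = (c.momCoord hy).symm q.2 := by
    rw [ContinuousLinearEquiv.eq_symm_apply]
    have h2 : κ.momCoords (κ.ofCoord q) = q.2 :=
      congrArg (fun q : CoordP n N K => q.2) (κ.toCoord_ofCoord hq)
    rw [← h2]
    exact (κ.momCoords_eq (κ.ofCoord_proj_mem hq)).symm
  rw [hmom] at h1
  have h3 := congrArg (fun f : TangentSpace (𝓡 (n + 1)) (πY.proj y) [⋀^Fin (n + 1)]→L[ℝ] ℝ =>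
    f (fun i => (c.baseDeriv hy).symm (stdVec i))) h1
  have h4 := c.momCoord_symm_apply hy q.2 ℓ' (fun i => (c.baseDeriv hy).symm (stdVec i))
  have h5 : ∀ μ, ℓ' ((c.baseDeriv hy).symm (stdVec μ)) = (c.vertDeriv hy).symm (ℓ (stdVec μ)) := by
    intro μ
    change (c.vertDeriv hy).symm (ℓ (c.baseDeriv hy ((c.baseDeriv hy).symm (stdVec μ)))) = _
    rw [ContinuousLinearEquiv.apply_symm_apply]
  simp only [h5, ContinuousLinearEquiv.apply_symm_apply, stdVol_std, mul_one] at h4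
  rw [← h4]
  refine Eq.trans ?_ h3
  have h6 : ∀ μ, γ ((c.baseDeriv hy).symm (stdVec μ)) = (c.chartDeriv hy).symm (stdVec μ, 0) := by
    intro μ
    change (c.chartDeriv hy).symm (c.baseDeriv hy ((c.baseDeriv hy).symm (stdVec μ)), 0) = _
    rw [ContinuousLinearEquiv.apply_symm_apply]
  have h7 : ∀ μ, (γ + (VerticalSpace πY y).subtypeL.comp ℓ') ((c.baseDeriv hy).symm (stdVec μ)) =
      (c.chartDeriv hy).symm (stdVec μ, ℓ (stdVec μ)) := by
    intro μ
    have h8 : ((ℓ' ((c.baseDeriv hy).symm (stdVec μ)) : VerticalSpace πY y) :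
        TangentSpace (𝓡 (n + 1 + N)) y) = (c.chartDeriv hy).symm (0, ℓ (stdVec μ)) := by
      rw [h5]; rfl
    change γ ((c.baseDeriv hy).symm (stdVec μ)) +
      ((ℓ' ((c.baseDeriv hy).symm (stdVec μ)) : VerticalSpace πY y) :
        TangentSpace (𝓡 (n + 1 + N)) y) = _
    rw [h6, h8, ← map_add]
    simp
  change (e.comp (κ.ofCoord q)).1.toForm (fun μ => (c.chartDeriv hy).symm (stdVec μ, ℓ (stdVec μ))) -
      (e.comp (κ.ofCoord q)).1.toForm (fun μ => (c.chartDeriv hy).symm (stdVec μ, 0)) =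
    (e.comp (κ.ofCoord q)).1.toForm (fun μ => (γ + (VerticalSpace πY y).subtypeL.comp ℓ')
      ((c.baseDeriv hy).symm (stdVec μ))) -
      (e.comp (κ.ofCoord q)).1.toForm (fun μ => γ ((c.baseDeriv hy).symm (stdVec μ)))
  simp only [h6, h7]

/-- These are the coefficients of dy^A ∧ d^n x_i. Only the x-components of the other entries matter,
because a second vertical contribution is killed by the dual jet condition. -/
theorem jetC_update {q : CoordP n N K} (hq : q.1 ∈ κ.chart.target) (i : Fin (n + 1)) (y : Euc N)
    (w : Fin (n + 1) → Euc (n + 1) × Euc N) (hw : ∀ μ, μ ≠ i → (w μ).1 = stdVec μ) :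
    κ.jetC e hq (Function.update w i (0, y)) = ∑ A, q.2 i A * y A := by
  have hadd : ∀ a : Fin (n + 1) → Euc (n + 1), ∀ b : Fin (n + 1) → Euc N,
      κ.jetC e hq (fun μ => (a μ, b μ)) = κ.jetC e hq (fun μ => (a μ, 0)) +
        ∑ j, κ.jetC e hq (Function.update (fun μ => (a μ, 0)) j (0, b j)) := by
    intro a b
    have h := multilinear_map_add_eq (κ.jetC e hq).toMultilinearMap
      (fun μ => (a μ, 0)) (fun μ => (0, b μ)) (by
        rintro w ⟨i, j, hij, hi, hj⟩
        exact κ.jetC_eq_zero e hq w hij (by rw [hi]) (by rw [hj]))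
    have h2 : (fun μ => (a μ, (0 : Euc N))) + (fun μ => ((0 : Euc (n + 1)), b μ)) =
      fun μ => (a μ, b μ) := by ext1 μ; simp
    rw [h2] at h
    exact h
  -- all arguments other than the `i`-th may be replaced by horizontal ones
  have h1 : κ.jetC e hq (Function.update w i (0, y)) =
      κ.jetC e hq (Function.update (fun μ => (stdVec μ, 0)) i (0, y)) := by
    have h := hadd (Function.update (fun μ => stdVec μ) i 0) (Function.update (fun μ => (w μ).2) i y)
    have e1 : (fun μ => (Function.update (fun μ => (stdVec μ : Euc (n + 1))) i 0 μ,
        Function.update (fun μ => (w μ).2) i y μ)) = Function.update w i (0, y) := by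
      ext1 μ
      by_cases hμ : μ = i
      · subst hμ; simp
      · simp only [Function.update_of_ne hμ]
        exact Prod.ext (hw μ hμ).symm rfl
    rw [e1] at h
    rw [h, Finset.sum_eq_single i]
    · rw [(κ.jetC e hq).map_coord_zero i (by simp), zero_add]
      congr 1
      ext1 μ
      by_cases hμ : μ = i
      · subst hμ; simp
      · simp [Function.update_of_ne hμ]
    · intro j _ hj
      exact κ.jetC_eq_zero e hq _ hj (by simp) (by simp [Function.update_of_ne hj.symm])
    · simp
  rw [h1]
  -- The rank-one map dx^i ⊗ y has a nonzero value only on the i-th frame vector, so it isolates the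
  -- i-th term.
  have h2 := κ.jetC_linearPart e hq ((EuclideanSpace.proj i : Euc (n + 1) →L[ℝ] ℝ).smulRight y)
  rw [hadd, add_sub_cancel_left, Finset.sum_eq_single i, Finset.sum_eq_single i] at h2
  · simpa using h2
  · intro μ _ hμ
    simp [hμ]
  · simp
  · intro j _ hj
    exact (κ.jetC e hq).map_coord_zero j (by simp [hj])
  · simp

/-- The Cartan form on a lift of the coordinate frame. -/
theorem thetaC_frame {q : CoordP n N K} (hq : q.1 ∈ κ.chart.target)
    (w : Fin (n + 1) → CoordP n N K) (hw : ∀ μ, (w μ).1.1.1 = stdVec μ) :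
    κ.thetaC e q w = - κ.eLoc e q.1 q.2 + ∑ μ, ∑ A, q.2 μ A * (w μ).1.1.2 A := by
  -- The (x, y)-parts of the lifted frame are the graph of this linear map over the standard frame.
  let ℓ : Euc (n + 1) →L[ℝ] Euc N :=
    ∑ μ, (EuclideanSpace.proj μ : Euc (n + 1) →L[ℝ] ℝ).smulRight (w μ).1.1.2
  have hℓ : ∀ μ, ℓ (stdVec μ) = (w μ).1.1.2 := by
    intro μ
    have h : ∀ ν, (EuclideanSpace.proj ν : Euc (n + 1) →L[ℝ] ℝ) (stdVec μ) =
        if ν = μ then 1 else 0 := by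
      intro ν; simp
    simp only [ℓ, sum_apply, ContinuousLinearMap.smulRight_apply, h, ite_smul, one_smul, zero_smul]
    simp
  have h1 := κ.jetC_linearPart e hq ℓ
  rw [κ.jetC_std e hq, sub_neg_eq_add, ← eq_sub_iff_add_eq] at h1
  rw [κ.thetaC_apply e hq]
  have h2 : (fun i => (w i).1.1) = fun μ => (stdVec μ, ℓ (stdVec μ)) := by
    ext1 μ
    rw [hℓ]
    exact Prod.ext (hw μ) rfl
  rw [h2, h1]
  simp only [hℓ]
  ring

/-- Such values occur in dΘ_e(V, w_0, …, w_n) when one w_i is used as the direction of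
differentiation and V remains among the arguments. -/
theorem thetaC_frame_update {q : CoordP n N K} (hq : q.1 ∈ κ.chart.target)
    (w : Fin (n + 1) → CoordP n N K) (hw : ∀ μ, (w μ).1.1.1 = stdVec μ) (i : Fin (n + 1))
    (V : CoordP n N K) (hV : V.1.1.1 = 0) :
    κ.thetaC e q (Function.update w i V) = ∑ A, q.2 i A * V.1.1.2 A := by
  rw [κ.thetaC_apply e hq]
  have h := κ.jetC_update e hq i V.1.1.2 (fun μ => (w μ).1.1) (fun μ _ => hw μ)
  rw [← h]
  congr 1
  ext1 μ
  by_cases hμ : μ = i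
  · subst hμ; simp only [Function.update_self]; exact Prod.ext hV rfl
  · simp only [Function.update_of_ne hμ]

end AdaptedCoords

end LocalCartan

/-! ### The multisymplectic form on a vertical vector and a lifted frame -/

section LocalOmega

variable {n N K : ℕ} {X Y B FY FB : Type*}
  [TopologicalSpace X] [ChartedSpace (Euc (n + 1)) X] [IsManifold (𝓡 (n + 1)) ∞ X]
  [TopologicalSpace Y] [ChartedSpace (Euc (n + 1 + N)) Y] [IsManifold (𝓡 (n + 1 + N)) ∞ Y]
  [TopologicalSpace B] [ChartedSpace (Euc (n + 1 + N + K)) B]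
  [IsManifold (𝓡 (n + 1 + N + K)) ∞ B]
  [TopologicalSpace FY] [ChartedSpace (Euc N) FY] [IsManifold (𝓡 N) ∞ FY]
  [TopologicalSpace FB] [ChartedSpace (Euc K) FB]
  {πY : SmoothFiberBundle (n + 1 + N) (n + 1) N Y X FY}
  {πB : SmoothFiberBundle (n + 1 + N + K) (n + 1 + N) K B Y FB}

namespace AdaptedCoords

variable (κ : AdaptedCoords πY πB) (e : EnergySection πY πB)

/-- The local expression of the energy section, as a function of all coordinates. -/
def eC (q : CoordP n N K) : ℝ := κ.eLoc e q.1 q.2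

/-- On the horizontal coordinate frame the momentum terms of Θ_e drop out, so e_loc is minus a
coefficient of a smooth form. -/
theorem contDiffOn_eC : ContDiffOn ℝ ∞ (κ.eC e) {q : CoordP n N K | q.1 ∈ κ.chart.target} := by
  have h := (contDiff_apply_alternating (r := ∞) (fun μ : Fin (n + 1) =>
    (((stdVec μ, 0), 0), 0) : Fin (n + 1) → CoordP n N K)).neg.comp_contDiffOn (κ.contDiffOn_thetaC e)
  refine h.congr fun q hq => ?_
  have h1 := κ.thetaC_frame e hq (fun μ : Fin (n + 1) => (((stdVec μ, 0), 0), 0)) (fun _ => rfl)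
  have h2 : κ.thetaC e q (fun μ : Fin (n + 1) => (((stdVec μ, 0), 0), 0)) = - κ.eC e q := by
    rw [h1]; simp [eC]
  simp [h2]

theorem differentiableAt_eC {q : CoordP n N K} (hq : q.1 ∈ κ.chart.target) :
    DifferentiableAt ℝ (κ.eC e) q :=
  ((κ.contDiffOn_eC e).contDiffAt (κ.isOpen_target.mem_nhds hq)).differentiableAt (by simp)

/-- `Ω_e` evaluated on a vertical vector and a lift of the coordinate frame. -/
theorem omegaC_frame {q : CoordP n N K} (hq : q.1 ∈ κ.chart.target)
    (w : Fin (n + 1) → CoordP n N K) (hw : ∀ μ, (w μ).1.1.1 = stdVec μ)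
    (V : CoordP n N K) (hV : V.1.1.1 = 0) :
    κ.omegaC e q (Fin.cons V w) = fderiv ℝ (κ.eC e) q V - (∑ μ, ∑ A, V.2 μ A * (w μ).1.1.2 A)
      + ∑ μ, ∑ A, (w μ).2 μ A * V.1.1.2 A := by
  have hd : DifferentiableAt ℝ (κ.thetaC e) q :=
    ((κ.contDiffOn_thetaC e).contDiffAt (κ.isOpen_target.mem_nhds hq)).differentiableAt (by simp)
  -- The arguments V and w are held constant, so dΘ_e is an alternating sum of derivatives of
  -- coefficient functions, without bracket terms.
  have hev : ∀ (a : CoordP n N K) (u : Fin (n + 1) → CoordP n N K),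
      fderiv ℝ (κ.thetaC e) q a u = fderiv ℝ (fun q' => κ.thetaC e q' u) q a := by
    intro a u
    have h := ((ContinuousAlternatingMap.apply ℝ (CoordP n N K) ℝ u).hasFDerivAt.comp q
      hd.hasFDerivAt).fderiv
    exact (congrArg (fun L : CoordP n N K →L[ℝ] ℝ => L a) h).symm
  have hnear : ∀ᶠ q' : CoordP n N K in 𝓝 q, q'.1 ∈ κ.chart.target := κ.isOpen_target.mem_nhds hq
  have hpd : ∀ (μ : Fin (n + 1)) (A : Fin N) (c : ℝ), HasFDerivAt (fun q' : CoordP n N K => q'.2 μ A * c)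
      (c • ((ContinuousLinearMap.proj A : (Fin N → ℝ) →L[ℝ] ℝ).comp
        ((ContinuousLinearMap.proj μ : Mom (n + 1) N →L[ℝ] (Fin N → ℝ)).comp
          (ContinuousLinearMap.snd ℝ ((Euc (n + 1) × Euc N) × Euc K) (Mom (n + 1) N))))) q := by
    intro μ A c
    exact ((ContinuousLinearMap.proj A : (Fin N → ℝ) →L[ℝ] ℝ).comp
        ((ContinuousLinearMap.proj μ : Mom (n + 1) N →L[ℝ] (Fin N → ℝ)).comp
          (ContinuousLinearMap.snd ℝ ((Euc (n + 1) × Euc N) × Euc K) (Mom (n + 1) N)))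
      ).hasFDerivAt.mul_const c
  have h0 : fderiv ℝ (fun q' => κ.thetaC e q' w) q V =
      - fderiv ℝ (κ.eC e) q V + ∑ μ, ∑ A, V.2 μ A * (w μ).1.1.2 A := by
    have h1 : (fun q' => κ.thetaC e q' w) =ᶠ[𝓝 q]
        fun q' => - κ.eC e q' + ∑ μ, ∑ A, q'.2 μ A * (w μ).1.1.2 A := by
      filter_upwards [hnear] with q' hq' using κ.thetaC_frame e hq' w hw
    have h5 := HasFDerivAt.fun_sum (u := (Finset.univ : Finset (Fin (n + 1)))) fun μ _ =>
      HasFDerivAt.fun_sum (u := (Finset.univ : Finset (Fin N))) fun A _ => hpd μ A ((w μ).1.1.2 A)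
    have h2 := ((κ.differentiableAt_eC e hq).hasFDerivAt.fun_neg.fun_add h5).fderiv
    rw [h1.fderiv_eq, h2]
    simp [mul_comm]
  have h3 : ∀ i : Fin (n + 1), fderiv ℝ (fun q' => κ.thetaC e q' (Function.update w i V)) q (w i) =
      ∑ A, (w i).2 i A * V.1.1.2 A := by
    intro i
    have h1 : (fun q' => κ.thetaC e q' (Function.update w i V)) =ᶠ[𝓝 q]
        fun q' => ∑ A, q'.2 i A * V.1.1.2 A := by
      filter_upwards [hnear] with q' hq' using κ.thetaC_frame_update e hq' w hw i V hV
    have h2 := (HasFDerivAt.fun_sum (u := Finset.univ) fun A _ => hpd i A (V.1.1.2 A)).fderiv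
    rw [h1.fderiv_eq, h2]
    simp [mul_comm]
  rw [κ.omegaC_eq e hq, ContinuousAlternatingMap.neg_apply, extDeriv_apply hd, Fin.sum_univ_succ]
  -- With w_i omitted, V stands in front. Moving it to the i-th place costs (-1)^i, which with the
  -- sign (-1)^(i+1) of the exterior derivative leaves -1 for every i.
  have h4 : ∀ i : Fin (n + 1), ((-1) ^ ((i.succ : Fin (n + 2)) : ℕ) : ℤ) •
      fderiv ℝ (fun q' => κ.thetaC e q'
        (i.succ.removeNth (Fin.cons V w : Fin (n + 2) → CoordP n N K))) q
          ((Fin.cons V w : Fin (n + 2) → CoordP n N K) i.succ) =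
      - ∑ A, (w i).2 i A * V.1.1.2 A := by
    intro i
    have h5 : (i.succ.removeNth (Fin.cons V w : Fin (n + 2) → CoordP n N K)) =
        (Fin.cons V (i.removeNth w) : Fin (n + 1) → CoordP n N K) :=
      funext (Fin.cases rfl fun _ => by simp [Fin.removeNth])
    have h6 := (fderiv ℝ (κ.thetaC e) q (w i)).neg_one_pow_smul_map_insertNth i V (i.removeNth w)
    rw [Fin.insertNth_removeNth, hev, h3 i] at h6
    rw [h5, Fin.cons_succ, ← hev]
    change _ • fderiv ℝ (κ.thetaC e) q (w i) (Matrix.vecCons V (i.removeNth w)) = _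
    rw [← h6, Fin.val_succ, pow_succ, smul_smul]
    rw [mul_neg_one, neg_mul, ← pow_add, ← two_mul, pow_mul]
    simp
  rw [Finset.sum_congr rfl fun i _ => h4 i, Finset.sum_neg_distrib]
  have h7 : (0 : Fin (n + 2)).removeNth (Fin.cons V w : Fin (n + 2) → CoordP n N K) = w := by
    rw [Fin.removeNth_zero, Fin.tail_cons]
  rw [h7, Fin.cons_zero, h0]
  simp
  ring

end AdaptedCoords

end LocalOmega

/-! ### Tangent vectors and sections in coordinates -/

section Sections

variable {n N K : ℕ} {X Y B FY FB : Type*}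
  [TopologicalSpace X] [ChartedSpace (Euc (n + 1)) X] [IsManifold (𝓡 (n + 1)) ∞ X]
  [TopologicalSpace Y] [ChartedSpace (Euc (n + 1 + N)) Y] [IsManifold (𝓡 (n + 1 + N)) ∞ Y]
  [TopologicalSpace B] [ChartedSpace (Euc (n + 1 + N + K)) B]
  [IsManifold (𝓡 (n + 1 + N + K)) ∞ B]
  [TopologicalSpace FY] [ChartedSpace (Euc N) FY] [IsManifold (𝓡 N) ∞ FY]
  [TopologicalSpace FB] [ChartedSpace (Euc K) FB]
  {πY : SmoothFiberBundle (n + 1 + N) (n + 1) N Y X FY}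
  {πB : SmoothFiberBundle (n + 1 + N + K) (n + 1 + N) K B Y FB}

namespace AdaptedCoords

variable (κ : AdaptedCoords πY πB) (e : EnergySection πY πB)

theorem contMDiffAt_toCoord {P : RPontryagin πY πB} (hP : P.proj ∈ κ.chart.source) :
    ContMDiffAt (modelP n N K) 𝓘(ℝ, CoordP n N K) ∞ κ.toCoord P :=
  κ.contMDiffOn_toCoord.contMDiffAt (κ.isOpen_source.mem_nhds hP)

/-- The components of a tangent vector of `𝔓`. -/
def vecCoord (P : RPontryagin πY πB) (W : TangentSpace (modelP n N K) P) : CoordP n N K :=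
  mfderiv (modelP n N K) 𝓘(ℝ, CoordP n N K) κ.toCoord P W

/-- The tangent vector of `𝔓` with given components. -/
def vecOfCoord (q : CoordP n N K) (w : CoordP n N K) : TangentSpace (modelP n N K) (κ.ofCoord q) :=
  mfderiv 𝓘(ℝ, CoordP n N K) (modelP n N K) κ.ofCoord q w

theorem vecOfCoord_vecCoord {P : RPontryagin πY πB} (hP : P.proj ∈ κ.chart.source)
    (W : TangentSpace (modelP n N K) P) :
    (κ.vecOfCoord (κ.toCoord P) (κ.vecCoord P W) : Euc (n + 1 + N + K) × Mom (n + 1) N) = W := by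
  have h1 := ((κ.contMDiffAt_ofCoord (κ.toCoord_fst_mem hP)).mdifferentiableAt
    (by simp)).hasMFDerivAt.comp P
      ((κ.contMDiffAt_toCoord hP).mdifferentiableAt (by simp)).hasMFDerivAt
  have h2 : κ.ofCoord ∘ κ.toCoord =ᶠ[𝓝 P] id := by
    filter_upwards [κ.isOpen_source.mem_nhds hP] with P' hP' using κ.ofCoord_toCoord hP'
  have h3 := hasMFDerivAt_unique (h1.congr_of_eventuallyEq h2.symm) (hasMFDerivAt_id P)
  exact congrArg (fun L : (Euc (n + 1 + N + K) × Mom (n + 1) N) →L[ℝ]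
    (Euc (n + 1 + N + K) × Mom (n + 1) N) => L W) h3

theorem vecCoord_vecOfCoord {q : CoordP n N K} (hq : q.1 ∈ κ.chart.target) (w : CoordP n N K) :
    κ.vecCoord (κ.ofCoord q) (κ.vecOfCoord q w) = w := by
  have h1 := ((κ.contMDiffAt_toCoord (κ.ofCoord_proj_mem hq)).mdifferentiableAt
    (by simp)).hasMFDerivAt.comp q
      ((κ.contMDiffAt_ofCoord hq).mdifferentiableAt (by simp)).hasMFDerivAt
  have h2 : κ.toCoord ∘ κ.ofCoord =ᶠ[𝓝 q] id := by
    filter_upwards [κ.isOpen_target.mem_nhds hq] with q' hq' using κ.toCoord_ofCoord hq'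
  have h3 := hasMFDerivAt_unique (h1.congr_of_eventuallyEq h2.symm) (hasMFDerivAt_id q)
  exact congrArg (fun L : CoordP n N K →L[ℝ] CoordP n N K => L w) h3

/-- In these coordinates 𝔓 → X is the projection to x, so verticality means that the x-components
vanish. -/
theorem vecCoord_fst {P : RPontryagin πY πB} (hP : P.proj ∈ κ.chart.source)
    (W : TangentSpace (modelP n N K) P) :
    (κ.vecCoord P W).1.1.1 = mfderiv (𝓡 (n + 1)) (𝓡 (n + 1)) κ.chartY.base (projX P)
      (mfderiv (modelP n N K) (𝓡 (n + 1)) projX P W) := by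
  let L : CoordP n N K →L[ℝ] Euc (n + 1) := (ContinuousLinearMap.fst ℝ (Euc (n + 1)) (Euc N)).comp
    ((ContinuousLinearMap.fst ℝ (Euc (n + 1) × Euc N) (Euc K)).comp
      (ContinuousLinearMap.fst ℝ ((Euc (n + 1) × Euc N) × Euc K) (Mom (n + 1) N)))
  have h1 : HasMFDerivAt (modelP n N K) 𝓘(ℝ, Euc (n + 1)) (L ∘ κ.toCoord) P _ :=
    L.hasMFDerivAt.comp P ((κ.contMDiffAt_toCoord hP).mdifferentiableAt (by simp)).hasMFDerivAt
  have h2 : HasMFDerivAt (modelP n N K) 𝓘(ℝ, Euc (n + 1)) (κ.chartY.base ∘ projX) P _ :=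
    (κ.chartY.base_mdiff.mdifferentiableAt (κ.projX_mem hP)).hasMFDerivAt.comp P
      ((contMDiff_projX (πY := πY) (πB := πB)).mdifferentiableAt (by simp)).hasMFDerivAt
  have h3 : κ.chartY.base ∘ projX =ᶠ[𝓝 P] L ∘ κ.toCoord := by
    filter_upwards [κ.isOpen_source.mem_nhds hP] with P' hP' using κ.base_projX hP'
  have h4 := hasMFDerivAt_unique (h2.congr_of_eventuallyEq h3.symm) h1
  exact congrArg (fun L : (Euc (n + 1 + N + K) × Mom (n + 1) N) →L[ℝ] Euc (n + 1) => L W) h4.symm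

theorem vecCoord_fst_eq_zero {P : RPontryagin πY πB} (hP : P.proj ∈ κ.chart.source)
    {W : TangentSpace (modelP n N K) P}
    (hW : mfderiv (modelP n N K) (𝓡 (n + 1)) projX P W = 0) : (κ.vecCoord P W).1.1.1 = 0 := by
  rw [κ.vecCoord_fst hP, hW, map_zero]
  rfl

theorem projX_vecOfCoord {q : CoordP n N K} (hq : q.1 ∈ κ.chart.target) {w : CoordP n N K}
    (hw : w.1.1.1 = 0) :
    mfderiv (modelP n N K) (𝓡 (n + 1)) projX (κ.ofCoord q) (κ.vecOfCoord q w) = 0 := by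
  have h := κ.vecCoord_fst (κ.ofCoord_proj_mem hq) (κ.vecOfCoord q w)
  rw [κ.vecCoord_vecOfCoord hq, hw] at h
  exact (κ.chartY.base_mdiff.mfderiv (κ.projX_mem (κ.ofCoord_proj_mem hq))).injective
    (h.symm.trans (map_zero _).symm)

/-- The coordinate expression of a section of `𝔓 → X`. -/
def secCoord (ψ : X → RPontryagin πY πB) (u : Euc (n + 1)) : CoordP n N K :=
  κ.toCoord (ψ (κ.chartY.base.symm u))

/-- The Euler-Lagrange expression: `Ω_e` on a vertical vector and a lift of the frame. -/
def eulerLagrange (q : CoordP n N K) (w : Fin (n + 1) → CoordP n N K) (V : CoordP n N K) : ℝ :=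
  fderiv ℝ (κ.eC e) q V - (∑ μ, ∑ A, V.2 μ A * (w μ).1.1.2 A) + ∑ μ, ∑ A, (w μ).2 μ A * V.1.1.2 A

variable {ψ : X → RPontryagin πY πB} {u : Euc (n + 1)}

theorem contDiffAt_secCoord (hu : u ∈ κ.chartY.base.target)
    (hψ : ContMDiffAt (𝓡 (n + 1)) (modelP n N K) ∞ ψ (κ.chartY.base.symm u))
    (hs : (ψ (κ.chartY.base.symm u)).proj ∈ κ.chart.source) :
    ContDiffAt ℝ ∞ (κ.secCoord ψ) u := by
  rw [← contMDiffAt_iff_contDiffAt]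
  exact (κ.contMDiffAt_toCoord hs).comp u (hψ.comp u
    (κ.chartY.base_symm_smooth.contMDiffAt (κ.chartY.base.open_target.mem_nhds hu)))

theorem eventually_source (hu : u ∈ κ.chartY.base.target)
    (hψ : ContMDiffAt (𝓡 (n + 1)) (modelP n N K) ∞ ψ (κ.chartY.base.symm u))
    (hs : (ψ (κ.chartY.base.symm u)).proj ∈ κ.chart.source) :
    ∀ᶠ u' in 𝓝 u, (ψ (κ.chartY.base.symm u')).proj ∈ κ.chart.source :=
  (hψ.continuousAt.comp_of_eq (κ.chartY.base.continuousAt_symm hu) rfl).preimage_mem_nhds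
    (κ.isOpen_source.mem_nhds hs)

/-- This rewrites the coordinate frame carried to 𝔓 by Tψ in terms of partial derivatives of the
coordinate expression, the form in which `thetaC_frame` and `omegaC_frame` apply. -/
theorem mfderiv_section (hu : u ∈ κ.chartY.base.target)
    (hψ : ContMDiffAt (𝓡 (n + 1)) (modelP n N K) ∞ ψ (κ.chartY.base.symm u))
    (hs : (ψ (κ.chartY.base.symm u)).proj ∈ κ.chart.source) (a : Euc (n + 1)) :
    (mfderiv (𝓡 (n + 1)) (modelP n N K) ψ (κ.chartY.base.symm u)
      (mfderiv (𝓡 (n + 1)) (𝓡 (n + 1)) κ.chartY.base.symm u a) :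
        Euc (n + 1 + N + K) × Mom (n + 1) N) =
      κ.vecOfCoord (κ.secCoord ψ u) (fderiv ℝ (κ.secCoord ψ) u a) := by
  have h0 : HasMFDerivAt 𝓘(ℝ, Euc (n + 1)) (𝓡 (n + 1)) κ.chartY.base.symm u
      (mfderiv (𝓡 (n + 1)) (𝓡 (n + 1)) κ.chartY.base.symm u) :=
    (κ.chartY.base_mdiff.mdifferentiableAt_symm hu).hasMFDerivAt
  have h1 := (hψ.mdifferentiableAt (by simp)).hasMFDerivAt.comp u h0
  have h2 : HasMFDerivAt 𝓘(ℝ, Euc (n + 1)) 𝓘(ℝ, CoordP n N K) (κ.secCoord ψ) u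
      (fderiv ℝ (κ.secCoord ψ) u) :=
    (((κ.contDiffAt_secCoord hu hψ hs).differentiableAt (by simp)).hasFDerivAt).hasMFDerivAt
  have h3 := ((κ.contMDiffAt_ofCoord (q := κ.secCoord ψ u) (κ.toCoord_fst_mem hs)).mdifferentiableAt
    (by simp)).hasMFDerivAt.comp u h2
  have h4 : κ.ofCoord ∘ κ.secCoord ψ =ᶠ[𝓝 u] ψ ∘ κ.chartY.base.symm := by
    filter_upwards [κ.eventually_source hu hψ hs] with u' hu' using κ.ofCoord_toCoord hu'
  have h5 := hasMFDerivAt_unique (h1.congr_of_eventuallyEq h4) h3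
  exact congrArg (fun L : Euc (n + 1) →L[ℝ] (Euc (n + 1 + N + K) × Mom (n + 1) N) => L a) h5

theorem secCoord_fst (hsec : ∀ᶠ x in 𝓝 (κ.chartY.base.symm u), projX (ψ x) = x)
    (hu : u ∈ κ.chartY.base.target)
    (hψ : ContMDiffAt (𝓡 (n + 1)) (modelP n N K) ∞ ψ (κ.chartY.base.symm u))
    (hs : (ψ (κ.chartY.base.symm u)).proj ∈ κ.chart.source) :
    ∀ᶠ u' in 𝓝 u, (κ.secCoord ψ u').1.1.1 = u' := by
  filter_upwards [κ.eventually_source hu hψ hs, κ.chartY.base.open_target.mem_nhds hu,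
    (κ.chartY.base.continuousAt_symm hu).eventually hsec] with u' h1 h2 h3
  rw [secCoord, ← κ.base_projX h1, h3, κ.chartY.base.right_inv h2]

/-- Since ψ is a section, its partial derivatives are lifts of the coordinate frame. -/
theorem fderiv_secCoord_fst (hsec : ∀ᶠ x in 𝓝 (κ.chartY.base.symm u), projX (ψ x) = x)
    (hu : u ∈ κ.chartY.base.target)
    (hψ : ContMDiffAt (𝓡 (n + 1)) (modelP n N K) ∞ ψ (κ.chartY.base.symm u))
    (hs : (ψ (κ.chartY.base.symm u)).proj ∈ κ.chart.source) (a : Euc (n + 1)) :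
    (fderiv ℝ (κ.secCoord ψ) u a).1.1.1 = a := by
  let L : CoordP n N K →L[ℝ] Euc (n + 1) := (ContinuousLinearMap.fst ℝ (Euc (n + 1)) (Euc N)).comp
    ((ContinuousLinearMap.fst ℝ (Euc (n + 1) × Euc N) (Euc K)).comp
      (ContinuousLinearMap.fst ℝ ((Euc (n + 1) × Euc N) × Euc K) (Mom (n + 1) N)))
  have h1 := L.hasFDerivAt.comp u
    ((κ.contDiffAt_secCoord hu hψ hs).differentiableAt (by simp)).hasFDerivAt
  have h2 : L ∘ κ.secCoord ψ =ᶠ[𝓝 u] id := κ.secCoord_fst hsec hu hψ hs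
  have h3 := (h1.congr_of_eventuallyEq h2.symm).unique (hasFDerivAt_id u)
  exact congrArg (fun L : Euc (n + 1) →L[ℝ] Euc (n + 1) => L a) h3

theorem diffForm_congr {k : ℕ} (α : DiffForm (modelP n N K) (RPontryagin πY πB) k)
    {P P' : RPontryagin πY πB} (h : P = P') (v : Fin k → Euc (n + 1 + N + K) × Mom (n + 1) N) :
    (α P : (Euc (n + 1 + N + K) × Mom (n + 1) N) [⋀^Fin k]→L[ℝ] ℝ) v =
      (α P' : (Euc (n + 1 + N + K) × Mom (n + 1) N) [⋀^Fin k]→L[ℝ] ℝ) v := by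
  subst h; rfl

end AdaptedCoords

/-- The form `ψ^* (i_W Ω_e)` for a vector field `W` along `ψ`. -/
def omegaAlong (e : EnergySection πY πB) (ψ : X → RPontryagin πY πB)
    (W : (x : X) → TangentSpace (modelP n N K) (ψ x)) : DiffForm (𝓡 (n + 1)) X (n + 1) :=
  fun x => (ContinuousAlternatingMap.curryLeft (E := Euc (n + 1 + N + K) × Mom (n + 1) N)
    (e.omega (ψ x)) (W x)).compContinuousLinearMap (mfderiv (𝓡 (n + 1)) (modelP n N K) ψ x)

namespace AdaptedCoords

variable (κ : AdaptedCoords πY πB) (e : EnergySection πY πB)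
variable {ψ : X → RPontryagin πY πB} {u : Euc (n + 1)}

theorem coordValue_theta (hu : u ∈ κ.chartY.base.target)
    (hψ : ContMDiffAt (𝓡 (n + 1)) (modelP n N K) ∞ ψ (κ.chartY.base.symm u))
    (hs : (ψ (κ.chartY.base.symm u)).proj ∈ κ.chart.source) :
    coordValue κ.chartY.base (formPullback (I := 𝓡 (n + 1)) ψ e.theta) u =
      κ.thetaC e (κ.secCoord ψ u) (fun μ => fderiv ℝ (κ.secCoord ψ) u (stdVec μ)) := by
  unfold coordValue thetaC pullbackVec formPullback
  have h1 : ψ (κ.chartY.base.symm u) = κ.ofCoord (κ.secCoord ψ u) := (κ.ofCoord_toCoord hs).symm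
  refine Eq.trans ?_ (diffForm_congr e.theta h1 _)
  exact congrArg (e.theta (ψ (κ.chartY.base.symm u)) :
    (Euc (n + 1 + N + K) × Mom (n + 1) N) [⋀^Fin (n + 1)]→L[ℝ] ℝ)
    (funext fun μ => κ.mfderiv_section hu hψ hs (stdVec μ))

theorem coordValue_theta_eq (hsec : ∀ᶠ x in 𝓝 (κ.chartY.base.symm u), projX (ψ x) = x)
    (hu : u ∈ κ.chartY.base.target)
    (hψ : ContMDiffAt (𝓡 (n + 1)) (modelP n N K) ∞ ψ (κ.chartY.base.symm u))
    (hs : (ψ (κ.chartY.base.symm u)).proj ∈ κ.chart.source) :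
    coordValue κ.chartY.base (formPullback (I := 𝓡 (n + 1)) ψ e.theta) u =
      - κ.eC e (κ.secCoord ψ u) + ∑ μ, ∑ A, (κ.secCoord ψ u).2 μ A *
        (fderiv ℝ (κ.secCoord ψ) u (stdVec μ)).1.1.2 A := by
  rw [κ.coordValue_theta e hu hψ hs]
  exact κ.thetaC_frame e (κ.toCoord_fst_mem hs) _
    fun μ => κ.fderiv_secCoord_fst hsec hu hψ hs (stdVec μ)

theorem coordValue_omegaAlong (hsec : ∀ᶠ x in 𝓝 (κ.chartY.base.symm u), projX (ψ x) = x)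
    (hu : u ∈ κ.chartY.base.target)
    (hψ : ContMDiffAt (𝓡 (n + 1)) (modelP n N K) ∞ ψ (κ.chartY.base.symm u))
    (hs : (ψ (κ.chartY.base.symm u)).proj ∈ κ.chart.source)
    (W : (x : X) → TangentSpace (modelP n N K) (ψ x))
    (hW : mfderiv (modelP n N K) (𝓡 (n + 1)) projX _ (W (κ.chartY.base.symm u)) = 0) :
    coordValue κ.chartY.base (omegaAlong e ψ W) u =
      κ.eulerLagrange e (κ.secCoord ψ u) (fun μ => fderiv ℝ (κ.secCoord ψ) u (stdVec μ))
        (κ.vecCoord _ (W (κ.chartY.base.symm u))) := by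
  have h2 := κ.omegaC_frame e (κ.toCoord_fst_mem hs) _
    (fun μ => κ.fderiv_secCoord_fst hsec hu hψ hs (stdVec μ))
    (κ.vecCoord _ (W (κ.chartY.base.symm u))) (κ.vecCoord_fst_eq_zero hs hW)
  unfold eulerLagrange
  refine Eq.trans ?_ h2
  unfold coordValue omegaAlong omegaC pullbackVec formPullback
  have h1 : ψ (κ.chartY.base.symm u) = κ.ofCoord (κ.secCoord ψ u) := (κ.ofCoord_toCoord hs).symm
  refine Eq.trans ?_ (diffForm_congr e.omega h1 _)
  refine congrArg (e.omega (ψ (κ.chartY.base.symm u)) :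
    (Euc (n + 1 + N + K) × Mom (n + 1) N) [⋀^Fin (n + 2)]→L[ℝ] ℝ) (funext fun i => ?_)
  refine Fin.cases ?_ (fun μ => ?_) i
  · exact (κ.vecOfCoord_vecCoord hs _).symm
  · exact κ.mfderiv_section hu hψ hs (stdVec μ)

end AdaptedCoords

end Sections

/-! ### The local equations as vanishing of the Euler-Lagrange expression -/

section LocalEquations

variable {n N K : ℕ} {X Y B FY FB : Type*}
  [TopologicalSpace X] [ChartedSpace (Euc (n + 1)) X] [IsManifold (𝓡 (n + 1)) ∞ X]
  [TopologicalSpace Y] [ChartedSpace (Euc (n + 1 + N)) Y] [IsManifold (𝓡 (n + 1 + N)) ∞ Y]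
  [TopologicalSpace B] [ChartedSpace (Euc (n + 1 + N + K)) B]
  [IsManifold (𝓡 (n + 1 + N + K)) ∞ B]
  [TopologicalSpace FY] [ChartedSpace (Euc N) FY] [IsManifold (𝓡 N) ∞ FY]
  [TopologicalSpace FB] [ChartedSpace (Euc K) FB]
  {πY : SmoothFiberBundle (n + 1 + N) (n + 1) N Y X FY}
  {πB : SmoothFiberBundle (n + 1 + N + K) (n + 1 + N) K B Y FB}

namespace AdaptedCoords

variable (κ : AdaptedCoords πY πB) (e : EnergySection πY πB)

/-- The Euler-Lagrange expression in terms of the components of a vertical vector. -/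
theorem eulerLagrange_eq_sum (q : CoordP n N K) (w : Fin (n + 1) → CoordP n N K) (V : CoordP n N K)
    (hV : V.1.1.1 = 0) :
    κ.eulerLagrange e q w V =
      (∑ μ, ∑ A, V.2 μ A * (fderiv ℝ (κ.eC e) q (0, Pi.single μ (Pi.single A 1)) - (w μ).1.1.2 A)) +
      (∑ A, V.1.1.2 A * (fderiv ℝ (κ.eC e) q (((0, stdVec A), 0), 0) + ∑ μ, (w μ).2 μ A)) +
      ∑ α, V.1.2 α * fderiv ℝ (κ.eC e) q ((0, stdVec α), 0) := by
  -- A vertical vector is a combination of ∂/∂p_A^μ, ∂/∂y^A and ∂/∂b^α.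
  have hdec : V = (∑ μ, ∑ A, V.2 μ A • ((0, Pi.single μ (Pi.single A 1)) : CoordP n N K)) +
      (∑ A, V.1.1.2 A • ((((0, stdVec A), 0), 0) : CoordP n N K)) +
      ∑ α, V.1.2 α • (((0, stdVec α), 0) : CoordP n N K) := by
    refine Prod.ext (Prod.ext (Prod.ext ?_ ?_) ?_) ?_
    · simp [Prod.fst_sum, hV]
    · ext j
      simp [Prod.fst_sum, Prod.snd_sum, Pi.single_apply]
    · ext j
      simp [Prod.fst_sum, Prod.snd_sum, Pi.single_apply]
    · ext μ A
      simp [Prod.snd_sum, Pi.single_apply, Finset.sum_apply]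
  have h := congrArg (fderiv ℝ (κ.eC e) q) hdec
  simp only [map_add, map_sum, map_smul, smul_eq_mul] at h
  unfold eulerLagrange
  rw [h]
  simp only [mul_sub, mul_add, Finset.sum_sub_distrib, Finset.sum_add_distrib, Finset.mul_sum]
  rw [Finset.sum_comm (f := fun A μ => V.1.1.2 A * (w μ).2 μ A)]
  simp only [mul_comm (V.1.1.2 _) ((w _).2 _ _)]
  ring

/-- Linearity in V reduces the test to the three families of basis vectors. The p-directions give
the field equations, the y-directions the momentum equations, and the b-directions the control
equations. -/
theorem eulerLagrange_eq_zero_iff (q : CoordP n N K) (w : Fin (n + 1) → CoordP n N K) :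
    (∀ V : CoordP n N K, V.1.1.1 = 0 → κ.eulerLagrange e q w V = 0) ↔
      (∀ μ A, (w μ).1.1.2 A = fderiv ℝ (κ.eC e) q (0, Pi.single μ (Pi.single A 1))) ∧
      (∀ A, ∑ μ, (w μ).2 μ A = - fderiv ℝ (κ.eC e) q (((0, stdVec A), 0), 0)) ∧
      (∀ α, fderiv ℝ (κ.eC e) q ((0, stdVec α), 0) = 0) := by
  constructor
  · intro h
    refine ⟨fun μ A => ?_, fun A => ?_, fun α => ?_⟩
    · have h1 := h (0, Pi.single μ (Pi.single A 1)) rfl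
      rw [κ.eulerLagrange_eq_sum e _ _ _ rfl, Finset.sum_eq_single μ, Finset.sum_eq_single A] at h1
      · simp at h1
        linarith
      · intro B _ hB
        simp [hB]
      · simp
      · intro ν _ hν
        simp [hν]
      · simp
    · have h1 := h (((0, stdVec A), 0), 0) rfl
      rw [κ.eulerLagrange_eq_sum e _ _ _ rfl] at h1
      simp at h1
      linarith
    · have h1 := h ((0, stdVec α), 0) rfl
      rw [κ.eulerLagrange_eq_sum e _ _ _ rfl] at h1
      simpa using h1
  · rintro ⟨h1, h2, h3⟩ V hV
    rw [κ.eulerLagrange_eq_sum e _ _ _ hV]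
    simp [h1, h2, h3]

variable {ψ : X → RPontryagin πY πB} {x : X}

/-- The local equations differentiate separate slices of e_loc and separate components of ψ. By the
chain rule these are components of the total derivatives of `eC` and `secCoord`. -/
theorem localEquationsAt_iff (hsec : ∀ᶠ x' in 𝓝 x, projX (ψ x') = x')
    (hψ : ContMDiffAt (𝓡 (n + 1)) (modelP n N K) ∞ ψ x)
    (hs : (ψ x).proj ∈ κ.chart.source) :
    LocalEquationsAt e ψ κ x ↔ ∀ V : CoordP n N K, V.1.1.1 = 0 →
      κ.eulerLagrange e (κ.toCoord (ψ x))
        (fun μ => fderiv ℝ (κ.secCoord ψ) (κ.chartY.base x) (stdVec μ)) V = 0 := by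
  have hx : x ∈ κ.chartY.base.source := by
    have := κ.projX_mem hs
    rwa [hsec.self_of_nhds] at this
  set q := κ.toCoord (ψ x) with hq
  have hqt : q.1 ∈ κ.chart.target := κ.toCoord_fst_mem hs
  have hxx : κ.chartY.base.symm (κ.chartY.base x) = x := κ.chartY.base.left_inv hx
  have hu : κ.chartY.base x ∈ κ.chartY.base.target := κ.chartY.base.map_source hx
  have hd : DifferentiableAt ℝ (κ.secCoord ψ) (κ.chartY.base x) :=
    (κ.contDiffAt_secCoord hu (by rwa [hxx]) (by rwa [hxx])).differentiableAt (by simp)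
  have he := κ.differentiableAt_eC e hqt
  have hev := κ.eventually_source (ψ := ψ) hu (by rwa [hxx]) (by rwa [hxx])
  have h1 : ∀ μ A, fderiv ℝ (fun u => (κ.chartY.chart (projY (ψ (κ.chartY.base.symm u)))).2 A)
      (κ.chartY.base x) (stdVec μ) =
      (fderiv ℝ (κ.secCoord ψ) (κ.chartY.base x) (stdVec μ)).1.1.2 A := by
    intro μ A
    let L : CoordP n N K →L[ℝ] ℝ := (EuclideanSpace.proj A : Euc N →L[ℝ] ℝ).comp
      ((ContinuousLinearMap.snd ℝ (Euc (n + 1)) (Euc N)).comp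
      ((ContinuousLinearMap.fst ℝ (Euc (n + 1) × Euc N) (Euc K)).comp
        (ContinuousLinearMap.fst ℝ ((Euc (n + 1) × Euc N) × Euc K) (Mom (n + 1) N))))
    have h2 : (fun u => (κ.chartY.chart (projY (ψ (κ.chartY.base.symm u)))).2 A) =ᶠ[𝓝 (κ.chartY.base x)]
        L ∘ κ.secCoord ψ := by
      filter_upwards [hev] with u hu'
      rw [κ.chartY_projY hu']
      rfl
    rw [h2.fderiv_eq, (L.hasFDerivAt.comp _ hd.hasFDerivAt).fderiv]
    rfl
  have h2 : ∀ μ A, fderiv ℝ (fun u => κ.momCoords (ψ (κ.chartY.base.symm u)) μ A)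
      (κ.chartY.base x) (stdVec μ) =
      (fderiv ℝ (κ.secCoord ψ) (κ.chartY.base x) (stdVec μ)).2 μ A := by
    intro μ A
    let L : CoordP n N K →L[ℝ] ℝ := (ContinuousLinearMap.proj A : (Fin N → ℝ) →L[ℝ] ℝ).comp
        ((ContinuousLinearMap.proj μ : Mom (n + 1) N →L[ℝ] (Fin N → ℝ)).comp
          (ContinuousLinearMap.snd ℝ ((Euc (n + 1) × Euc N) × Euc K) (Mom (n + 1) N)))
    have h3 := (L.hasFDerivAt.comp _ hd.hasFDerivAt).fderiv
    exact congrArg (fun L : Euc (n + 1) →L[ℝ] ℝ => L (stdVec μ)) h3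
  have h3 : ∀ W : Mom (n + 1) N, fderiv ℝ (fun P => κ.eLoc e (κ.chart (ψ x).proj) P)
      (κ.momCoords (ψ x)) W = fderiv ℝ (κ.eC e) q (0, W) := by
    intro W
    have h4 := (he.hasFDerivAt.comp (κ.momCoords (ψ x))
      (hasFDerivAt_prodMk_right (κ.chart (ψ x).proj) (κ.momCoords (ψ x)))).fderiv
    exact congrArg (fun L : Mom (n + 1) N →L[ℝ] ℝ => L W) h4
  have h4 : ∀ v : Euc N, fderiv ℝ (fun y => κ.eLoc e (((κ.chart (ψ x).proj).1.1, y),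
      (κ.chart (ψ x).proj).2) (κ.momCoords (ψ x))) (κ.chart (ψ x).proj).1.2 v =
      fderiv ℝ (κ.eC e) q (((0, v), 0), 0) := by
    intro v
    have h5 := ((hasFDerivAt_prodMk_right (𝕜 := ℝ) (κ.chart (ψ x).proj).1.1
      (κ.chart (ψ x).proj).1.2).prodMk (hasFDerivAt_const (κ.chart (ψ x).proj).2 _)).prodMk
        (hasFDerivAt_const (κ.momCoords (ψ x)) _)
    have h6 := (he.hasFDerivAt.comp (κ.chart (ψ x).proj).1.2 h5).fderiv
    exact congrArg (fun L : Euc N →L[ℝ] ℝ => L v) h6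
  have h5 : ∀ v : Euc K, fderiv ℝ (fun b => κ.eLoc e ((κ.chart (ψ x).proj).1, b)
      (κ.momCoords (ψ x))) (κ.chart (ψ x).proj).2 v = fderiv ℝ (κ.eC e) q ((0, v), 0) := by
    intro v
    have h5 := (hasFDerivAt_prodMk_right (𝕜 := ℝ) (κ.chart (ψ x).proj).1
      (κ.chart (ψ x).proj).2).prodMk (hasFDerivAt_const (κ.momCoords (ψ x)) _)
    have h6 := (he.hasFDerivAt.comp (κ.chart (ψ x).proj).2 h5).fderiv
    exact congrArg (fun L : Euc K →L[ℝ] ℝ => L v) h6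
  rw [κ.eulerLagrange_eq_zero_iff]
  constructor
  · rintro ⟨a, b, c⟩
    refine ⟨fun μ A => ?_, fun A => ?_, fun α => ?_⟩
    · rw [← h1, ← h3]; exact a μ A
    · rw [← h4, ← b A]; exact Finset.sum_congr rfl fun μ _ => (h2 μ A).symm
    · rw [← h5]; exact c α
  · rintro ⟨a, b, c⟩
    refine ⟨fun μ A => ?_, fun A => ?_, fun α => ?_⟩
    · rw [h1, h3]; exact a μ A
    · rw [h4, ← b A]; exact Finset.sum_congr rfl fun μ _ => h2 μ A
    · rw [h5]; exact c α

end AdaptedCoords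

end LocalEquations

/-! ### Forms of top degree are determined by one frame -/

section CoordValue

variable {m : ℕ} {X : Type*} [TopologicalSpace X] [ChartedSpace (Euc m) X]

theorem apply_eq_coordValue_mul {χ : OpenPartialHomeomorph X (Euc m)}
    (hχ : χ.MDifferentiable (𝓡 m) (𝓡 m)) (α : DiffForm (𝓡 m) X m) {u : Euc m} (hu : u ∈ χ.target)
    (v : Fin m → TangentSpace (𝓡 m) (χ.symm u)) :
    α (χ.symm u) v = coordValue χ α u *
      stdVol m (fun i => mfderiv (𝓡 m) (𝓡 m) χ (χ.symm u) (v i)) := by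
  let D : Euc m →L[ℝ] Euc m := mfderiv (𝓡 m) (𝓡 m) χ.symm u
  have h1 : ((α (χ.symm u) : Euc m [⋀^Fin m]→L[ℝ] ℝ).compContinuousLinearMap D) =
      coordValue χ α u • stdVol m := eq_smul_stdVol _
  have h2 : ∀ i, D (mfderiv (𝓡 m) (𝓡 m) χ (χ.symm u) (v i)) = v i := by
    intro i
    have h3 := hχ.symm_comp_deriv (χ.map_target hu)
    rw [χ.right_inv hu] at h3
    exact congrArg (fun L : Euc m →L[ℝ] Euc m => L (v i)) h3
  have h4 := congrArg (fun f : Euc m [⋀^Fin m]→L[ℝ] ℝ =>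
    f (fun i => mfderiv (𝓡 m) (𝓡 m) χ (χ.symm u) (v i))) h1
  refine Eq.trans ?_ h4
  exact (congrArg (α (χ.symm u) : Euc m [⋀^Fin m]→L[ℝ] ℝ) (funext h2)).symm

theorem eq_zero_of_coordValue_eq_zero {χ : OpenPartialHomeomorph X (Euc m)}
    (hχ : χ.MDifferentiable (𝓡 m) (𝓡 m)) {α : DiffForm (𝓡 m) X m} {u : Euc m} (hu : u ∈ χ.target)
    (h : coordValue χ α u = 0) : α (χ.symm u) = 0 := by
  ext v
  rw [apply_eq_coordValue_mul hχ α hu, h, zero_mul]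
  rfl

end CoordValue

/-! ### Coordinate vector fields with constant components are smooth -/

section ConstantFields

variable {E : Type*} [NormedAddCommGroup E] [NormedSpace ℝ E]
  {F : Type*} [NormedAddCommGroup F] [NormedSpace ℝ F] {H : Type*} [TopologicalSpace H]
  {I : ModelWithCorners ℝ F H} {M : Type*} [TopologicalSpace M] [ChartedSpace H M]
  [IsManifold I ∞ M]

theorem contMDiffOn_mfderiv_const {f : E → M} {s : Set E} (hs : IsOpen s)
    (hf : ContMDiffOn 𝓘(ℝ, E) I ∞ f s) (w : E) :
    ContMDiffOn 𝓘(ℝ, E) I.tangent ∞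
      (fun q => (⟨f q, mfderiv 𝓘(ℝ, E) I f q w⟩ : TangentBundle I M)) s := by
  have h1 := hf.contMDiffOn_tangentMapWithin (m := ∞) (by simp) hs.uniqueMDiffOn
  have h2 : ContMDiff 𝓘(ℝ, E) 𝓘(ℝ, E).tangent ∞
      (fun q : E => (⟨q, w⟩ : TangentBundle 𝓘(ℝ, E) E)) := fun q =>
    contMDiffAt_vectorSpace_iff_contDiffAt.2 contDiffAt_const
  refine (h1.comp h2.contMDiffOn (fun q hq => hq)).congr ?_
  intro q hq
  simp only [Function.comp, tangentMapWithin, mfderivWithin_of_isOpen hs hq]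

end ConstantFields

/-! ### Vertical fields, and the equivalence of pull-back condition and local equations -/

section VerticalFields

variable {n N K : ℕ} {X Y B FY FB : Type*}
  [TopologicalSpace X] [ChartedSpace (Euc (n + 1)) X] [IsManifold (𝓡 (n + 1)) ∞ X]
  [TopologicalSpace Y] [ChartedSpace (Euc (n + 1 + N)) Y] [IsManifold (𝓡 (n + 1 + N)) ∞ Y]
  [TopologicalSpace B] [ChartedSpace (Euc (n + 1 + N + K)) B]
  [IsManifold (𝓡 (n + 1 + N + K)) ∞ B]
  [TopologicalSpace FY] [ChartedSpace (Euc N) FY] [IsManifold (𝓡 N) ∞ FY]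
  [TopologicalSpace FB] [ChartedSpace (Euc K) FB]
  {πY : SmoothFiberBundle (n + 1 + N) (n + 1) N Y X FY}
  {πB : SmoothFiberBundle (n + 1 + N + K) (n + 1 + N) K B Y FB}

/-- The field with constant components in adapted coordinates is vertical; a cut-off makes it
global. The bump function may be taken on B, because the coordinate domain is the full preimage of a
domain in B. -/
theorem exists_verticalField [T2Space B] [IsManifold (𝓡 K) ∞ FB] (P₀ : RPontryagin πY πB)
    (W₀ : TangentSpace (modelP n N K) P₀)
    (hW : mfderiv (modelP n N K) (𝓡 (n + 1)) projX P₀ W₀ = 0) :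
    ∃ V : (P : RPontryagin πY πB) → TangentSpace (modelP n N K) P,
      IsVerticalField V ∧ V P₀ = W₀ := by
  obtain ⟨κ, hκ⟩ := exists_adaptedCoords (πY := πY) (πB := πB) P₀.proj
  obtain ⟨χ, -, hχ⟩ := (SmoothBumpFunction.nhds_basis_tsupport (I := 𝓡 (n + 1 + N + K))
    P₀.proj).mem_iff.1 (κ.chart.open_source.mem_nhds hκ)
  set w := κ.vecCoord P₀ W₀ with hw
  have hw0 : w.1.1.1 = 0 := κ.vecCoord_fst_eq_zero hκ hW
  let S : Set (RPontryagin πY πB) := {P | P.proj ∈ κ.chart.source}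
  have hS : IsOpen S := κ.isOpen_source
  let V₁ : (P : RPontryagin πY πB) → TangentSpace (modelP n N K) P :=
    fun P => κ.vecOfCoord (κ.toCoord P) w
  let f : RPontryagin πY πB → ℝ := fun P => χ P.proj
  have hf : ContMDiff (modelP n N K) 𝓘(ℝ, ℝ) ∞ f := χ.contMDiff.comp (contMDiff_proj _)
  have hfS : tsupport f ⊆ S :=
    (tsupport_comp_subset_preimage χ (FiberBundle.continuous_proj _ _)).trans fun P hP => hχ hP
  have hV₁ : ContMDiffOn (modelP n N K) (modelP n N K).tangent ∞
      (fun P => (⟨P, V₁ P⟩ : TangentBundle (modelP n N K) (RPontryagin πY πB))) S := by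
    have h1 := contMDiffOn_mfderiv_const κ.isOpen_target κ.contMDiffOn_ofCoord w
    refine (h1.comp κ.contMDiffOn_toCoord fun P hP => κ.toCoord_fst_mem hP).congr ?_
    intro P hP
    have h2 : ∀ Q : RPontryagin πY πB, Q = P → ∀ v : Euc (n + 1 + N + K) × Mom (n + 1) N,
        (⟨P, v⟩ : TangentBundle (modelP n N K) (RPontryagin πY πB)) = ⟨Q, v⟩ := by
      rintro _ rfl v
      rfl
    exact h2 _ (κ.ofCoord_toCoord hP) _
  refine ⟨f • V₁, ⟨ContMDiffOn.smul_section_of_tsupport hf.contMDiffOn hS hfS hV₁, ?_⟩, ?_⟩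
  · intro P
    change mfderiv (modelP n N K) (𝓡 (n + 1)) projX P (f P • V₁ P) = 0
    by_cases hP : P ∈ S
    · have h2 : mfderiv (modelP n N K) (𝓡 (n + 1)) projX P (V₁ P) = 0 := by
        have h3 := κ.projX_vecOfCoord (κ.toCoord_fst_mem hP) hw0
        rw [κ.ofCoord_toCoord hP] at h3
        exact h3
      rw [map_smul, h2, smul_zero]
    · have h2 : f P = 0 := image_eq_zero_of_notMem_tsupport fun h => hP (hfS h)
      rw [h2, zero_smul, map_zero]
  · change χ P₀.proj • V₁ P₀ = W₀
    rw [χ.eq_one, one_smul]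
    exact κ.vecOfCoord_vecCoord hκ W₀

/-- At a point of the open set U the local extension agrees with ψ on a neighbourhood, so
derivatives of ψ itself may be used. -/
theorem isSmoothSectionOn_at {ψ : X → RPontryagin πY πB} {U : Set X} (hU : IsOpen U)
    (hψ : IsSmoothSectionOn ψ (closure U)) {x : X} (hx : x ∈ U) :
    ContMDiffAt (𝓡 (n + 1)) (modelP n N K) ∞ ψ x ∧ ∀ᶠ x' in 𝓝 x, projX (ψ x') = x' := by
  obtain ⟨W, hW, hxW, g, hg, hgs, hfg⟩ := hψ x (subset_closure hx)
  have h1 : ψ =ᶠ[𝓝 x] g := by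
    filter_upwards [hU.mem_nhds hx, hW.mem_nhds hxW] with x' h1 h2
    exact hfg ⟨subset_closure h1, h2⟩
  refine ⟨(hg.contMDiffAt (hW.mem_nhds hxW)).congr_of_eventuallyEq h1, ?_⟩
  filter_upwards [h1, hW.mem_nhds hxW] with x' h1 h2
  rw [h1]
  exact hgs x' h2

/-- The contraction at ψ(x) sees only the value of V there, so global fields can be exchanged for
single vertical vectors. -/
theorem satisfiesPullbackEq_iff [T2Space B] [IsManifold (𝓡 K) ∞ FB] (e : EnergySection πY πB)
    {U : Set X} {ψ : X → RPontryagin πY πB} :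
    SatisfiesPullbackEq e U ψ ↔ ∀ x ∈ U, ∀ W : (x : X) → TangentSpace (modelP n N K) (ψ x),
      mfderiv (modelP n N K) (𝓡 (n + 1)) projX (ψ x) (W x) = 0 → omegaAlong e ψ W x = 0 := by
  constructor
  · intro h x hx W hW
    obtain ⟨V, hV, hVW⟩ := exists_verticalField (ψ x) (W x) hW
    have h1 := h V hV x hx
    have h2 : omegaAlong e ψ W x = omegaAlong e ψ (fun x => V (ψ x)) x := by
      exact congrArg (fun w : Euc (n + 1 + N + K) × Mom (n + 1) N =>
        (ContinuousAlternatingMap.curryLeft (E := Euc (n + 1 + N + K) × Mom (n + 1) N)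
          (e.omega (ψ x)) w).compContinuousLinearMap
            (mfderiv (𝓡 (n + 1)) (modelP n N K) ψ x)) hVW.symm
    rw [h2]
    exact h1
  · intro h V hV x hx
    exact h x hx (fun x => V (ψ x)) (hV.2 (ψ x))

theorem satisfiesPullbackEq_iff_satisfiesLocalEq [T2Space B] [IsManifold (𝓡 K) ∞ FB]
    (e : EnergySection πY πB) {U : Set X} (hU : IsOpen U) {ψ : X → RPontryagin πY πB}
    (hψ : IsSmoothSectionOn ψ (closure U)) :
    SatisfiesPullbackEq e U ψ ↔ SatisfiesLocalEq e U ψ := by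
  rw [satisfiesPullbackEq_iff]
  constructor
  · intro h κ x hx hs
    obtain ⟨h1, h2⟩ := isSmoothSectionOn_at hU hψ hx
    have hxs : x ∈ κ.chartY.base.source := by
      have := κ.projX_mem hs
      rwa [h2.self_of_nhds] at this
    have hxx : κ.chartY.base.symm (κ.chartY.base x) = x := κ.chartY.base.left_inv hxs
    rw [κ.localEquationsAt_iff e h2 h1 hs]
    intro V hV
    -- The vector field along ψ with constant components V; only its value at x matters.
    let W : (x : X) → TangentSpace (modelP n N K) (ψ x) := fun x => κ.vecOfCoord (κ.toCoord (ψ x)) V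
    have hW : mfderiv (modelP n N K) (𝓡 (n + 1)) projX (ψ x) (W x) = 0 := by
      have h3 := κ.projX_vecOfCoord (κ.toCoord_fst_mem hs) hV
      rw [κ.ofCoord_toCoord hs] at h3
      exact h3
    have hWV : κ.vecCoord (ψ x) (W x) = V := by
      have h3 := κ.vecCoord_vecOfCoord (κ.toCoord_fst_mem hs) V
      rw [κ.ofCoord_toCoord hs] at h3
      exact h3
    have h4 := κ.coordValue_omegaAlong e (ψ := ψ) (u := κ.chartY.base x) (by rwa [hxx])
      (κ.chartY.base.map_source hxs) (by rwa [hxx]) (by rwa [hxx]) W (by rwa [hxx])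
    rw [hxx, hWV, AdaptedCoords.secCoord, hxx] at h4
    rw [← h4]
    unfold coordValue
    rw [hxx, h x hx W hW]
    rfl
  · intro h x hx W hW
    obtain ⟨h1, h2⟩ := isSmoothSectionOn_at hU hψ hx
    obtain ⟨κ, hs⟩ := exists_adaptedCoords (πY := πY) (πB := πB) (ψ x).proj
    have hxs : x ∈ κ.chartY.base.source := by
      have := κ.projX_mem hs
      rwa [h2.self_of_nhds] at this
    have hxx : κ.chartY.base.symm (κ.chartY.base x) = x := κ.chartY.base.left_inv hxs
    have h3 := (κ.localEquationsAt_iff e h2 h1 hs).1 (h κ x hx hs) (κ.vecCoord (ψ x) (W x))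
      (κ.vecCoord_fst_eq_zero hs hW)
    have h4 := κ.coordValue_omegaAlong e (ψ := ψ) (u := κ.chartY.base x) (by rwa [hxx])
      (κ.chartY.base.map_source hxs) (by rwa [hxx]) (by rwa [hxx]) W (by rwa [hxx])
    rw [hxx, AdaptedCoords.secCoord, hxx, h3] at h4
    have h5 := eq_zero_of_coordValue_eq_zero κ.chartY.base_mdiff (κ.chartY.base.map_source hxs) h4
    rwa [hxx] at h5

end VerticalFields

/-! ### Change of charts for top-degree forms and orientations -/

section ChartChange

variable {m : ℕ} {X : Type*} [TopologicalSpace X] [ChartedSpace (Euc m) X] [IsManifold (𝓡 m) ∞ X]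

theorem stdVol_comp (L : Euc m →L[ℝ] Euc m) : stdVol m (fun i => L (stdVec i)) = L.det := by
  have h2 := AlternatingMap.eq_smul_basis_det (EuclideanSpace.basisFun (Fin m) ℝ).toBasis
    (stdVol m).toAlternatingMap
  have hb : ⇑(EuclideanSpace.basisFun (Fin m) ℝ).toBasis = fun i => (stdVec i : Euc m) := by
    ext i; simp
  rw [hb] at h2
  have h3 : (stdVol m).toAlternatingMap (fun i => stdVec i) = 1 := stdVol_std
  rw [h3, one_smul] at h2
  have h4 := Module.Basis.det_comp (EuclideanSpace.basisFun (Fin m) ℝ).toBasis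
    (L : Euc m →ₗ[ℝ] Euc m) (EuclideanSpace.basisFun (Fin m) ℝ).toBasis
  rw [Module.Basis.det_self, mul_one, hb] at h4
  change (stdVol m).toAlternatingMap (fun i => L (stdVec i)) = _
  rw [h2]
  exact h4

/-- The value of a form of top degree on the coordinate frame of a chart, with the sign of the
chart with respect to the orientation. -/
def orientedValue (o : ManifoldOrientation (m := m) X) (χ : OpenPartialHomeomorph X (Euc m))
    (α : DiffForm (𝓡 m) X m) (u : Euc m) : ℝ :=
  (SignType.sign (coordValue χ o.form u) : ℝ) * coordValue χ α u

variable {φ χ : OpenPartialHomeomorph X (Euc m)}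

theorem hasFDerivAt_chartChange (hφ : φ.MDifferentiable (𝓡 m) (𝓡 m))
    (hχ : χ.MDifferentiable (𝓡 m) (𝓡 m)) {u : Euc m} (hu : u ∈ χ.target)
    (hu' : χ.symm u ∈ φ.source) :
    HasFDerivAt (E := Euc m) (F := Euc m) (fun u => φ (χ.symm u))
      ((show Euc m →L[ℝ] Euc m from mfderiv (𝓡 m) (𝓡 m) φ (χ.symm u)).comp
        (show Euc m →L[ℝ] Euc m from mfderiv (𝓡 m) (𝓡 m) χ.symm u)) u :=
  ((hφ.mdifferentiableAt hu').hasMFDerivAt.comp u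
    (hχ.mdifferentiableAt_symm hu).hasMFDerivAt).hasFDerivAt

theorem coordValue_chartChange (hφ : φ.MDifferentiable (𝓡 m) (𝓡 m))
    (hχ : χ.MDifferentiable (𝓡 m) (𝓡 m)) (α : DiffForm (𝓡 m) X m) {u : Euc m} (hu : u ∈ χ.target)
    (hu' : χ.symm u ∈ φ.source) :
    coordValue χ α u =
      coordValue φ α (φ (χ.symm u)) * (fderiv ℝ (fun u => φ (χ.symm u)) u).det := by
  have hf := (hasFDerivAt_chartChange hφ hχ hu hu').fderiv
  rw [hf, ← stdVol_comp]
  have h : ∀ x, x = χ.symm u → ∀ v : Fin m → Euc m,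
      (α (χ.symm u) : Euc m [⋀^Fin m]→L[ℝ] ℝ) v = (α x : Euc m [⋀^Fin m]→L[ℝ] ℝ) v := by
    rintro _ rfl v
    rfl
  have h' : ∀ x, x = χ.symm u → (mfderiv (𝓡 m) (𝓡 m) φ (χ.symm u) : Euc m →L[ℝ] Euc m) =
      (mfderiv (𝓡 m) (𝓡 m) φ x : Euc m →L[ℝ] Euc m) := by
    rintro _ rfl
    rfl
  have h0 := φ.left_inv hu'
  have h1 := apply_eq_coordValue_mul hφ α (φ.map_source hu')
    (fun i => (mfderiv (𝓡 m) (𝓡 m) χ.symm u : Euc m →L[ℝ] Euc m) (stdVec i))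
  refine ((h _ h0 _).trans h1).trans ?_
  rw [← h' _ h0]
  rfl

/-- Both coordinate values acquire the Jacobian determinant. Its sign, coming from the orientation,
turns the determinant into its absolute value, the factor in the change of variables for Lebesgue
measure. -/
theorem orientedValue_chartChange (o : ManifoldOrientation (m := m) X)
    (hφ : φ.MDifferentiable (𝓡 m) (𝓡 m))
    (hχ : χ.MDifferentiable (𝓡 m) (𝓡 m)) (α : DiffForm (𝓡 m) X m) {u : Euc m} (hu : u ∈ χ.target)
    (hu' : χ.symm u ∈ φ.source) :
    orientedValue o χ α u =
      |(fderiv ℝ (fun u => φ (χ.symm u)) u).det| * orientedValue o φ α (φ (χ.symm u)) := by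
  rw [orientedValue, orientedValue, coordValue_chartChange hφ hχ α hu hu',
    coordValue_chartChange hφ hχ o.form hu hu', sign_mul, ← sign_mul_self]
  push_cast
  ring

theorem coordValue_form_ne_zero (o : ManifoldOrientation (m := m) X)
    (hχ : χ.MDifferentiable (𝓡 m) (𝓡 m)) {u : Euc m} (hu : u ∈ χ.target) :
    coordValue χ o.form u ≠ 0 := fun h =>
  o.ne_zero _ (eq_zero_of_coordValue_eq_zero hχ hu h)

/-- The bundle trivialization at x₀ evaluates the orienting form on the frame of the preferred
chart, so continuity as a section gives continuity of the coefficient. -/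
theorem continuousAt_coordValue_chartAt (o : ManifoldOrientation (m := m) X) (x₀ : X) :
    ContinuousAt (fun x => coordValue (chartAt (Euc m) x₀) o.form (chartAt (Euc m) x₀ x)) x₀ := by
  have h1 : ContinuousAt (fun x => (trivializationAt (ExtModel m m) (ExtFiber m m X) x₀
      (⟨x, o.form x⟩ : ExtBundle m m X)).2) x₀ := by
    have h2 := (trivializationAt (ExtModel m m) (ExtFiber m m X) x₀).continuousOn.continuousAt
      (x := (⟨x₀, o.form x₀⟩ : ExtBundle m m X))
      ((trivializationAt (ExtModel m m) (ExtFiber m m X) x₀).open_source.mem_nhds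
        ((trivializationAt (ExtModel m m) (ExtFiber m m X) x₀).mem_source.2
          (FiberBundle.mem_baseSet_trivializationAt' x₀)))
    exact continuous_snd.continuousAt.comp
      (h2.comp (f := fun x => (⟨x, o.form x⟩ : ExtBundle m m X)) o.continuous_form.continuousAt)
  have h3 : ContinuousAt (fun x => (trivializationAt (ExtModel m m) (ExtFiber m m X) x₀
      (⟨x, o.form x⟩ : ExtBundle m m X)).2 (fun i => stdVec i)) x₀ :=
    ((ContinuousAlternatingMap.apply ℝ (Euc m) ℝ
      (fun i : Fin m => (stdVec i : Euc m))).continuous.continuousAt).comp h1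
  refine h3.congr ?_
  filter_upwards [(chartAt (Euc m) x₀).open_source.mem_nhds (mem_chart_source _ x₀)] with x hx
  rw [extBundle_trivializationAt_apply x₀ (⟨x, o.form x⟩ : ExtBundle m m X) hx]
  have h : ∀ x', x' = x → ∀ v : Fin m → Euc m,
      (o.form x : Euc m [⋀^Fin m]→L[ℝ] ℝ) v = (o.form x' : Euc m [⋀^Fin m]→L[ℝ] ℝ) v := by
    rintro _ rfl v
    rfl
  refine (h _ ((chartAt (Euc m) x₀).left_inv hx) _).trans ?_
  simp only [coordValue, mfderivWithin_univ, ModelWithCorners.range_eq_univ]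
  rfl

theorem continuousOn_coordValue_form (o : ManifoldOrientation (m := m) X)
    (hχ : ContMDiffOn (𝓡 m) (𝓡 m) ∞ χ χ.source)
    (hχ' : ContMDiffOn (𝓡 m) (𝓡 m) ∞ χ.symm χ.target) :
    ContinuousOn (coordValue χ o.form) χ.target := by
  intro u hu
  refine ContinuousAt.continuousWithinAt ?_
  set φ := chartAt (Euc m) (χ.symm u)
  have hd : χ.MDifferentiable (𝓡 m) (𝓡 m) :=
    ⟨hχ.mdifferentiableOn (by simp), hχ'.mdifferentiableOn (by simp)⟩
  have hφ : φ.MDifferentiable (𝓡 m) (𝓡 m) := mdifferentiable_chart _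
  have hs : χ.symm u ∈ φ.source := mem_chart_source _ _
  have hc : ContinuousAt χ.symm u := χ.continuousAt_symm hu
  have hcd : ContDiffAt ℝ ∞ (fun u => φ (χ.symm u)) u :=
    (((contMDiffOn_chart (I := 𝓡 m) (n := ∞)).contMDiffAt (φ.open_source.mem_nhds hs)).comp u
      (hχ'.contMDiffAt (χ.open_target.mem_nhds hu))).contDiffAt
  have h1 : ContinuousAt (fun v => (fderiv ℝ (fun u => φ (χ.symm u)) v).det) u :=
    ContinuousLinearMap.continuous_det.continuousAt.comp
      (hcd.fderiv_right (m := 0) (by simp)).continuousAt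
  have h2 : ContinuousAt (fun v => coordValue φ o.form (φ (χ.symm v))) u :=
    ContinuousAt.comp (f := χ.symm) (continuousAt_coordValue_chartAt o (χ.symm u)) hc
  refine (h2.mul h1).congr ?_
  filter_upwards [χ.open_target.mem_nhds hu, hc.preimage_mem_nhds (φ.open_source.mem_nhds hs)]
    with v hv hv'
  exact (coordValue_chartChange hφ hd o.form hv hv').symm

/-- The coefficient of the orienting form is continuous and nowhere zero, hence its sign is locally
constant. No chart needs to be connected or compatible with the orientation. -/
theorem eventually_sign_coordValue_eq (o : ManifoldOrientation (m := m) X)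
    (hχ : ContMDiffOn (𝓡 m) (𝓡 m) ∞ χ χ.source)
    (hχ' : ContMDiffOn (𝓡 m) (𝓡 m) ∞ χ.symm χ.target) {u : Euc m} (hu : u ∈ χ.target) :
    ∀ᶠ v in 𝓝 u, SignType.sign (coordValue χ o.form v) = SignType.sign (coordValue χ o.form u) := by
  have hc := (continuousOn_coordValue_form o hχ hχ').continuousAt (χ.open_target.mem_nhds hu)
  have hd : χ.MDifferentiable (𝓡 m) (𝓡 m) :=
    ⟨hχ.mdifferentiableOn (by simp), hχ'.mdifferentiableOn (by simp)⟩
  exact (ContinuousAt.comp (continuousAt_sign_of_ne_zero (coordValue_form_ne_zero o hd hu))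
    hc).eventually (isOpen_discrete _ |>.mem_nhds rfl : {SignType.sign (coordValue χ o.form u)} ∈ _)

end ChartChange

/-! ### The integral of a top-degree form: linearity and computation in one chart -/

section FormIntegral

variable {m : ℕ} {X : Type*} [TopologicalSpace X] [ChartedSpace (Euc m) X] [IsManifold (𝓡 m) ∞ X]

/-- The coordinates of the points of `U` in the chart `χ`. -/
def chartDomain (χ : OpenPartialHomeomorph X (Euc m)) (U : Set X) : Set (Euc m) :=
  χ.target ∩ χ.symm ⁻¹' U

theorem isOpen_chartDomain (χ : OpenPartialHomeomorph X (Euc m)) {U : Set X} (hU : IsOpen U) :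
    IsOpen (chartDomain χ U) :=
  χ.isOpen_inter_preimage_symm hU

theorem measurableSet_chartDomain (χ : OpenPartialHomeomorph X (Euc m)) {U : Set X}
    (hU : IsOpen U) : MeasurableSet (chartDomain χ U) :=
  (isOpen_chartDomain χ hU).measurableSet

theorem orientedValue_eq_zero (o : ManifoldOrientation (m := m) X)
    (χ : OpenPartialHomeomorph X (Euc m)) {α : DiffForm (𝓡 m) X m} {u : Euc m}
    (h : α (χ.symm u) = 0) : orientedValue o χ α u = 0 := by
  have h0 : coordValue χ α u = 0 := by
    rw [coordValue, h]
    rfl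
  rw [orientedValue, h0, mul_zero]

section Change

variable {φ χ : OpenPartialHomeomorph X (Euc m)} {V : Set X}

theorem image_chartChange (hVφ : V ⊆ φ.source) (hVχ : V ⊆ χ.source) :
    (fun u => φ (χ.symm u)) '' chartDomain χ V = chartDomain φ V := by
  ext v
  constructor
  · rintro ⟨u, ⟨hu, hu'⟩, rfl⟩
    have h1 : χ.symm u ∈ φ.source := hVφ hu'
    refine ⟨φ.map_source h1, ?_⟩
    change φ.symm (φ (χ.symm u)) ∈ V
    rwa [φ.left_inv h1]
  · rintro ⟨hv, hv'⟩
    have h1 : φ.symm v ∈ χ.source := hVχ hv'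
    refine ⟨χ (φ.symm v), ⟨χ.map_source h1, ?_⟩, ?_⟩
    · change χ.symm (χ (φ.symm v)) ∈ V
      rwa [χ.left_inv h1]
    · change φ (χ.symm (χ (φ.symm v))) = v
      rw [χ.left_inv h1, φ.right_inv hv]

theorem injOn_chartChange (hVφ : V ⊆ φ.source) :
    InjOn (fun u => φ (χ.symm u)) (chartDomain χ V) := by
  intro u hu v hv h
  exact χ.symm.injOn hu.1 hv.1 (φ.injOn (hVφ hu.2) (hVφ hv.2) h)

theorem hasFDerivWithinAt_chartChange (hφ : φ.MDifferentiable (𝓡 m) (𝓡 m))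
    (hχ : χ.MDifferentiable (𝓡 m) (𝓡 m)) (hVφ : V ⊆ φ.source) :
    ∀ u ∈ chartDomain χ V, HasFDerivWithinAt (fun u => φ (χ.symm u))
      (fderiv ℝ (fun u => φ (χ.symm u)) u) (chartDomain χ V) u := fun _ hu =>
  (hasFDerivAt_chartChange hφ hχ hu.1 (hVφ hu.2)).differentiableAt.hasFDerivAt.hasFDerivWithinAt

theorem eqOn_chartChange (o : ManifoldOrientation (m := m) X)
    (hφ : φ.MDifferentiable (𝓡 m) (𝓡 m)) (hχ : χ.MDifferentiable (𝓡 m) (𝓡 m))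
    (hVφ : V ⊆ φ.source) (α : DiffForm (𝓡 m) X m) (g : X → ℝ) :
    EqOn (fun u => |(fderiv ℝ (fun u => φ (χ.symm u)) u).det| •
        (fun v => g (φ.symm v) * orientedValue o φ α v) (φ (χ.symm u)))
      (fun u => g (χ.symm u) * orientedValue o χ α u) (chartDomain χ V) := by
  intro u hu
  simp only [smul_eq_mul]
  rw [orientedValue_chartChange o hφ hχ α hu.1 (hVφ hu.2), φ.left_inv (hVφ hu.2)]
  ring

theorem integrableOn_chartDomain_iff (o : ManifoldOrientation (m := m) X)
    (hφ : φ.MDifferentiable (𝓡 m) (𝓡 m)) (hχ : χ.MDifferentiable (𝓡 m) (𝓡 m)) (hV : IsOpen V)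
    (hVφ : V ⊆ φ.source) (hVχ : V ⊆ χ.source) (α : DiffForm (𝓡 m) X m) (g : X → ℝ) :
    IntegrableOn (fun v => g (φ.symm v) * orientedValue o φ α v) (chartDomain φ V) ↔
      IntegrableOn (fun u => g (χ.symm u) * orientedValue o χ α u) (chartDomain χ V) := by
  rw [← image_chartChange hVφ hVχ,
    integrableOn_image_iff_integrableOn_abs_det_fderiv_smul volume
      (measurableSet_chartDomain χ hV) (hasFDerivWithinAt_chartChange hφ hχ hVφ)
      (injOn_chartChange hVφ)]
  exact integrableOn_congr_fun (eqOn_chartChange o hφ hχ hVφ α g) (measurableSet_chartDomain χ hV)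

theorem setIntegral_chartDomain_eq (o : ManifoldOrientation (m := m) X)
    (hφ : φ.MDifferentiable (𝓡 m) (𝓡 m)) (hχ : χ.MDifferentiable (𝓡 m) (𝓡 m)) (hV : IsOpen V)
    (hVφ : V ⊆ φ.source) (hVχ : V ⊆ χ.source) (α : DiffForm (𝓡 m) X m) (g : X → ℝ) :
    ∫ v in chartDomain φ V, g (φ.symm v) * orientedValue o φ α v =
      ∫ u in chartDomain χ V, g (χ.symm u) * orientedValue o χ α u := by
  rw [← image_chartChange hVφ hVχ,
    integral_image_eq_integral_abs_det_fderiv_smul volume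
      (measurableSet_chartDomain χ hV) (hasFDerivWithinAt_chartChange hφ hχ hVφ)
      (injOn_chartChange hVφ)]
  exact setIntegral_congr_fun (measurableSet_chartDomain χ hV) (eqOn_chartChange o hφ hχ hVφ α g)

end Change

variable [T2Space X] [SigmaCompactSpace X]

/-- Integrability on `U` of the local terms of `formIntegral`. -/
def FormIntegrable (o : ManifoldOrientation (m := m) X) (U : Set X) (α : DiffForm (𝓡 m) X m) :
    Prop :=
  ∀ c : X, IntegrableOn (fun u => chartPartition m X c ((chartAt (Euc m) c).symm u) *
    orientedValue o (chartAt (Euc m) c) α u) (chartDomain (chartAt (Euc m) c) U)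

theorem formIntegral_eq (o : ManifoldOrientation (m := m) X) (U : Set X)
    (α : DiffForm (𝓡 m) X m) :
    formIntegral o U α = ∑ᶠ c : X, ∫ u in chartDomain (chartAt (Euc m) c) U,
      chartPartition m X c ((chartAt (Euc m) c).symm u) *
        orientedValue o (chartAt (Euc m) c) α u := by
  simp only [formIntegral, orientedValue, chartDomain, mul_assoc]

theorem tsupport_chartPartition_subset (c : X) :
    tsupport (chartPartition m X c) ⊆ (chartAt (Euc m) c).source :=
  Classical.choose_spec (SmoothPartitionOfUnity.exists_isSubordinate_chartAt_source (𝓡 m) X) c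

theorem exists_finset_chartPartition {U : Set X} (hUc : IsCompact (closure U)) :
    ∃ s : Finset X, ∀ c ∉ s, ∀ x ∈ U, chartPartition m X c x = 0 := by
  have h := (chartPartition m X).locallyFinite.finite_nonempty_inter_compact hUc
  refine ⟨h.toFinset, fun c hc x hx => ?_⟩
  by_contra h0
  exact hc (h.mem_toFinset.2 ⟨x, h0, subset_closure hx⟩)

/-- A compact closure meets only finitely many supports of the partition, so the defining sum has a
finite index set that works for all forms simultaneously. -/
theorem formIntegral_eq_finset_sum (o : ManifoldOrientation (m := m) X) {U : Set X} (hU : IsOpen U)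
    {s : Finset X} (hs : ∀ c ∉ s, ∀ x ∈ U, chartPartition m X c x = 0) (α : DiffForm (𝓡 m) X m) :
    formIntegral o U α = ∑ c ∈ s, ∫ u in chartDomain (chartAt (Euc m) c) U,
      chartPartition m X c ((chartAt (Euc m) c).symm u) *
        orientedValue o (chartAt (Euc m) c) α u := by
  rw [formIntegral_eq]
  refine finsum_eq_sum_of_support_subset _ fun c hc => ?_
  by_contra hcs
  refine hc ?_
  refine (setIntegral_congr_fun (measurableSet_chartDomain _ hU) (g := fun _ => 0)
    fun u hu => ?_).trans (by simp)
  simp only [hs c hcs _ hu.2, zero_mul]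

theorem formIntegral_congr (o : ManifoldOrientation (m := m) X) {U : Set X} (hU : IsOpen U)
    {α β : DiffForm (𝓡 m) X m} (h : ∀ x ∈ U, α x = β x) :
    formIntegral o U α = formIntegral o U β := by
  rw [formIntegral_eq, formIntegral_eq]
  refine finsum_congr fun c => setIntegral_congr_fun (measurableSet_chartDomain _ hU) fun u hu => ?_
  simp only [orientedValue, coordValue, h _ hu.2]

theorem formIntegral_sum (o : ManifoldOrientation (m := m) X) {U : Set X} (hU : IsOpen U)
    (hUc : IsCompact (closure U)) {ι : Type*} (t : Finset ι) {α : ι → DiffForm (𝓡 m) X m}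
    (hα : ∀ j ∈ t, FormIntegrable o U (α j)) :
    formIntegral o U (fun x => ∑ j ∈ t, α j x) = ∑ j ∈ t, formIntegral o U (α j) := by
  obtain ⟨s, hs⟩ := exists_finset_chartPartition (m := m) hUc
  simp only [formIntegral_eq_finset_sum o hU hs]
  rw [Finset.sum_comm]
  refine Finset.sum_congr rfl fun c _ => ?_
  rw [← integral_finsetSum t fun j hj => hα j hj c]
  refine setIntegral_congr_fun (measurableSet_chartDomain _ hU) fun u _ => ?_
  simp only [orientedValue, coordValue]
  rw [← Finset.mul_sum, ← Finset.mul_sum]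
  congr 2
  exact ContinuousAlternatingMap.sum_apply _ _

variable {χ : OpenPartialHomeomorph X (Euc m)} {U : Set X} {α : DiffForm (𝓡 m) X m}

theorem continuousOn_chartPartition_symm (c : X) :
    ContinuousOn (fun u => chartPartition m X c (χ.symm u)) χ.target :=
  (chartPartition m X c).contMDiff.continuous.comp_continuousOn χ.continuousOn_symm

theorem integrableOn_chartPartition_mul {f : Euc m → ℝ} (hU : IsOpen U)
    (hf : IntegrableOn f (chartDomain χ U)) (c : X) :
    IntegrableOn (fun u => chartPartition m X c (χ.symm u) * f u) (chartDomain χ U) := by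
  refine Integrable.bdd_mul (c := 1) hf ?_ (Eventually.of_forall fun u => ?_)
  · exact ((continuousOn_chartPartition_symm c).mono inter_subset_left).aestronglyMeasurable
      (measurableSet_chartDomain χ hU)
  · rw [Real.norm_eq_abs, abs_of_nonneg ((chartPartition m X).nonneg _ _)]
    exact (chartPartition m X).le_one _ _

/-- On the overlap with another chart integrability is carried over by the change of variables; off
the overlap the form is zero. -/
theorem formIntegrable_of_support (o : ManifoldOrientation (m := m) X) (hU : IsOpen U)
    (hχ : χ.MDifferentiable (𝓡 m) (𝓡 m))
    (hα : ∀ x ∈ U, x ∉ χ.source → α x = 0)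
    (hint : IntegrableOn (orientedValue o χ α) (chartDomain χ U)) : FormIntegrable o U α := by
  intro c
  set φ := chartAt (Euc m) c
  set V := U ∩ (φ.source ∩ χ.source)
  have hV : IsOpen V := hU.inter (φ.open_source.inter χ.open_source)
  have h1 : IntegrableOn (fun u => chartPartition m X c (χ.symm u) * orientedValue o χ α u)
      (chartDomain χ V) :=
    (integrableOn_chartPartition_mul hU hint c).mono_set fun u hu => ⟨hu.1, hu.2.1⟩
  have h2 := (integrableOn_chartDomain_iff o (mdifferentiable_chart c) hχ hV (fun x hx => hx.2.1)
    (fun x hx => hx.2.2) α (chartPartition m X c)).2 h1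
  refine IntegrableOn.of_forall_sdiff_eq_zero h2 (measurableSet_chartDomain _ hU) fun u hu => ?_
  have h3 : φ.symm u ∉ χ.source := fun h =>
    hu.2 ⟨hu.1.1, hu.1.2, φ.map_target hu.1.1, h⟩
  rw [orientedValue_eq_zero o _ (hα _ hu.1.2 h3), mul_zero]

/-- Each term of the partition can be moved to the chart χ: on the overlap by change of variables,
while off the overlap the integrand is zero on either side. The partition then sums to one. -/
theorem formIntegral_of_support (o : ManifoldOrientation (m := m) X) (hU : IsOpen U)
    (hUc : IsCompact (closure U)) (hχ : χ.MDifferentiable (𝓡 m) (𝓡 m))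
    (hα : ∀ x ∈ U, x ∉ χ.source → α x = 0)
    (hint : IntegrableOn (orientedValue o χ α) (chartDomain χ U)) :
    formIntegral o U α = ∫ u in chartDomain χ U, orientedValue o χ α u := by
  obtain ⟨s, hs⟩ := exists_finset_chartPartition (m := m) hUc
  have key : ∀ c, ∫ u in chartDomain (chartAt (Euc m) c) U,
      chartPartition m X c ((chartAt (Euc m) c).symm u) *
        orientedValue o (chartAt (Euc m) c) α u =
      ∫ u in chartDomain χ U, chartPartition m X c (χ.symm u) * orientedValue o χ α u := by
    intro c
    set φ := chartAt (Euc m) c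
    set V := U ∩ (φ.source ∩ χ.source)
    have hV : IsOpen V := hU.inter (φ.open_source.inter χ.open_source)
    rw [setIntegral_eq_of_subset_of_forall_sdiff_eq_zero (measurableSet_chartDomain φ hU)
        (s := chartDomain φ V) (fun u hu => ⟨hu.1, hu.2.1⟩) ?_,
      setIntegral_eq_of_subset_of_forall_sdiff_eq_zero (measurableSet_chartDomain χ hU)
        (s := chartDomain χ V) (fun u hu => ⟨hu.1, hu.2.1⟩) ?_]
    · exact setIntegral_chartDomain_eq o (mdifferentiable_chart c) hχ hV (fun x hx => hx.2.1)
        (fun x hx => hx.2.2) α (chartPartition m X c)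
    -- On the χ side the partition function vanishes outside its own chart; on the φ side, treated
    -- next, it is the form that vanishes outside χ.
    · intro u hu
      have h3 : χ.symm u ∉ φ.source := fun h =>
        hu.2 ⟨hu.1.1, hu.1.2, h, χ.map_target hu.1.1⟩
      rw [image_eq_zero_of_notMem_tsupport fun h => h3 (tsupport_chartPartition_subset c h),
        zero_mul]
    · intro u hu
      have h3 : φ.symm u ∉ χ.source := fun h =>
        hu.2 ⟨hu.1.1, hu.1.2, φ.map_target hu.1.1, h⟩
      rw [orientedValue_eq_zero o _ (hα _ hu.1.2 h3), mul_zero]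
  rw [formIntegral_eq_finset_sum o hU hs, Finset.sum_congr rfl fun c _ => key c,
    ← integral_finsetSum s fun c _ => integrableOn_chartPartition_mul hU hint c]
  refine setIntegral_congr_fun (measurableSet_chartDomain χ hU) fun u hu => ?_
  simp only [← Finset.sum_mul]
  have h : ∑ c ∈ s, chartPartition m X c (χ.symm u) = 1 := by
    rw [← (chartPartition m X).sum_eq_one (mem_univ (χ.symm u))]
    refine (finsum_eq_sum_of_support_subset _ fun c hc => ?_).symm
    by_contra hcs
    exact hc (hs c hcs _ hu.2)
  rw [h, one_mul]

end FormIntegral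

/-! ### Integrals of derivatives over open sets with arbitrary frontier -/

section Divergence

variable {E : Type*} [NormedAddCommGroup E] [NormedSpace ℝ E]

/-- A segment from a point of D to a point outside meets the frontier, where G is zero. The
Lipschitz estimate up to that crossing point bounds the jump. -/
theorem _root_.LipschitzWith.indicator_of_frontier {C : NNReal} {G : E → ℝ}
    (hG : LipschitzWith C G) {D : Set E} (h0 : ∀ x ∈ frontier D, G x = 0) :
    LipschitzWith C (D.indicator G) := by
  have key : ∀ x ∈ D, ∀ y ∉ D, |G x| ≤ C * dist x y := by
    intro x hx y hy
    obtain ⟨z, hz, hzD⟩ : (segment ℝ x y ∩ frontier D).Nonempty := by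
      -- If the segment missed the frontier, the interior of D and the complement of its closure
      -- would disconnect it.
      by_contra hne
      have hcov : ∀ z ∈ segment ℝ x y, z ∈ closure D → z ∈ _root_.interior D := fun z hz hzD => by
        by_contra h
        exact hne ⟨z, hz, hzD, h⟩
      obtain ⟨z, -, hz₁, hz₂⟩ := (convex_segment x y).isPreconnected (_root_.interior D) (closure D)ᶜ
        isOpen_interior isClosed_closure.isOpen_compl
        (fun z hz => or_iff_not_imp_right.2 fun h => hcov z hz (not_not.1 h))
        ⟨x, left_mem_segment ℝ x y, hcov x (left_mem_segment ℝ x y) (subset_closure hx)⟩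
        ⟨y, right_mem_segment ℝ x y, fun h =>
          hy (interior_subset (hcov y (right_mem_segment ℝ x y) h))⟩
      exact hz₂ (subset_closure (interior_subset hz₁))
    have h1 := hG.dist_le_mul x z
    rw [h0 z hzD, Real.dist_eq, sub_zero] at h1
    refine h1.trans (mul_le_mul_of_nonneg_left ?_ C.2)
    have := dist_add_dist_of_mem_segment hz
    linarith [dist_nonneg (x := z) (y := y)]
  refine LipschitzWith.of_dist_le_mul fun x y => ?_
  by_cases hx : x ∈ D <;> by_cases hy : y ∈ D
  · rw [indicator_of_mem hx, indicator_of_mem hy]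
    exact hG.dist_le_mul x y
  · rw [indicator_of_mem hx, indicator_of_notMem hy, Real.dist_eq, sub_zero]
    exact key x hx y hy
  · rw [indicator_of_notMem hx, indicator_of_mem hy, dist_comm x y, dist_comm, Real.dist_eq,
      sub_zero]
    exact key y hy x hx
  · rw [indicator_of_notMem hx, indicator_of_notMem hy, dist_self]
    positivity

variable [MeasurableSpace E] [BorelSpace E] {μ : Measure E}

/-- A zero of a nonnegative function is a minimum. -/
theorem lineDeriv_eq_zero_of_nonneg {f : E → ℝ} (hf : ∀ x, 0 ≤ f x) {x : E} (hx : f x = 0) (v : E) :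
    lineDeriv ℝ f x v = 0 := by
  have h : IsLocalMin f x := Eventually.of_forall fun y => hx ▸ hf y
  rw [h.lineDeriv_eq_zero]
  rfl

variable [FiniteDimensional ℝ E] [μ.IsAddHaarMeasure]

theorem integrable_lineDeriv_of_nonneg {f : E → ℝ} {C : NNReal} (hf : LipschitzWith C f)
    (h0 : ∀ x, 0 ≤ f x) (hc : HasCompactSupport f) (v : E) :
    Integrable (fun x => lineDeriv ℝ f x v) μ := by
  rw [← integrableOn_univ]
  refine IntegrableOn.of_forall_sdiff_eq_zero
    ((hf.locallyIntegrable_lineDeriv (μ := μ) v).integrableOn_isCompact hc) MeasurableSet.univ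
    fun x hx => lineDeriv_eq_zero_of_nonneg h0 (image_eq_zero_of_notMem_tsupport hx.2) v

theorem integral_lineDeriv_eq_zero {f : E → ℝ} {C : NNReal} (hf : LipschitzWith C f)
    (hc : HasCompactSupport f) (v : E) : ∫ x, lineDeriv ℝ f x v ∂μ = 0 := by
  -- Integration by parts against the constant 1. The direction is -v because moving the derivative
  -- to the other factor reverses it.
  have h := LipschitzWith.integral_lineDeriv_mul_eq (μ := μ)
    (LipschitzWith.const (1 : ℝ) : LipschitzWith 0 fun _ : E => (1 : ℝ)) hf hc (-v)
  have h1 : ∀ x : E, lineDeriv ℝ (fun _ : E => (1 : ℝ)) x (-v) = 0 := fun x => by simp [lineDeriv]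
  simpa [h1] using h.symm

/-- The integral of a directional derivative of a compactly supported function over an open set
vanishes if the function vanishes on the frontier of the set. -/
theorem setIntegral_fderiv_eq_zero_of_frontier {G : E → ℝ} (hG : ContDiff ℝ 1 G)
    (hc : HasCompactSupport G) {D : Set E} (hD : IsOpen D) (h0 : ∀ x ∈ frontier D, G x = 0)
    (v : E) : ∫ x in D, fderiv ℝ G x v ∂μ = 0 := by
  obtain ⟨C, hC⟩ := hG.lipschitzWith_of_hasCompactSupport hc (by simp)
  set F := D.indicator G
  have hF : LipschitzWith C F := hC.indicator_of_frontier h0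
  have hFc : HasCompactSupport F := hc.mono fun x hx h => hx (by
    by_cases hxD : x ∈ D
    · rw [← h]
      exact indicator_of_mem hxD _
    · exact indicator_of_notMem hxD _)
  have hp : ∀ f : E → ℝ, LipschitzWith C f → LipschitzWith C (fun x => max (f x) 0) :=
    fun f hf => hf.max_const 0
  have hpc : ∀ f : E → ℝ, HasCompactSupport f → HasCompactSupport (fun x => max (f x) 0) :=
    fun f hf => hf.comp_left (g := fun t : ℝ => max t 0) (by simp)
  -- Outside D the derivative of the extension by zero must vanish, including on frontier points,
  -- which may have positive measure. A signed function need not have derivative zero at a zero, but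
  -- its positive and negative parts have a minimum there.
  set F₁ : E → ℝ := fun x => max (F x) 0
  set F₂ : E → ℝ := fun x => max (-F x) 0
  have hF₁ : LipschitzWith C F₁ := hp _ hF
  have hF₂ : LipschitzWith C F₂ := hp _ hF.neg
  have hF₁c : HasCompactSupport F₁ := hpc _ hFc
  have hF₂c : HasCompactSupport F₂ :=
    hpc (fun x => -F x) (hFc.comp_left (g := fun t : ℝ => -t) (by simp))
  have hn₁ : ∀ x, 0 ≤ F₁ x := fun x => le_max_right _ _
  have hn₂ : ∀ x, 0 ≤ F₂ x := fun x => le_max_right _ _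
  have hsub : ∀ x, F x = F₁ x - F₂ x := fun x => by
    simp only [F₁, F₂]
    rcases le_total (F x) 0 with h | h
    · rw [max_eq_right h, max_eq_left (by linarith)]; ring
    · rw [max_eq_left h, max_eq_right (by linarith)]; ring
  have hae : D.indicator (fun x => fderiv ℝ G x v) =ᵐ[μ]
      fun x => lineDeriv ℝ F₁ x v - lineDeriv ℝ F₂ x v := by
    filter_upwards [hF₁.ae_lineDifferentiableAt (μ := μ) v, hF₂.ae_lineDifferentiableAt (μ := μ) v]
      with x hx₁ hx₂
    by_cases hx : x ∈ D
    · rw [indicator_of_mem hx]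
      have h1 : HasLineDerivAt ℝ F (lineDeriv ℝ F₁ x v - lineDeriv ℝ F₂ x v) x v := by
        have h2 : HasLineDerivAt ℝ (fun y => F₁ y - F₂ y)
            (lineDeriv ℝ F₁ x v - lineDeriv ℝ F₂ x v) x v :=
          HasDerivAt.sub hx₁.hasLineDerivAt hx₂.hasLineDerivAt
        exact HasLineDerivAt.congr_of_eventuallyEq h2 (Eventually.of_forall hsub)
      have h3 : F =ᶠ[𝓝 x] G := by
        filter_upwards [hD.mem_nhds hx] with y hy
        exact indicator_of_mem hy _
      have h4 : HasLineDerivAt ℝ F (fderiv ℝ G x v) x v :=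
        ((hG.differentiable (by simp) x).hasFDerivAt.hasLineDerivAt v).congr_of_eventuallyEq h3
      exact h4.unique h1
    · have hFx : F x = 0 := indicator_of_notMem hx _
      rw [indicator_of_notMem hx, lineDeriv_eq_zero_of_nonneg hn₁ (by simp [F₁, hFx]),
        lineDeriv_eq_zero_of_nonneg hn₂ (by simp [F₂, hFx]), sub_zero]
  rw [← integral_indicator hD.measurableSet, integral_congr_ae hae,
    integral_sub (integrable_lineDeriv_of_nonneg hF₁ hn₁ hF₁c v)
      (integrable_lineDeriv_of_nonneg hF₂ hn₂ hF₂c v),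
    integral_lineDeriv_eq_zero hF₁ hF₁c, integral_lineDeriv_eq_zero hF₂ hF₂c, sub_zero]

end Divergence

section Calculus

variable {E : Type*} [NormedAddCommGroup E] [NormedSpace ℝ E]
  {W : Type*} [NormedAddCommGroup W] [NormedSpace ℝ W]

theorem contDiff_of_forall_tsupport {f : E → W} {r : WithTop ℕ∞}
    (h : ∀ x ∈ tsupport f, ContDiffAt ℝ r f x) : ContDiff ℝ r f := by
  refine contDiff_iff_contDiffAt.2 fun x => ?_
  by_cases hx : x ∈ tsupport f
  · exact h x hx
  · exact contDiffAt_const.congr_of_eventuallyEq (notMem_tsupport_iff_eventuallyEq.1 hx)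

/-- Integration by parts for one term of a first-order Lagrangian. -/
theorem fderiv_mul_fderiv_eq {F : ℝ × E → W} {p : ℝ × E} (hF : ContDiffAt ℝ 2 F p)
    (P Q : W →L[ℝ] ℝ) (v : E) :
    fderiv ℝ (fun q => P (F q) * Q (fderiv ℝ F q (0, v))) p (1, 0) =
      P (fderiv ℝ F p (1, 0)) * Q (fderiv ℝ F p (0, v)) -
      P (fderiv ℝ F p (0, v)) * Q (fderiv ℝ F p (1, 0)) +
      fderiv ℝ (fun u => P (F (p.1, u)) * Q (fderiv ℝ F (p.1, u) (1, 0))) p.2 v := by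
  have hsymm := hF.isSymmSndFDerivAt (by simp) (1, 0) (0, v)
  have h1 : HasFDerivAt F (fderiv ℝ F p) p := (hF.differentiableAt (by simp)).hasFDerivAt
  have h2 : HasFDerivAt (fderiv ℝ F) (fderiv ℝ (fderiv ℝ F) p) p :=
    ((hF.fderiv_right (m := 1) (by norm_num)).differentiableAt (by simp)).hasFDerivAt
  have h3 : ∀ a : ℝ × E, HasFDerivAt (fun q => P (F q) * Q (fderiv ℝ F q a)) _ p := fun a =>
    (P.hasFDerivAt.comp p h1).mul (Q.hasFDerivAt.comp p (h2.clm_apply (hasFDerivAt_const a p)))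
  have h4 : HasFDerivAt (fun u : E => (p.1, u)) (ContinuousLinearMap.inr ℝ ℝ E) p.2 :=
    hasFDerivAt_prodMk_right p.1 p.2
  have h5 : fderiv ℝ (fun u => P (F (p.1, u)) * Q (fderiv ℝ F (p.1, u) (1, 0))) p.2 v =
      fderiv ℝ (fun q => P (F q) * Q (fderiv ℝ F q (1, 0))) p (0, v) := by
    have h6 := (h3 (1, 0)).comp (x := p.2) (f := fun u : E => (p.1, u)) h4
    rw [(h3 (1, 0)).fderiv]
    exact congrArg (fun L : E →L[ℝ] ℝ => L v) h6.fderiv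
  rw [h5, (h3 (0, v)).fderiv, (h3 (1, 0)).fderiv]
  simp [hsymm]
  ring

variable [MeasurableSpace E] [BorelSpace E] {μ : Measure E} [IsFiniteMeasureOnCompacts μ]

theorem continuous_cutoff_mul {c f : E → ℝ} (hc : Continuous c) {O : Set E} (hO : IsOpen O)
    (hcO : tsupport c ⊆ O) (hf : ContinuousOn f O) : Continuous (fun u => c u * f u) :=
  (hc.continuousOn.mul hf).continuous_of_tsupport_subset hO ((tsupport_mul_subset_left).trans hcO)

theorem integrable_cutoff_mul {c f : E → ℝ} (hc : Continuous c) (hcc : HasCompactSupport c)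
    {O : Set E} (hO : IsOpen O) (hcO : tsupport c ⊆ O) (hf : ContinuousOn f O) :
    Integrable (fun u => c u * f u) μ :=
  (continuous_cutoff_mul hc hO hcO hf).integrable_of_hasCompactSupport hcc.mul_right

theorem hasDerivAt_setIntegral_cutoff_mul {c : E → ℝ} (hc : Continuous c)
    (hcc : HasCompactSupport c) {O : Set E} (hO : IsOpen O) (hcO : tsupport c ⊆ O)
    {δ : ℝ} (hδ : 0 < δ) {L : ℝ × E → ℝ} (hL : ContDiffOn ℝ 1 L (Ioo (-δ) δ ×ˢ O)) (D : Set E) :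
    HasDerivAt (fun ε => ∫ u in D, c u * L (ε, u) ∂μ)
      (∫ u in D, c u * fderiv ℝ L (0, u) (1, 0) ∂μ) 0 := by
  have hS : IsOpen (Ioo (-δ) δ ×ˢ O) := isOpen_Ioo.prod hO
  have hL' : ContinuousOn (fun p => fderiv ℝ L p (1, 0)) (Ioo (-δ) δ ×ˢ O) :=
    (hL.continuousOn_fderiv_of_isOpen hS (by simp)).clm_apply continuousOn_const
  have hsl : ∀ ε ∈ Ioo (-δ) δ, ∀ f : ℝ × E → ℝ, ContinuousOn f (Ioo (-δ) δ ×ˢ O) →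
      ContinuousOn (fun u => f (ε, u)) O := fun ε hε f hf =>
    hf.comp (Continuous.prodMk_right ε).continuousOn fun u hu => ⟨hε, hu⟩
  have hK : IsCompact (Icc (-(δ / 2)) (δ / 2) ×ˢ tsupport c) := isCompact_Icc.prod hcc
  have hKS : Icc (-(δ / 2)) (δ / 2) ×ˢ tsupport c ⊆ Ioo (-δ) δ ×ˢ O := fun p hp =>
    ⟨⟨by linarith [hp.1.1], by linarith [hp.1.2]⟩, hcO hp.2⟩
  obtain ⟨M, hM⟩ := hK.exists_bound_of_continuousOn (hL'.mono hKS)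
  have h0 : (0 : ℝ) ∈ Ioo (-δ) δ := ⟨by linarith, hδ⟩
  have hnhds : Ioo (-(δ / 2)) (δ / 2) ∈ 𝓝 (0 : ℝ) := Ioo_mem_nhds (by linarith) (by linarith)
  refine (hasDerivAt_integral_of_dominated_loc_of_deriv_le
    (F := fun ε u => c u * L (ε, u)) (F' := fun ε u => c u * fderiv ℝ L (ε, u) (1, 0))
    (bound := fun u => ‖c u‖ * M) hnhds ?_ ?_ ?_ ?_ ?_ ?_).2
  · filter_upwards [Ioo_mem_nhds h0.1 h0.2] with ε hε
    exact (integrable_cutoff_mul hc hcc hO hcO (hsl ε hε L hL.continuousOn)).aestronglyMeasurable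
  · exact (integrable_cutoff_mul hc hcc hO hcO (hsl 0 h0 L hL.continuousOn)).integrableOn
  · exact (integrable_cutoff_mul hc hcc hO hcO (hsl 0 h0 _ hL')).aestronglyMeasurable
  · refine Eventually.of_forall fun u ε hε => ?_
    by_cases hu : u ∈ tsupport c
    · rw [norm_mul]
      exact mul_le_mul_of_nonneg_left (hM (ε, u) ⟨Ioo_subset_Icc_self hε, hu⟩) (norm_nonneg _)
    · simp [image_eq_zero_of_notMem_tsupport hu]
  · exact ((hc.norm.integrable_of_hasCompactSupport hcc.norm).mul_const M).integrableOn
  · refine Eventually.of_forall fun u ε hε => ?_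
    by_cases hu : u ∈ tsupport c
    · have hp : (ε, u) ∈ Ioo (-δ) δ ×ˢ O := hKS ⟨Ioo_subset_Icc_self hε, hu⟩
      have h1 : HasFDerivAt L (fderiv ℝ L (ε, u)) (ε, u) :=
        ((hL.contDiffAt (hS.mem_nhds hp)).differentiableAt (by simp)).hasFDerivAt
      have h2 : HasDerivAt (fun t : ℝ => (t, u)) ((1 : ℝ), (0 : E)) ε :=
        (hasDerivAt_id ε).prodMk (hasDerivAt_const ε u)
      exact (h1.comp_hasDerivAt ε h2).const_mul (c u)
    · simpa [image_eq_zero_of_notMem_tsupport hu] using hasDerivAt_const ε (0 : ℝ)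

theorem setIntegral_mul_fderiv_eq [FiniteDimensional ℝ E] {μ : Measure E} [μ.IsAddHaarMeasure] {c η : E → ℝ}
    (hc : ContDiff ℝ 1 c) (hcc : HasCompactSupport c) {O : Set E} (hO : IsOpen O)
    (hcO : tsupport c ⊆ O) (hη : ContDiffOn ℝ 1 η O) {D : Set E} (hD : IsOpen D)
    (h0 : ∀ u ∈ frontier D ∩ O, η u = 0) (v : E) :
    ∫ u in D, c u * fderiv ℝ η u v ∂μ = - ∫ u in D, η u * fderiv ℝ c u v ∂μ := by
  have hG : ContDiff ℝ 1 (fun u => c u * η u) := contDiff_of_forall_tsupport fun u hu =>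
    hc.contDiffAt.mul (hη.contDiffAt (hO.mem_nhds (hcO (tsupport_mul_subset_left hu))))
  have h1 := setIntegral_fderiv_eq_zero_of_frontier (μ := μ) hG hcc.mul_right hD (fun u hu => by
    by_cases h : u ∈ O
    · rw [h0 u ⟨hu, h⟩, mul_zero]
    · rw [image_eq_zero_of_notMem_tsupport fun h' => h (hcO h'), zero_mul]) v
  have h2 : ∀ u, fderiv ℝ (fun u => c u * η u) u v =
      c u * fderiv ℝ η u v + fderiv ℝ c u v * η u := by
    intro u
    by_cases h : u ∈ O
    · have hd : DifferentiableAt ℝ η u := (hη.contDiffAt (hO.mem_nhds h)).differentiableAt (by simp)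
      rw [fderiv_fun_mul (hc.differentiable (by simp) u) hd]
      simp [mul_comm]
    · have h' : u ∉ tsupport c := fun h' => h (hcO h')
      have h3 : (fun u => c u * η u) =ᶠ[𝓝 u] fun _ => 0 := by
        filter_upwards [notMem_tsupport_iff_eventuallyEq.1 h'] with y hy
        rw [hy, Pi.zero_apply, zero_mul]
      rw [h3.fderiv_eq, (notMem_tsupport_iff_eventuallyEq.1 h').fderiv_eq,
        image_eq_zero_of_notMem_tsupport h']
      simp
  have hi1 : Integrable (fun u => c u * fderiv ℝ η u v) μ :=
    integrable_cutoff_mul hc.continuous hcc hO hcO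
      ((hη.continuousOn_fderiv_of_isOpen hO (by simp)).clm_apply continuousOn_const)
  have hi2 : Integrable (fun u => fderiv ℝ c u v * η u) μ :=
    integrable_cutoff_mul ((hc.continuous_fderiv (by simp)).clm_apply continuous_const)
      (hcc.fderiv_apply ℝ v) hO
      ((tsupport_fderiv_apply_subset ℝ v).trans hcO) hη.continuousOn
  simp only [h2] at h1
  rw [integral_add hi1.integrableOn hi2.integrableOn] at h1
  simp only [mul_comm (η _)]
  linarith

end Calculus

section CoordinateVariation

variable {n N K : ℕ} {X Y B FY FB : Type*}
  [TopologicalSpace X] [ChartedSpace (Euc (n + 1)) X] [IsManifold (𝓡 (n + 1)) ∞ X]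
  [TopologicalSpace Y] [ChartedSpace (Euc (n + 1 + N)) Y] [IsManifold (𝓡 (n + 1 + N)) ∞ Y]
  [TopologicalSpace B] [ChartedSpace (Euc (n + 1 + N + K)) B]
  [IsManifold (𝓡 (n + 1 + N + K)) ∞ B]
  [TopologicalSpace FY] [ChartedSpace (Euc N) FY] [IsManifold (𝓡 N) ∞ FY]
  [TopologicalSpace FB] [ChartedSpace (Euc K) FB]
  {πY : SmoothFiberBundle (n + 1 + N) (n + 1) N Y X FY}
  {πB : SmoothFiberBundle (n + 1 + N + K) (n + 1 + N) K B Y FB}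


/-- The momentum coordinate `p_A^μ` as a linear functional. -/
def momL (μ : Fin (n + 1)) (A : Fin N) : CoordP n N K →L[ℝ] ℝ :=
  (ContinuousLinearMap.proj A).comp ((ContinuousLinearMap.proj (R := ℝ) (φ := fun _ => Fin N → ℝ)
    μ).comp (ContinuousLinearMap.snd ℝ ((Euc (n + 1) × Euc N) × Euc K) (Mom (n + 1) N)))

/-- The field coordinate `y^A` as a linear functional. -/
def fieldL (A : Fin N) : CoordP n N K →L[ℝ] ℝ :=
  (EuclideanSpace.proj A).comp ((ContinuousLinearMap.snd ℝ (Euc (n + 1)) (Euc N)).comp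
    ((ContinuousLinearMap.fst ℝ (Euc (n + 1) × Euc N) (Euc K)).comp
      (ContinuousLinearMap.fst ℝ ((Euc (n + 1) × Euc N) × Euc K) (Mom (n + 1) N))))

/-- The vector `p_A^μ V^A` at the point `q`. -/
def flux (q V : CoordP n N K) (μ : Fin (n + 1)) : ℝ := ∑ A, q.2 μ A * V.1.1.2 A

theorem flux_eq (q V : CoordP n N K) (μ : Fin (n + 1)) :
    flux q V μ = ∑ A, momL μ A q * fieldL A V := rfl

namespace AdaptedCoords

variable (κ : AdaptedCoords πY πB) (e : EnergySection πY πB)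
  {F : ℝ × Euc (n + 1) → CoordP n N K}

/-- The density of the action of a family of sections in coordinates. -/
def lagrangian (F : ℝ × Euc (n + 1) → CoordP n N K) (p : ℝ × Euc (n + 1)) : ℝ :=
  - κ.eC e (F p) + ∑ μ, ∑ A, (F p).2 μ A * (fderiv ℝ F p (0, stdVec μ)).1.1.2 A

theorem lagrangian_eq : κ.lagrangian e F = fun p => - κ.eC e (F p) +
    ∑ μ, ∑ A, momL μ A (F p) * fieldL A (fderiv ℝ F p (0, stdVec μ)) := rfl

theorem contDiffOn_lagrangian {S : Set (ℝ × Euc (n + 1))} (hS : IsOpen S)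
    (hF : ContDiffOn ℝ ∞ F S) (hm : ∀ p ∈ S, (F p).1 ∈ κ.chart.target) :
    ContDiffOn ℝ ∞ (κ.lagrangian e F) S := by
  rw [lagrangian_eq]
  have h1 : ContDiffOn ℝ ∞ (fderiv ℝ F) S := hF.fderiv_of_isOpen hS (by simp)
  refine ((κ.contDiffOn_eC e).comp hF hm).neg.add ?_
  refine ContDiffOn.sum fun μ _ => ContDiffOn.sum fun A _ => ?_
  exact ((momL μ A).contDiff.comp_contDiffOn hF).mul
    ((fieldL A).contDiff.comp_contDiffOn (h1.clm_apply contDiffOn_const))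

theorem fderiv_lagrangian {p : ℝ × Euc (n + 1)} (hF : ContDiffAt ℝ ∞ F p)
    (hp : (F p).1 ∈ κ.chart.target) :
    fderiv ℝ (κ.lagrangian e F) p (1, 0) =
      - κ.eulerLagrange e (F p) (fun μ => fderiv ℝ F p (0, stdVec μ)) (fderiv ℝ F p (1, 0)) +
      ∑ μ, fderiv ℝ (fun u => flux (F (p.1, u)) (fderiv ℝ F (p.1, u) (1, 0)) μ) p.2 (stdVec μ) := by
  have hF2 : ContDiffAt ℝ 2 F p := hF.of_le ENat.LEInfty.out
  have hd : HasFDerivAt F (fderiv ℝ F p) p := (hF2.differentiableAt (by simp)).hasFDerivAt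
  have hE := (κ.differentiableAt_eC e hp).hasFDerivAt.comp p hd
  have hF1 : ContDiffAt ℝ 1 (fderiv ℝ F) p := hF2.fderiv_right (by norm_num)
  have ht : ∀ (μ : Fin (n + 1)) (A : Fin N) (a : ℝ × Euc (n + 1)), DifferentiableAt ℝ
      (fun q => momL μ A (F q) * fieldL A (fderiv ℝ F q a)) p := fun μ A a =>
    ((momL μ A).differentiableAt.comp p hd.differentiableAt).mul ((fieldL A).differentiableAt.comp p
      ((hF1.differentiableAt (by simp)).clm_apply (differentiableAt_const _)))
  have hsl : ∀ (μ : Fin (n + 1)) (A : Fin N), DifferentiableAt ℝ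
      (fun u => momL μ A (F (p.1, u)) * fieldL A (fderiv ℝ F (p.1, u) (1, 0))) p.2 := fun μ A =>
    (ht μ A (1, 0)).comp (x := p.2) (f := fun u => (p.1, u))
      (hasFDerivAt_prodMk_right p.1 p.2).differentiableAt
  have h1 : fderiv ℝ (κ.lagrangian e F) p (1, 0) = - fderiv ℝ (κ.eC e) (F p) (fderiv ℝ F p (1, 0)) +
      ∑ μ, ∑ A, fderiv ℝ (fun q => momL μ A (F q) * fieldL A (fderiv ℝ F q (0, stdVec μ))) p
        (1, 0) := by
    have h2 := hE.neg.add (HasFDerivAt.fun_sum (u := Finset.univ) fun μ _ =>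
      HasFDerivAt.fun_sum (u := Finset.univ) fun A _ => (ht μ A (0, stdVec μ)).hasFDerivAt)
    have h3 : fderiv ℝ (κ.lagrangian e F) p = _ := h2.fderiv
    rw [h3]
    simp [sum_apply]
  have h4 : ∀ μ, fderiv ℝ (fun u => flux (F (p.1, u)) (fderiv ℝ F (p.1, u) (1, 0)) μ) p.2
      (stdVec μ) = ∑ A, fderiv ℝ (fun u => momL μ A (F (p.1, u)) *
        fieldL A (fderiv ℝ F (p.1, u) (1, 0))) p.2 (stdVec μ) := by
    intro μ
    simp only [flux_eq]
    rw [fderiv_fun_sum fun A _ => hsl μ A, sum_apply]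
  rw [h1]
  simp only [h4, fun (μ : Fin (n + 1)) (A : Fin N) =>
    fderiv_mul_fderiv_eq hF2 (momL μ A) (fieldL A) (stdVec μ)]
  simp only [Finset.sum_add_distrib, Finset.sum_sub_distrib]
  simp only [eulerLagrange]
  change _ = -(_ - (∑ μ, ∑ A, momL μ A (fderiv ℝ F p (1, 0)) *
    fieldL A (fderiv ℝ F p (0, stdVec μ))) + ∑ μ, ∑ A, momL μ A (fderiv ℝ F p (0, stdVec μ)) *
    fieldL A (fderiv ℝ F p (1, 0))) + _
  ring

/-- The first variation of the action of a family of sections in coordinates, with a cut-off. -/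
theorem hasDerivAt_setIntegral_lagrangian {c : Euc (n + 1) → ℝ} (hc : ContDiff ℝ 1 c)
    (hcc : HasCompactSupport c) {O : Set (Euc (n + 1))} (hO : IsOpen O) (hcO : tsupport c ⊆ O)
    {δ : ℝ} (hδ : 0 < δ) (hF : ContDiffOn ℝ ∞ F (Ioo (-δ) δ ×ˢ O))
    (hm : ∀ p ∈ Ioo (-δ) δ ×ˢ O, (F p).1 ∈ κ.chart.target)
    {D : Set (Euc (n + 1))} (hD : IsOpen D)
    (h0 : ∀ u ∈ frontier D ∩ O, (fderiv ℝ F (0, u) (1, 0)).1.1.2 = 0) :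
    HasDerivAt (fun ε => ∫ u in D, c u * κ.lagrangian e F (ε, u))
      (-(∫ u in D, c u * κ.eulerLagrange e (F (0, u)) (fun μ => fderiv ℝ F (0, u) (0, stdVec μ))
          (fderiv ℝ F (0, u) (1, 0))) -
        ∫ u in D, ∑ μ, flux (F (0, u)) (fderiv ℝ F (0, u) (1, 0)) μ * fderiv ℝ c u (stdVec μ))
      0 := by
  have hS : IsOpen (Ioo (-δ) δ ×ˢ O) := isOpen_Ioo.prod hO
  have h00 : (0 : ℝ) ∈ Ioo (-δ) δ := ⟨by linarith, hδ⟩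
  have hsl : ∀ {W : Type} [NormedAddCommGroup W] [NormedSpace ℝ W] {f : ℝ × Euc (n + 1) → W},
      ContDiffOn ℝ ∞ f (Ioo (-δ) δ ×ˢ O) → ContDiffOn ℝ ∞ (fun u => f (0, u)) O :=
    fun hf => hf.comp (contDiff_prodMk_right 0).contDiffOn fun u hu => ⟨h00, hu⟩
  have hF' : ContDiffOn ℝ ∞ (fderiv ℝ F) (Ioo (-δ) δ ×ˢ O) := hF.fderiv_of_isOpen hS (by simp)
  have hη : ∀ μ, ContDiffOn ℝ ∞
      (fun u => flux (F (0, u)) (fderiv ℝ F (0, u) (1, 0)) μ) O := fun μ => by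
    simp only [flux_eq]
    exact ContDiffOn.sum fun A _ => ((momL μ A).contDiff.comp_contDiffOn (hsl hF)).mul
      ((fieldL A).contDiff.comp_contDiffOn ((hsl hF').clm_apply contDiffOn_const))
  have hL := κ.contDiffOn_lagrangian e hS hF hm
  have h1 := hasDerivAt_setIntegral_cutoff_mul (μ := volume) hc.continuous hcc hO hcO hδ
    (hL.of_le (by simp)) D
  have hdL : ContinuousOn (fun u => fderiv ℝ (κ.lagrangian e F) (0, u) (1, 0)) O :=
    ((hsl (hL.fderiv_of_isOpen hS (m := ∞) (by simp))).clm_apply contDiffOn_const).continuousOn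
  have hdη : ∀ μ, ContinuousOn (fun u => fderiv ℝ (fun u => flux (F (0, u))
      (fderiv ℝ F (0, u) (1, 0)) μ) u (stdVec μ)) O := fun μ =>
    (((hη μ).fderiv_of_isOpen hO (m := ∞) (by simp)).clm_apply contDiffOn_const).continuousOn
  have hpt : ∀ u ∈ O, fderiv ℝ (κ.lagrangian e F) (0, u) (1, 0) =
      - κ.eulerLagrange e (F (0, u)) (fun μ => fderiv ℝ F (0, u) (0, stdVec μ))
        (fderiv ℝ F (0, u) (1, 0)) + ∑ μ, fderiv ℝ (fun u => flux (F (0, u))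
          (fderiv ℝ F (0, u) (1, 0)) μ) u (stdVec μ) := fun u hu =>
    κ.fderiv_lagrangian e (hF.contDiffAt (hS.mem_nhds ⟨h00, hu⟩)) (hm _ ⟨h00, hu⟩)
  have hint : ∀ f : Euc (n + 1) → ℝ, ContinuousOn f O → Integrable (fun u => c u * f u) := fun f hf =>
    integrable_cutoff_mul hc.continuous hcc hO hcO hf
  have hzero : ∀ u, u ∉ O → c u = 0 := fun u hu =>
    image_eq_zero_of_notMem_tsupport fun h => hu (hcO h)
  have h2 : ∫ u in D, c u * κ.eulerLagrange e (F (0, u)) (fun μ => fderiv ℝ F (0, u) (0, stdVec μ))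
        (fderiv ℝ F (0, u) (1, 0)) =
      (∑ μ, ∫ u in D, c u * fderiv ℝ (fun u => flux (F (0, u))
        (fderiv ℝ F (0, u) (1, 0)) μ) u (stdVec μ)) -
      ∫ u in D, c u * fderiv ℝ (κ.lagrangian e F) (0, u) (1, 0) := by
    rw [← integral_finsetSum _ fun μ _ => (hint _ (hdη μ)).integrableOn, ← integral_sub
      (integrable_finsetSum _ fun μ _ => (hint _ (hdη μ)).integrableOn) (hint _ hdL).integrableOn]
    refine integral_congr_ae (Eventually.of_forall fun u => ?_)
    by_cases hu : u ∈ O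
    · simp only [hpt u hu, ← Finset.mul_sum]
      ring
    · simp [hzero u hu]
  have h3 : ∫ u in D, ∑ μ, flux (F (0, u)) (fderiv ℝ F (0, u) (1, 0)) μ * fderiv ℝ c u (stdVec μ) =
      - ∑ μ, ∫ u in D, c u * fderiv ℝ (fun u => flux (F (0, u))
        (fderiv ℝ F (0, u) (1, 0)) μ) u (stdVec μ) := by
    rw [integral_finsetSum, ← Finset.sum_neg_distrib]
    · refine Finset.sum_congr rfl fun μ _ => ?_
      rw [setIntegral_mul_fderiv_eq hc hcc hO hcO ((hη μ).of_le (by simp)) hD (fun u hu => ?_)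
        (stdVec μ), neg_neg]
      simp [flux, h0 u hu]
    · intro μ _
      simp only [mul_comm (flux _ _ _)]
      exact (integrable_cutoff_mul ((hc.continuous_fderiv (by simp)).clm_apply continuous_const)
        (hcc.fderiv_apply ℝ (stdVec μ)) hO ((tsupport_fderiv_apply_subset ℝ _).trans hcO)
        (hη μ).continuousOn).integrableOn
  convert h1 using 1
  rw [h2, h3]
  ring

end AdaptedCoords

end CoordinateVariation

section ChartCutoff

variable {m : ℕ} {X : Type*} [TopologicalSpace X] [ChartedSpace (Euc m) X] [IsManifold (𝓡 m) ∞ X]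
  (o : ManifoldOrientation (m := m) X) (b : OpenPartialHomeomorph X (Euc m)) (ρ : X → ℝ)

/-- The coordinate expression of a cut-off function, with the sign of the chart with respect to the
orientation, extended by zero. -/
def chartCutoff : Euc m → ℝ :=
  b.target.indicator fun u => (SignType.sign (coordValue b o.form u) : ℝ) * ρ (b.symm u)

variable {o b ρ}

theorem chartCutoff_of_mem {u : Euc m} (hu : u ∈ b.target) :
    chartCutoff o b ρ u = (SignType.sign (coordValue b o.form u) : ℝ) * ρ (b.symm u) :=
  indicator_of_mem hu _

theorem orientedValue_smul {α : DiffForm (𝓡 m) X m} {u : Euc m} (hu : u ∈ b.target) :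
    orientedValue o b (fun x => ρ x • α x) u = chartCutoff o b ρ u * coordValue b α u := by
  rw [chartCutoff_of_mem hu, mul_assoc]
  rfl

theorem isCompact_image_tsupport (hρc : HasCompactSupport ρ) (hρb : tsupport ρ ⊆ b.source) :
    IsCompact (b '' tsupport ρ) :=
  hρc.isCompact.image_of_continuousOn (b.continuousOn.mono hρb)

theorem tsupport_chartCutoff_subset (hρc : HasCompactSupport ρ) (hρb : tsupport ρ ⊆ b.source) :
    tsupport (chartCutoff o b ρ) ⊆ b '' tsupport ρ := by
  refine closure_minimal (fun u hu => ?_) (isCompact_image_tsupport hρc hρb).isClosed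
  by_cases hb : u ∈ b.target
  · rw [Function.mem_support, chartCutoff_of_mem hb] at hu
    exact ⟨b.symm u, subset_tsupport _ (right_ne_zero_of_mul hu), b.right_inv hb⟩
  · exact absurd (indicator_of_notMem hb _) hu

theorem hasCompactSupport_chartCutoff (hρc : HasCompactSupport ρ) (hρb : tsupport ρ ⊆ b.source) :
    HasCompactSupport (chartCutoff o b ρ) :=
  (isCompact_image_tsupport hρc hρb).of_isClosed_subset (isClosed_tsupport _)
    (tsupport_chartCutoff_subset hρc hρb)

theorem tsupport_chartCutoff_subset_chartDomain (hρc : HasCompactSupport ρ)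
    (hρb : tsupport ρ ⊆ b.source) {W : Set X} (hW : tsupport ρ ⊆ W) :
    tsupport (chartCutoff o b ρ) ⊆ chartDomain b W := by
  intro u hu
  obtain ⟨x, hx, rfl⟩ := tsupport_chartCutoff_subset hρc hρb hu
  refine ⟨b.map_source (hρb hx), ?_⟩
  rw [mem_preimage, b.left_inv (hρb hx)]
  exact hW hx

theorem chartCutoff_eventuallyEq (hb : ContMDiffOn (𝓡 m) (𝓡 m) ∞ b b.source)
    (hb' : ContMDiffOn (𝓡 m) (𝓡 m) ∞ b.symm b.target)
    {u : Euc m} (hu : u ∈ b.target) :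
    chartCutoff o b ρ =ᶠ[𝓝 u]
      fun v => (SignType.sign (coordValue b o.form u) : ℝ) * ρ (b.symm v) := by
  filter_upwards [b.open_target.mem_nhds hu, eventually_sign_coordValue_eq o hb hb' hu] with v hv h
  rw [chartCutoff_of_mem hv, h]

theorem contDiff_chartCutoff (hb : ContMDiffOn (𝓡 m) (𝓡 m) ∞ b b.source)
    (hb' : ContMDiffOn (𝓡 m) (𝓡 m) ∞ b.symm b.target)
    (hρ : ContMDiff (𝓡 m) 𝓘(ℝ, ℝ) ∞ ρ) (hρc : HasCompactSupport ρ)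
    (hρb : tsupport ρ ⊆ b.source) : ContDiff ℝ ∞ (chartCutoff o b ρ) := by
  refine contDiff_of_forall_tsupport fun u hu => ?_
  have hu' : u ∈ b.target :=
    (tsupport_chartCutoff_subset_chartDomain hρc hρb (subset_univ _) hu).1
  have h1 : ContDiffAt ℝ ∞ (fun v => ρ (b.symm v)) u :=
    (hρ.contMDiffAt.comp u (hb'.contMDiffAt (b.open_target.mem_nhds hu'))).contDiffAt
  exact (contDiffAt_const.mul h1).congr_of_eventuallyEq (chartCutoff_eventuallyEq hb hb' hu')

theorem fderiv_chartCutoff (hb : ContMDiffOn (𝓡 m) (𝓡 m) ∞ b b.source)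
    (hb' : ContMDiffOn (𝓡 m) (𝓡 m) ∞ b.symm b.target)
    (hρ : ContMDiff (𝓡 m) 𝓘(ℝ, ℝ) ∞ ρ) {u : Euc m} (hu : u ∈ b.target)
    (v : Euc m) : fderiv ℝ (chartCutoff o b ρ) u v = (SignType.sign (coordValue b o.form u) : ℝ) *
      (show ℝ from mfderiv (𝓡 m) 𝓘(ℝ, ℝ) ρ (b.symm u) (mfderiv (𝓡 m) (𝓡 m) b.symm u v)) := by
  rw [(chartCutoff_eventuallyEq hb hb' hu).fderiv_eq]
  have h1 := ((hρ.mdifferentiable (by simp) (b.symm u)).hasMFDerivAt.comp u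
    ((hb'.contMDiffAt (b.open_target.mem_nhds hu)).mdifferentiableAt (by simp)).hasMFDerivAt)
  have h2 : HasFDerivAt (E := Euc m) (F := ℝ) (fun v => ρ (b.symm v)) _ u := h1.hasFDerivAt
  have h3 : fderiv ℝ (fun v => (SignType.sign (coordValue b o.form u) : ℝ) * ρ (b.symm v)) u = _ :=
    (h2.const_mul (SignType.sign (coordValue b o.form u) : ℝ)).fderiv
  rw [h3]
  rfl

theorem chartDomain_inter_frontier {U W : Set X} {u : Euc m}
    (hu : u ∈ frontier (chartDomain b U) ∩ chartDomain b W) : b.symm u ∈ frontier U ∩ W := by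
  refine ⟨?_, hu.2.2⟩
  have h1 : u ∈ frontier (b.symm ⁻¹' U ∩ b.target) ∩ b.target :=
    ⟨by rw [inter_comm]; exact hu.1, hu.2.1⟩
  rw [frontier_inter_open_inter b.open_target] at h1
  have h2 := b.symm.preimage_frontier U
  exact (h2.symm.subset ⟨h1.2, h1.1⟩).2

end ChartCutoff

section LocalFamilies

variable {n N K : ℕ} {X Y B FY FB : Type*}
  [TopologicalSpace X] [ChartedSpace (Euc (n + 1)) X] [IsManifold (𝓡 (n + 1)) ∞ X]
  [TopologicalSpace Y] [ChartedSpace (Euc (n + 1 + N)) Y] [IsManifold (𝓡 (n + 1 + N)) ∞ Y]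
  [TopologicalSpace B] [ChartedSpace (Euc (n + 1 + N + K)) B]
  [IsManifold (𝓡 (n + 1 + N + K)) ∞ B]
  [TopologicalSpace FY] [ChartedSpace (Euc N) FY] [IsManifold (𝓡 N) ∞ FY]
  [TopologicalSpace FB] [ChartedSpace (Euc K) FB]
  {πY : SmoothFiberBundle (n + 1 + N) (n + 1) N Y X FY}
  {πB : SmoothFiberBundle (n + 1 + N + K) (n + 1 + N) K B Y FB}


/-- The velocity at `ε = 0` of a family of sections. -/
def velocity (Ψ : ℝ → X → RPontryagin πY πB) (x : X) : TangentSpace (modelP n N K) (Ψ 0 x) :=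
  mfderiv 𝓘(ℝ, ℝ) (modelP n N K) (fun ε => Ψ ε x) 0 (1 : ℝ)

/-- The form `Θ_e(Tψ + λ ⊗ V) - Θ_e(Tψ)` for a form `λ` of degree one and a vector field `V` along
`ψ`; it is the product of `λ` with the flux of momentum through `V`. -/
def fluxForm (e : EnergySection πY πB) (ψ : X → RPontryagin πY πB)
    (V : (x : X) → TangentSpace (modelP n N K) (ψ x))
    (l : (x : X) → TangentSpace (𝓡 (n + 1)) x →L[ℝ] ℝ) : DiffForm (𝓡 (n + 1)) X (n + 1) :=
  fun x => (e.theta (ψ x)).compContinuousLinearMap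
      (mfderiv (𝓡 (n + 1)) (modelP n N K) ψ x + (l x).smulRight (V x)) -
    (e.theta (ψ x)).compContinuousLinearMap (mfderiv (𝓡 (n + 1)) (modelP n N K) ψ x)

namespace AdaptedCoords

variable (κ : AdaptedCoords πY πB) (e : EnergySection πY πB)

theorem coordValue_fluxForm {ψ : X → RPontryagin πY πB} {u : Euc (n + 1)}
    (hsec : ∀ᶠ x in 𝓝 (κ.chartY.base.symm u), projX (ψ x) = x)
    (hu : u ∈ κ.chartY.base.target)
    (hψ : ContMDiffAt (𝓡 (n + 1)) (modelP n N K) ∞ ψ (κ.chartY.base.symm u))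
    (hs : (ψ (κ.chartY.base.symm u)).proj ∈ κ.chart.source)
    (V : (x : X) → TangentSpace (modelP n N K) (ψ x))
    (hV : mfderiv (modelP n N K) (𝓡 (n + 1)) projX _ (V (κ.chartY.base.symm u)) = 0)
    (l : (x : X) → TangentSpace (𝓡 (n + 1)) x →L[ℝ] ℝ) :
    coordValue κ.chartY.base (fluxForm e ψ V l) u =
      ∑ μ, l (κ.chartY.base.symm u) (mfderiv (𝓡 (n + 1)) (𝓡 (n + 1)) κ.chartY.base.symm u
        (stdVec μ)) * flux (κ.secCoord ψ u) (κ.vecCoord _ (V (κ.chartY.base.symm u))) μ := by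
  set x := κ.chartY.base.symm u with hx
  set w : Fin (n + 1) → CoordP n N K := fun μ => fderiv ℝ (κ.secCoord ψ) u (stdVec μ) with hw
  set v : CoordP n N K := κ.vecCoord _ (V x) with hv
  let a : Fin (n + 1) → ℝ := fun μ => l x (mfderiv (𝓡 (n + 1)) (𝓡 (n + 1)) κ.chartY.base.symm u
    (stdVec μ))
  have hv0 : v.1.1.1 = 0 := κ.vecCoord_fst_eq_zero hs hV
  have hw0 : ∀ μ, (w μ).1.1.1 = stdVec μ := fun μ => κ.fderiv_secCoord_fst hsec hu hψ hs (stdVec μ)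
  have h1 : ψ x = κ.ofCoord (κ.secCoord ψ u) := (κ.ofCoord_toCoord hs).symm
  have h2 : coordValue κ.chartY.base (fluxForm e ψ V l) u =
      κ.thetaC e (κ.secCoord ψ u) (fun μ => w μ + a μ • v) - κ.thetaC e (κ.secCoord ψ u) w := by
    have h3 := κ.coordValue_theta e hu hψ hs
    refine congrArg₂ (fun s t : ℝ => s - t) ?_ h3
    unfold thetaC pullbackVec
    refine Eq.trans ?_ (diffForm_congr e.theta h1 _)
    refine congrArg (e.theta (ψ x) :
      (Euc (n + 1 + N + K) × Mom (n + 1) N) [⋀^Fin (n + 1)]→L[ℝ] ℝ) (funext fun μ => ?_)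
    have h4 := κ.mfderiv_section hu hψ hs (stdVec μ)
    have h5 := κ.vecOfCoord_vecCoord hs (V x)
    refine (congrArg₂ (fun s t : Euc (n + 1 + N + K) × Mom (n + 1) N => s + a μ • t) h4
      h5.symm).trans ?_
    unfold vecOfCoord
    exact ((map_add _ _ _).trans (congrArg _ (map_smul _ _ _))).symm
  have hq : (κ.secCoord ψ u).1 ∈ κ.chart.target := κ.toCoord_fst_mem hs
  rw [h2, κ.thetaC_frame e hq w hw0, κ.thetaC_frame e hq (fun μ => w μ + a μ • v) fun μ => by
      rw [← hw0 μ]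
      change (w μ).1.1.1 + a μ • v.1.1.1 = _
      rw [hv0, smul_zero, add_zero]]
  rw [add_sub_add_left_eq_sub, ← Finset.sum_sub_distrib]
  refine Finset.sum_congr rfl fun μ _ => ?_
  rw [flux, Finset.mul_sum, ← Finset.sum_sub_distrib]
  refine Finset.sum_congr rfl fun A _ => ?_
  change (κ.secCoord ψ u).2 μ A * ((w μ).1.1.2 A + a μ * v.1.1.2 A) -
    (κ.secCoord ψ u).2 μ A * (w μ).1.1.2 A = a μ * ((κ.secCoord ψ u).2 μ A * v.1.1.2 A)
  ring

/-- A description of the family `Ψ` of sections over `U`, near the points of `W`, by a smooth family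
with values in the domain of the coordinates `κ`. -/
structure IsLocalFamily (U : Set X) (Ψ : ℝ → X → RPontryagin πY πB) (W : Set X) (δ : ℝ)
    (g : ℝ × X → RPontryagin πY πB) : Prop where
  pos : 0 < δ
  isOpen : IsOpen W
  smooth : ContMDiffOn (𝓘(ℝ, ℝ).prod (𝓡 (n + 1))) (modelP n N K) ∞ g (Ioo (-δ) δ ×ˢ W)
  isSection : ∀ p ∈ Ioo (-δ) δ ×ˢ W, projX (g p) = p.2
  source : ∀ p ∈ Ioo (-δ) δ ×ˢ W, (g p).proj ∈ κ.chart.source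
  eq : ∀ ε ∈ Ioo (-δ) δ, ∀ x ∈ closure U ∩ W, Ψ ε x = g (ε, x)
  boundary : ∀ ε ∈ Ioo (-δ) δ, ∀ x ∈ frontier U ∩ W, projY (g (ε, x)) = projY (g (0, x))

/-- The coordinate expression of a family of sections. -/
def famCoord (g : ℝ × X → RPontryagin πY πB) (p : ℝ × Euc (n + 1)) : CoordP n N K :=
  κ.toCoord (g (p.1, κ.chartY.base.symm p.2))

namespace IsLocalFamily

variable {κ} {U : Set X} {Ψ : ℝ → X → RPontryagin πY πB} {W : Set X} {δ : ℝ}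
    {g : ℝ × X → RPontryagin πY πB} (h : κ.IsLocalFamily U Ψ W δ g)

include h

theorem zero_mem : (0 : ℝ) ∈ Ioo (-δ) δ := ⟨by linarith [h.pos], h.pos⟩

theorem isOpen_prod : IsOpen (Ioo (-δ) δ ×ˢ W) := isOpen_Ioo.prod h.isOpen

theorem isOpen_chartDomain : IsOpen (chartDomain κ.chartY.base W) :=
  CovPontryagin.isOpen_chartDomain _ h.isOpen

theorem subset_source : W ⊆ κ.chartY.base.source := fun x hx => by
  have h1 := κ.projX_mem (h.source (0, x) ⟨h.zero_mem, hx⟩)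
  rwa [h.isSection (0, x) ⟨h.zero_mem, hx⟩] at h1

theorem contDiffOn_famCoord :
    ContDiffOn ℝ ∞ (κ.famCoord g) (Ioo (-δ) δ ×ˢ chartDomain κ.chartY.base W) := by
  rw [← contMDiffOn_iff_contDiffOn]
  have h1 : ContMDiffOn 𝓘(ℝ, ℝ × Euc (n + 1)) (𝓘(ℝ, ℝ).prod (𝓡 (n + 1))) ∞
      (fun p : ℝ × Euc (n + 1) => (p.1, κ.chartY.base.symm p.2))
      (Ioo (-δ) δ ×ˢ chartDomain κ.chartY.base W) :=
    contDiff_fst.contMDiff.contMDiffOn.prodMk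
      (κ.chartY.base_symm_smooth.comp contDiff_snd.contMDiff.contMDiffOn fun p hp => hp.2.1)
  exact κ.contMDiffOn_toCoord.comp (h.smooth.comp h1 fun p hp => ⟨hp.1, hp.2.2⟩)
    fun p hp => h.source _ ⟨hp.1, hp.2.2⟩

theorem famCoord_mem : ∀ p ∈ Ioo (-δ) δ ×ˢ chartDomain κ.chartY.base W,
    (κ.famCoord g p).1 ∈ κ.chart.target := fun _ hp =>
  κ.toCoord_fst_mem (h.source _ ⟨hp.1, hp.2.2⟩)

theorem hasFDerivAt_famCoord {ε : ℝ} (hε : ε ∈ Ioo (-δ) δ) {u : Euc (n + 1)}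
    (hu : u ∈ chartDomain κ.chartY.base W) :
    HasFDerivAt (κ.famCoord g) (fderiv ℝ (κ.famCoord g) (ε, u)) (ε, u) :=
  ((h.contDiffOn_famCoord.contDiffAt ((isOpen_Ioo.prod h.isOpen_chartDomain).mem_nhds
    ⟨hε, hu⟩)).differentiableAt (by simp)).hasFDerivAt

theorem fderiv_famCoord_boundary {u : Euc (n + 1)}
    (hu : u ∈ frontier (chartDomain κ.chartY.base U) ∩ chartDomain κ.chartY.base W) :
    (fderiv ℝ (κ.famCoord g) (0, u) (1, 0)).1.1.2 = 0 := by
  have hx := chartDomain_inter_frontier hu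
  let L : CoordP n N K →L[ℝ] Euc N := (ContinuousLinearMap.snd ℝ (Euc (n + 1)) (Euc N)).comp
    ((ContinuousLinearMap.fst ℝ (Euc (n + 1) × Euc N) (Euc K)).comp
      (ContinuousLinearMap.fst ℝ ((Euc (n + 1) × Euc N) × Euc K) (Mom (n + 1) N)))
  have h1 : HasDerivAt (fun t : ℝ => (t, u)) ((1 : ℝ), (0 : Euc (n + 1))) 0 :=
    (hasDerivAt_id 0).prodMk (hasDerivAt_const 0 u)
  have h2 := L.hasFDerivAt.comp_hasDerivAt (0 : ℝ)
    ((h.hasFDerivAt_famCoord h.zero_mem hu.2).comp_hasDerivAt (0 : ℝ) h1)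
  have h3 : (L ∘ κ.famCoord g ∘ fun t : ℝ => (t, u)) =ᶠ[𝓝 0]
      fun _ => L (κ.famCoord g (0, u)) := by
    filter_upwards [Ioo_mem_nhds h.zero_mem.1 h.zero_mem.2] with t ht
    have h4 : ∀ s ∈ Ioo (-δ) δ, (κ.famCoord g (s, u)).1.1 =
        κ.chartY.chart (projY (g (s, κ.chartY.base.symm u))) := fun s hs =>
      (κ.chartY_projY (h.source _ ⟨hs, hx.2⟩)).symm
    change (κ.famCoord g (t, u)).1.1.2 = (κ.famCoord g (0, u)).1.1.2
    rw [h4 t ht, h4 0 h.zero_mem, h.boundary t ht _ hx]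
  exact (h2.congr_of_eventuallyEq h3.symm).unique (hasDerivAt_const 0 _)

section Interior

variable (hU : IsOpen U) {u : Euc (n + 1)} (hu : u ∈ chartDomain κ.chartY.base (U ∩ W))

include hU in
theorem eventuallyEq {ε : ℝ} (hε : ε ∈ Ioo (-δ) δ) {x : X} (hx : x ∈ U ∩ W) :
    Ψ ε =ᶠ[𝓝 x] fun y => g (ε, y) := by
  filter_upwards [hU.mem_nhds hx.1, h.isOpen.mem_nhds hx.2] with y hy hy'
  exact h.eq ε hε y ⟨subset_closure hy, hy'⟩

include hU in
theorem contMDiffAt {ε : ℝ} (hε : ε ∈ Ioo (-δ) δ) {x : X} (hx : x ∈ U ∩ W) :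
    ContMDiffAt (𝓡 (n + 1)) (modelP n N K) ∞ (Ψ ε) x :=
  ((h.smooth.contMDiffAt (h.isOpen_prod.mem_nhds ⟨hε, hx.2⟩)).comp x
    (contMDiffAt_const.prodMk contMDiffAt_id)).congr_of_eventuallyEq (h.eventuallyEq hU hε hx)

include hU in
theorem eventually_isSection {ε : ℝ} (hε : ε ∈ Ioo (-δ) δ) {x : X} (hx : x ∈ U ∩ W) :
    ∀ᶠ y in 𝓝 x, projX (Ψ ε y) = y := by
  filter_upwards [h.eventuallyEq hU hε hx, h.isOpen.mem_nhds hx.2] with y hy hy'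
  rw [hy, h.isSection _ ⟨hε, hy'⟩]

theorem proj_mem {ε : ℝ} (hε : ε ∈ Ioo (-δ) δ) {x : X} (hx : x ∈ U ∩ W) :
    (Ψ ε x).proj ∈ κ.chart.source := by
  rw [h.eq ε hε x ⟨subset_closure hx.1, hx.2⟩]
  exact h.source _ ⟨hε, hx.2⟩

include hU hu in
theorem secCoord_eventuallyEq {ε : ℝ} (hε : ε ∈ Ioo (-δ) δ) :
    κ.secCoord (Ψ ε) =ᶠ[𝓝 u] fun v => κ.famCoord g (ε, v) := by
  filter_upwards [(CovPontryagin.isOpen_chartDomain κ.chartY.base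
    (hU.inter h.isOpen)).mem_nhds hu] with v hv
  rw [secCoord, famCoord, h.eq ε hε _ ⟨subset_closure hv.2.1, hv.2.2⟩]

include hU hu in
theorem fderiv_secCoord {ε : ℝ} (hε : ε ∈ Ioo (-δ) δ) (v : Euc (n + 1)) :
    fderiv ℝ (κ.secCoord (Ψ ε)) u v = fderiv ℝ (κ.famCoord g) (ε, u) (0, v) := by
  rw [(h.secCoord_eventuallyEq hU hu hε).fderiv_eq]
  have h1 := (h.hasFDerivAt_famCoord hε ⟨hu.1, hu.2.2⟩).comp u (hasFDerivAt_prodMk_right ε u)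
  have h2 : fderiv ℝ (fun v => κ.famCoord g (ε, v)) u = _ := h1.fderiv
  rw [h2]
  rfl

include hU hu in
theorem coordValue_theta {ε : ℝ} (hε : ε ∈ Ioo (-δ) δ) :
    coordValue κ.chartY.base (formPullback (I := 𝓡 (n + 1)) (Ψ ε) e.theta) u =
      κ.lagrangian e (κ.famCoord g) (ε, u) := by
  rw [κ.coordValue_theta_eq e (h.eventually_isSection hU hε hu.2) hu.1
    (h.contMDiffAt hU hε hu.2) (h.proj_mem hε hu.2), lagrangian,
    (h.secCoord_eventuallyEq hU hu hε).self_of_nhds]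
  simp only [h.fderiv_secCoord hU hu hε]

theorem hasMFDerivAt_velocity {x : X} (hx : x ∈ U ∩ W) :
    HasMFDerivAt 𝓘(ℝ, ℝ) (modelP n N K) (fun ε => Ψ ε x) 0
      (mfderiv 𝓘(ℝ, ℝ) (modelP n N K) (fun ε => Ψ ε x) 0) := by
  have h1 : ContMDiffAt 𝓘(ℝ, ℝ) (modelP n N K) ∞ (fun ε => g (ε, x)) 0 :=
    (h.smooth.contMDiffAt (h.isOpen_prod.mem_nhds ⟨h.zero_mem, hx.2⟩)).comp (0 : ℝ)
      (contMDiffAt_id.prodMk contMDiffAt_const)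
  have h2 : (fun ε => Ψ ε x) =ᶠ[𝓝 0] fun ε => g (ε, x) := by
    filter_upwards [Ioo_mem_nhds h.zero_mem.1 h.zero_mem.2] with t ht
    exact h.eq t ht x ⟨subset_closure hx.1, hx.2⟩
  exact ((h1.congr_of_eventuallyEq h2).mdifferentiableAt (by simp)).hasMFDerivAt

theorem projX_velocity {x : X} (hx : x ∈ U ∩ W) :
    mfderiv (modelP n N K) (𝓡 (n + 1)) projX (Ψ 0 x) (velocity Ψ x) = 0 := by
  have h1 := ((contMDiff_projX (πY := πY) (πB := πB)).mdifferentiable (by simp)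
    (Ψ 0 x)).hasMFDerivAt.comp (0 : ℝ) (h.hasMFDerivAt_velocity hx)
  have h2 : (projX ∘ fun ε => Ψ ε x) =ᶠ[𝓝 0] fun _ => x := by
    filter_upwards [Ioo_mem_nhds h.zero_mem.1 h.zero_mem.2] with t ht
    rw [Function.comp_apply, h.eq t ht x ⟨subset_closure hx.1, hx.2⟩, h.isSection _ ⟨ht, hx.2⟩]
  have h3 := hasMFDerivAt_unique (h1.congr_of_eventuallyEq h2.symm) (hasMFDerivAt_const x (0 : ℝ))
  exact congrArg (fun L : ℝ →L[ℝ] Euc (n + 1) => L 1) h3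

include hu in
theorem vecCoord_velocity :
    κ.vecCoord (Ψ 0 (κ.chartY.base.symm u)) (velocity Ψ (κ.chartY.base.symm u)) =
      fderiv ℝ (κ.famCoord g) (0, u) (1, 0) := by
  have h1 := ((κ.contMDiffAt_toCoord (h.proj_mem h.zero_mem hu.2)).mdifferentiableAt
    (by simp)).hasMFDerivAt.comp (0 : ℝ) (h.hasMFDerivAt_velocity hu.2)
  have h2 : (κ.toCoord ∘ fun ε => Ψ ε (κ.chartY.base.symm u)) =ᶠ[𝓝 0]
      κ.famCoord g ∘ fun t : ℝ => (t, u) := by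
    filter_upwards [Ioo_mem_nhds h.zero_mem.1 h.zero_mem.2] with t ht
    rw [Function.comp_apply, h.eq t ht _ ⟨subset_closure hu.2.1, hu.2.2⟩]
    rfl
  have h3 : HasDerivAt (fun t : ℝ => (t, u)) ((1 : ℝ), (0 : Euc (n + 1))) 0 :=
    (hasDerivAt_id 0).prodMk (hasDerivAt_const 0 u)
  have h4 := ((h.hasFDerivAt_famCoord h.zero_mem ⟨hu.1, hu.2.2⟩).comp (0 : ℝ)
    h3.hasFDerivAt).hasMFDerivAt
  have h5 := hasMFDerivAt_unique (h1.congr_of_eventuallyEq h2.symm) h4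
  refine (congrArg (fun L : ℝ →L[ℝ] CoordP n N K => L 1) h5).trans ?_
  simp

include hU hu in
theorem coordValue_omegaAlong :
    coordValue κ.chartY.base (omegaAlong e (Ψ 0) (velocity Ψ)) u =
      κ.eulerLagrange e (κ.famCoord g (0, u))
        (fun μ => fderiv ℝ (κ.famCoord g) (0, u) (0, stdVec μ))
        (fderiv ℝ (κ.famCoord g) (0, u) (1, 0)) := by
  rw [κ.coordValue_omegaAlong e (h.eventually_isSection hU h.zero_mem hu.2) hu.1
    (h.contMDiffAt hU h.zero_mem hu.2) (h.proj_mem h.zero_mem hu.2) _ (h.projX_velocity hu.2),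
    (h.secCoord_eventuallyEq hU hu h.zero_mem).self_of_nhds, h.vecCoord_velocity hu]
  simp only [h.fderiv_secCoord hU hu h.zero_mem]

include hU hu in
theorem coordValue_fluxForm (l : (x : X) → TangentSpace (𝓡 (n + 1)) x →L[ℝ] ℝ) :
    coordValue κ.chartY.base (fluxForm e (Ψ 0) (velocity Ψ) l) u =
      ∑ μ, l (κ.chartY.base.symm u) (mfderiv (𝓡 (n + 1)) (𝓡 (n + 1)) κ.chartY.base.symm u
        (stdVec μ)) * flux (κ.famCoord g (0, u)) (fderiv ℝ (κ.famCoord g) (0, u) (1, 0)) μ := by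
  rw [κ.coordValue_fluxForm e (h.eventually_isSection hU h.zero_mem hu.2) hu.1
    (h.contMDiffAt hU h.zero_mem hu.2) (h.proj_mem h.zero_mem hu.2) _ (h.projX_velocity hu.2),
    (h.secCoord_eventuallyEq hU hu h.zero_mem).self_of_nhds, h.vecCoord_velocity hu]

end Interior

end IsLocalFamily

end AdaptedCoords

end LocalFamilies

section CutoffVariation

variable {n N K : ℕ} {X Y B FY FB : Type*}
  [TopologicalSpace X] [ChartedSpace (Euc (n + 1)) X] [IsManifold (𝓡 (n + 1)) ∞ X]
  [TopologicalSpace Y] [ChartedSpace (Euc (n + 1 + N)) Y] [IsManifold (𝓡 (n + 1 + N)) ∞ Y]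
  [TopologicalSpace B] [ChartedSpace (Euc (n + 1 + N + K)) B]
  [IsManifold (𝓡 (n + 1 + N + K)) ∞ B]
  [TopologicalSpace FY] [ChartedSpace (Euc N) FY] [IsManifold (𝓡 N) ∞ FY]
  [TopologicalSpace FB] [ChartedSpace (Euc K) FB]
  {πY : SmoothFiberBundle (n + 1 + N) (n + 1) N Y X FY}
  {πB : SmoothFiberBundle (n + 1 + N + K) (n + 1 + N) K B Y FB}

  [T2Space X] [SigmaCompactSpace X]

theorem formIntegral_of_eqOn {m : ℕ} {M : Type*} [TopologicalSpace M] [ChartedSpace (Euc m) M]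
    [IsManifold (𝓡 m) ∞ M] [T2Space M] [SigmaCompactSpace M] (o : ManifoldOrientation (m := m) M)
    {U : Set M} (hU : IsOpen U) (hUc : IsCompact (closure U))
    {b : OpenPartialHomeomorph M (Euc m)} (hb : b.MDifferentiable (𝓡 m) (𝓡 m))
    {α : DiffForm (𝓡 m) M m} (hα : ∀ x ∈ U, x ∉ b.source → α x = 0) {G : Euc m → ℝ}
    (hG : Integrable G) (h : ∀ u ∈ chartDomain b U, orientedValue o b α u = G u) :
    FormIntegrable o U α ∧ formIntegral o U α = ∫ u in chartDomain b U, G u := by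
  have h1 : IntegrableOn (orientedValue o b α) (chartDomain b U) :=
    (integrableOn_congr_fun h (measurableSet_chartDomain b hU)).2 hG.integrableOn
  refine ⟨formIntegrable_of_support o hU hb hα h1, ?_⟩
  rw [formIntegral_of_support o hU hUc hb hα h1]
  exact setIntegral_congr_fun (measurableSet_chartDomain b hU) h

theorem fluxForm_eq_zero (e : EnergySection πY πB) {ψ : X → RPontryagin πY πB}
    {V : (x : X) → TangentSpace (modelP n N K) (ψ x)}
    {l : (x : X) → TangentSpace (𝓡 (n + 1)) x →L[ℝ] ℝ} {x : X} (hl : l x = 0) :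
    fluxForm e ψ V l x = 0 := by
  have h1 : (l x).smulRight (V x) = 0 := by
    rw [hl]
    ext
    simp
  rw [fluxForm, h1, add_zero, sub_self]

/-- The differential of a function. -/
def differential (ρ : X → ℝ) (x : X) : TangentSpace (𝓡 (n + 1)) x →L[ℝ] ℝ :=
  mfderiv (𝓡 (n + 1)) 𝓘(ℝ, ℝ) ρ x

theorem differential_eq_zero {ρ : X → ℝ} {x : X} (hx : x ∉ tsupport ρ) :
    differential (n := n) ρ x = 0 := by
  have h1 : ρ =ᶠ[𝓝 x] fun _ => 0 := notMem_tsupport_iff_eventuallyEq.1 hx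
  exact h1.mfderiv_eq.trans mfderiv_const

theorem coordValue_sum {m : ℕ} {M : Type*} [TopologicalSpace M] [ChartedSpace (Euc m) M]
    {ι : Type*} (s : Finset ι) (χ : OpenPartialHomeomorph M (Euc m))
    (α : ι → DiffForm (𝓡 m) M m) (u : Euc m) :
    coordValue χ (fun x => ∑ j ∈ s, α j x) u = ∑ j ∈ s, coordValue χ (α j) u :=
  ContinuousAlternatingMap.sum_apply _ _

theorem AdaptedCoords.continuousOn_eulerLagrange (κ : AdaptedCoords πY πB)
    (e : EnergySection πY πB) {Z : Type*} [TopologicalSpace Z] {O : Set Z}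
    {q V : Z → CoordP n N K} {w : Z → Fin (n + 1) → CoordP n N K} (hq : ContinuousOn q O)
    (hm : ∀ z ∈ O, (q z).1 ∈ κ.chart.target) (hw : ∀ μ, ContinuousOn (fun z => w z μ) O)
    (hV : ContinuousOn V O) : ContinuousOn (fun z => κ.eulerLagrange e (q z) (w z) (V z)) O := by
  unfold AdaptedCoords.eulerLagrange
  have h1 : ContinuousOn (fun z => fderiv ℝ (κ.eC e) (q z)) O :=
    ((κ.contDiffOn_eC e).continuousOn_fderiv_of_isOpen κ.isOpen_target (by simp)).comp hq hm
  refine ((h1.clm_apply hV).sub ?_).add ?_ <;>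
    refine continuousOn_finsetSum _ fun μ _ => continuousOn_finsetSum _ fun A _ => ?_
  · exact ((momL μ A).continuous.comp_continuousOn hV).mul
      ((fieldL A).continuous.comp_continuousOn (hw μ))
  · exact ((momL μ A).continuous.comp_continuousOn (hw μ)).mul
      ((fieldL A).continuous.comp_continuousOn hV)

namespace AdaptedCoords.IsLocalFamily

variable {κ : AdaptedCoords πY πB} (e : EnergySection πY πB) {U : Set X}
  {Ψ : ℝ → X → RPontryagin πY πB} {W : Set X} {δ : ℝ} {g : ℝ × X → RPontryagin πY πB}

theorem sum_fluxForm_eq_zero (h : κ.IsLocalFamily U Ψ W δ g) (hU : IsOpen U) {ι : Type*}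
    (s : Finset ι) (l : ι → (x : X) → TangentSpace (𝓡 (n + 1)) x →L[ℝ] ℝ) {x : X}
    (hx : x ∈ U ∩ W) (hl : ∑ j ∈ s, l j x = 0) :
    ∑ j ∈ s, fluxForm e (Ψ 0) (velocity Ψ) (l j) x = 0 := by
  have hxs := h.subset_source hx.2
  have hxx : κ.chartY.base.symm (κ.chartY.base x) = x := κ.chartY.base.left_inv hxs
  have hu : κ.chartY.base x ∈ chartDomain κ.chartY.base (U ∩ W) :=
    ⟨κ.chartY.base.map_source hxs, by rwa [mem_preimage, hxx]⟩
  have h1 : coordValue κ.chartY.base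
      (fun x => ∑ j ∈ s, fluxForm e (Ψ 0) (velocity Ψ) (l j) x) (κ.chartY.base x) = 0 := by
    rw [coordValue_sum]
    simp only [h.coordValue_fluxForm e hU hu]
    rw [Finset.sum_comm]
    refine Finset.sum_eq_zero fun μ _ => ?_
    rw [← Finset.sum_mul]
    have h2 : ∀ v, ∑ j ∈ s, l j (κ.chartY.base.symm (κ.chartY.base x)) v = 0 := by
      rw [hxx]
      intro v
      rw [← sum_apply, hl]
      rfl
    rw [h2, zero_mul]
  have h3 := eq_zero_of_coordValue_eq_zero κ.chartY.base_mdiff hu.1 h1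
  rwa [hxx] at h3

variable (o : ManifoldOrientation (m := n + 1) X)

/-- The first variation of the action, with a cut-off supported in a coordinate domain. -/
theorem hasDerivAt_formIntegral (h : κ.IsLocalFamily U Ψ W δ g) (hU : IsOpen U)
    (hUc : IsCompact (closure U)) {ρ : X → ℝ} (hρ : ContMDiff (𝓡 (n + 1)) 𝓘(ℝ, ℝ) ∞ ρ)
    (hρc : HasCompactSupport ρ) (hρW : tsupport ρ ⊆ W) :
    (∀ᶠ ε in 𝓝 0, FormIntegrable o U (fun x => ρ x • formPullback (I := 𝓡 (n + 1)) (Ψ ε) e.theta x)) ∧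
    FormIntegrable o U (fun x => ρ x • omegaAlong e (Ψ 0) (velocity Ψ) x) ∧
    FormIntegrable o U (fluxForm e (Ψ 0) (velocity Ψ) (differential ρ)) ∧
    HasDerivAt (fun ε => formIntegral o U
        (fun x => ρ x • formPullback (I := 𝓡 (n + 1)) (Ψ ε) e.theta x))
      (- formIntegral o U (fun x => ρ x • omegaAlong e (Ψ 0) (velocity Ψ) x) -
        formIntegral o U (fluxForm e (Ψ 0) (velocity Ψ) (differential ρ))) 0 := by
  set b := κ.chartY.base
  set c := chartCutoff o b ρ
  set F := κ.famCoord g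
  set O := chartDomain b W
  have hb : b.MDifferentiable (𝓡 (n + 1)) (𝓡 (n + 1)) := κ.chartY.base_mdiff
  have hρb : tsupport ρ ⊆ b.source := hρW.trans h.subset_source
  have hc : ContDiff ℝ ∞ c :=
    contDiff_chartCutoff κ.chartY.base_smooth κ.chartY.base_symm_smooth hρ hρc hρb
  have hcc : HasCompactSupport c := hasCompactSupport_chartCutoff hρc hρb
  have hcO : tsupport c ⊆ O := tsupport_chartCutoff_subset_chartDomain hρc hρb hρW
  have hO : IsOpen O := h.isOpen_chartDomain
  have hS : IsOpen (Ioo (-δ) δ ×ˢ O) := isOpen_Ioo.prod hO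
  have hsl : ∀ {Z : Type} [NormedAddCommGroup Z] [NormedSpace ℝ Z] {f : ℝ × Euc (n + 1) → Z}
      {ε : ℝ}, ε ∈ Ioo (-δ) δ → ContDiffOn ℝ ∞ f (Ioo (-δ) δ ×ˢ O) →
      ContinuousOn (fun u => f (ε, u)) O := fun hε hf =>
    hf.continuousOn.comp (Continuous.prodMk_right _).continuousOn fun u hu => ⟨hε, hu⟩
  have hF := h.contDiffOn_famCoord
  have hF' : ContDiffOn ℝ ∞ (fderiv ℝ F) (Ioo (-δ) δ ×ˢ O) := hF.fderiv_of_isOpen hS (by simp)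
  have hL := κ.contDiffOn_lagrangian e hS hF h.famCoord_mem
  have hη : ∀ μ, ContDiffOn ℝ ∞ (fun p => flux (F p) (fderiv ℝ F p (1, 0)) μ)
      (Ioo (-δ) δ ×ˢ O) := fun μ => by
    simp only [flux_eq]
    exact ContDiffOn.sum fun A _ => ((momL μ A).contDiff.comp_contDiffOn hF).mul
      ((fieldL A).contDiff.comp_contDiffOn (hF'.clm_apply contDiffOn_const))
  have hEL : ContinuousOn (fun u => κ.eulerLagrange e (F (0, u))
      (fun μ => fderiv ℝ F (0, u) (0, stdVec μ)) (fderiv ℝ F (0, u) (1, 0))) O := by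
    have h2 : ∀ a, ContinuousOn (fun u => fderiv ℝ F (0, u) a) O := fun a =>
      hsl h.zero_mem (hF'.clm_apply contDiffOn_const)
    exact κ.continuousOn_eulerLagrange e (hsl h.zero_mem hF)
      (fun u hu => h.famCoord_mem _ ⟨h.zero_mem, hu⟩) (fun μ => h2 _) (h2 _)
  have hint : ∀ f : Euc (n + 1) → ℝ, ContinuousOn f O → Integrable (fun u => c u * f u) := fun f hf =>
    integrable_cutoff_mul hc.continuous hcc hO hcO hf
  have hsupp : ∀ (α : DiffForm (𝓡 (n + 1)) X (n + 1)) (x : X), x ∉ b.source → ρ x • α x = 0 :=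
    fun α x hx => by rw [image_eq_zero_of_notMem_tsupport fun h' => hx (hρb h'), zero_smul]
  have key : ∀ (α : DiffForm (𝓡 (n + 1)) X (n + 1)) (f : Euc (n + 1) → ℝ),
      (∀ u ∈ chartDomain b (U ∩ W), coordValue b α u = f u) → ∀ u ∈ chartDomain b U,
        orientedValue o b (fun x => ρ x • α x) u = c u * f u := by
    intro α f hf u hu
    rw [orientedValue_smul hu.1]
    by_cases hW : b.symm u ∈ W
    · rw [hf u ⟨hu.1, hu.2, hW⟩]
    · have h0 : c u = 0 := image_eq_zero_of_notMem_tsupport fun h' => hW (hcO h').2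
      change c u * _ = _
      rw [h0, zero_mul, zero_mul]
  have h1 : ∀ ε ∈ Ioo (-δ) δ, _ := fun ε hε => formIntegral_of_eqOn o hU hUc hb
    (fun x _ hx => hsupp (formPullback (Ψ ε) e.theta) x hx) (hint _ (hsl hε hL))
    (key _ _ fun u hu => h.coordValue_theta e hU hu hε)
  have h2 := formIntegral_of_eqOn o hU hUc hb
    (fun x _ hx => hsupp (omegaAlong e (Ψ 0) (velocity Ψ)) x hx) (hint _ hEL)
    (key _ _ fun u hu => h.coordValue_omegaAlong e hU hu)
  have h3 := formIntegral_of_eqOn o hU hUc hb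
    (α := fluxForm e (Ψ 0) (velocity Ψ) (differential ρ))
    (G := fun u => ∑ μ, flux (F (0, u)) (fderiv ℝ F (0, u) (1, 0)) μ * fderiv ℝ c u (stdVec μ))
    (fun x _ hx => fluxForm_eq_zero e (differential_eq_zero fun h' => hx (hρb h')))
    (integrable_finsetSum _ fun μ _ => by
      simp only [mul_comm (flux _ _ _)]
      exact integrable_cutoff_mul ((hc.continuous_fderiv (by simp)).clm_apply continuous_const)
        (hcc.fderiv_apply ℝ (stdVec μ)) hO ((tsupport_fderiv_apply_subset ℝ _).trans hcO)
        (hsl h.zero_mem (hη μ)))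
    (fun u hu => by
      by_cases hW : b.symm u ∈ W
      · rw [orientedValue, h.coordValue_fluxForm e hU ⟨hu.1, hu.2, hW⟩, Finset.mul_sum]
        refine Finset.sum_congr rfl fun μ _ => ?_
        rw [fderiv_chartCutoff κ.chartY.base_smooth κ.chartY.base_symm_smooth hρ hu.1, ← mul_assoc,
          mul_comm]
        rfl
      · have h4 : b.symm u ∉ tsupport ρ := fun h' => hW (hρW h')
        rw [orientedValue_eq_zero o b (fluxForm_eq_zero e (differential_eq_zero h4))]
        refine (Finset.sum_eq_zero fun μ _ => ?_).symm
        rw [fderiv_of_notMem_tsupport ℝ fun h' => hW (hcO h').2]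
        simp)
  have h5 := κ.hasDerivAt_setIntegral_lagrangian e (hc.of_le (by simp)) hcc hO hcO h.pos hF
    h.famCoord_mem (CovPontryagin.isOpen_chartDomain b hU) fun u hu => h.fderiv_famCoord_boundary hu
  have hnhds : ∀ᶠ ε in 𝓝 (0 : ℝ), ε ∈ Ioo (-δ) δ := Ioo_mem_nhds h.zero_mem.1 h.zero_mem.2
  refine ⟨hnhds.mono fun ε hε => (h1 ε hε).1, h2.1, h3.1, ?_⟩
  rw [h2.2, h3.2]
  exact h5.congr_of_eventuallyEq (hnhds.mono fun ε hε => (h1 ε hε).2)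

end AdaptedCoords.IsLocalFamily

end CutoffVariation

section FirstVariation

variable {n N K : ℕ} {X Y B FY FB : Type*}
  [TopologicalSpace X] [ChartedSpace (Euc (n + 1)) X] [IsManifold (𝓡 (n + 1)) ∞ X]
  [TopologicalSpace Y] [ChartedSpace (Euc (n + 1 + N)) Y] [IsManifold (𝓡 (n + 1 + N)) ∞ Y]
  [TopologicalSpace B] [ChartedSpace (Euc (n + 1 + N + K)) B]
  [IsManifold (𝓡 (n + 1 + N + K)) ∞ B]
  [TopologicalSpace FY] [ChartedSpace (Euc N) FY] [IsManifold (𝓡 N) ∞ FY]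
  [TopologicalSpace FB] [ChartedSpace (Euc K) FB]
  {πY : SmoothFiberBundle (n + 1 + N) (n + 1) N Y X FY}
  {πB : SmoothFiberBundle (n + 1 + N + K) (n + 1 + N) K B Y FB}

  [T2Space X] [SigmaCompactSpace X]

theorem IsVariation.exists_isLocalFamily [IsManifold (𝓡 K) ∞ FB] {U : Set X}
    {ψ : X → RPontryagin πY πB} {ε₀ : ℝ} {Ψ : ℝ → X → RPontryagin πY πB}
    (hΨ : IsVariation U ψ ε₀ Ψ) {x : X} (hx : x ∈ closure U) :
    ∃ (κ : AdaptedCoords πY πB) (W : Set X) (δ : ℝ) (g : ℝ × X → RPontryagin πY πB),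
      κ.IsLocalFamily U Ψ W δ g ∧ x ∈ W ∧ ∃ C, IsCompact C ∧ W ⊆ C := by
  have h0 : (0 : ℝ) ∈ Ioo (-ε₀) ε₀ := ⟨by linarith [hΨ.pos], hΨ.pos⟩
  obtain ⟨W₀, hW₀, hx₀, g, hg, hgs, hgΨ⟩ := hΨ.smooth (0, x) ⟨h0, hx⟩
  obtain ⟨κ, hκ⟩ := exists_adaptedCoords (πY := πY) (πB := πB) (g (0, x)).proj
  have hS : IsOpen (W₀ ∩ g ⁻¹' {P | P.proj ∈ κ.chart.source}) :=
    hg.continuousOn.isOpen_inter_preimage hW₀ κ.isOpen_source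
  obtain ⟨I, V, hI, h0I, hV, hxV, hIV⟩ := mem_nhds_prod_iff'.1 (hS.mem_nhds ⟨hx₀, hκ⟩)
  obtain ⟨δ, hδ, hδI⟩ := Metric.mem_nhds_iff.1 (hI.mem_nhds h0I)
  have : LocallyCompactSpace X := ChartedSpace.locallyCompactSpace (Euc (n + 1)) X
  obtain ⟨C, hC, hxC, hCV⟩ := exists_compact_subset hV hxV
  have hI' : ∀ ε ∈ Ioo (-min δ ε₀) (min δ ε₀), ε ∈ I ∧ ε ∈ Ioo (-ε₀) ε₀ := by
    intro ε hε
    have h1 := min_le_left δ ε₀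
    have h2 := min_le_right δ ε₀
    refine ⟨hδI ?_, by linarith [hε.1], by linarith [hε.2]⟩
    rw [Real.ball_eq_Ioo]
    exact ⟨by linarith [hε.1], by linarith [hε.2]⟩
  have hp : ∀ p ∈ Ioo (-min δ ε₀) (min δ ε₀) ×ˢ _root_.interior C,
      p ∈ W₀ ∩ g ⁻¹' {P | P.proj ∈ κ.chart.source} := fun p hp =>
    hIV ⟨(hI' _ hp.1).1, hCV (interior_subset hp.2)⟩
  have hpos : 0 < min δ ε₀ := lt_min hδ hΨ.pos
  have heq : ∀ ε ∈ Ioo (-min δ ε₀) (min δ ε₀), ∀ y ∈ closure U ∩ _root_.interior C,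
      Ψ ε y = g (ε, y) := fun ε hε y hy =>
    hgΨ ⟨⟨(hI' _ hε).2, hy.1⟩, (hp (ε, y) ⟨hε, hy.2⟩).1⟩
  refine ⟨κ, _root_.interior C, min δ ε₀, g, ⟨hpos, isOpen_interior, hg.mono fun p h => (hp p h).1,
    fun p h => hgs p (hp p h).1, fun p h => (hp p h).2, heq, ?_⟩, hxC, C, hC, interior_subset⟩
  intro ε hε y hy
  have hy' : y ∈ closure U ∩ _root_.interior C := ⟨frontier_subset_closure hy.1, hy.2⟩
  have hz : (0 : ℝ) ∈ Ioo (-min δ ε₀) (min δ ε₀) := ⟨by linarith, hpos⟩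
  rw [← heq ε hε y hy', ← heq 0 hz y hy', hΨ.boundary ε (hI' _ hε).2 y hy.1,
    hΨ.boundary 0 h0 y hy.1]

theorem sum_differential_eq_zero {ι : Type*} (s : Finset ι) {ρ : ι → X → ℝ}
    (hρ : ∀ i ∈ s, ContMDiff (𝓡 (n + 1)) 𝓘(ℝ, ℝ) ∞ (ρ i)) {x : X}
    (h : ∀ᶠ y in 𝓝 x, ∑ i ∈ s, ρ i y = 1) : ∑ i ∈ s, differential (n := n) (ρ i) x = 0 := by
  let D : ι → (TangentSpace (𝓡 (n + 1)) x →L[ℝ] ℝ) := fun i => differential (n := n) (ρ i) x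
  have h3 : ∀ t : Finset ι, t ⊆ s → HasMFDerivAt (𝓡 (n + 1)) 𝓘(ℝ, ℝ) (fun y => ∑ i ∈ t, ρ i y) x
      (show TangentSpace (𝓡 (n + 1)) x →L[ℝ] ℝ from ∑ i ∈ t, D i) := by
    classical
    intro t
    induction t using Finset.induction_on with
    | empty => exact fun _ => by simpa using! hasMFDerivAt_const (0 : ℝ) x
    | insert i t hi IH =>
      intro ht
      have h4 : (fun y => ∑ j ∈ insert i t, ρ j y) = ρ i + fun y => ∑ j ∈ t, ρ j y := by
        ext y
        exact Finset.sum_insert hi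
      rw [h4, Finset.sum_insert hi]
      exact (((hρ i (ht (Finset.mem_insert_self i t))).mdifferentiable (by simp)
        x).hasMFDerivAt).add (IH ((Finset.subset_insert i t).trans ht))
  exact hasMFDerivAt_unique (h3 s subset_rfl)
    ((hasMFDerivAt_const (1 : ℝ) x).congr_of_eventuallyEq h)

/-- The first variation formula for the action. -/
theorem IsVariation.hasDerivAt_action [IsManifold (𝓡 K) ∞ FB]
    (o : ManifoldOrientation (m := n + 1) X) (e : EnergySection πY πB) {U : Set X} (hU : IsOpen U)
    (hUc : IsCompact (closure U)) {ψ : X → RPontryagin πY πB} {ε₀ : ℝ}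
    {Ψ : ℝ → X → RPontryagin πY πB} (hΨ : IsVariation U ψ ε₀ Ψ) :
    HasDerivAt (fun ε => action o e U (Ψ ε))
      (- formIntegral o U (omegaAlong e (Ψ 0) (velocity Ψ))) 0 := by
  choose κ W δ g h hxW C hC hWC using fun x : closure U => hΨ.exists_isLocalFamily x.2
  obtain ⟨ρ, hρ⟩ := SmoothPartitionOfUnity.exists_isSubordinate (𝓡 (n + 1)) isClosed_closure W
    (fun x => (h x).isOpen) fun x hx => mem_iUnion.2 ⟨⟨x, hx⟩, hxW ⟨x, hx⟩⟩
  have hfin := ρ.locallyFinite.finite_nonempty_inter_compact hUc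
  set s := hfin.toFinset with hs
  have hsum : ∀ x ∈ U, ∑ i ∈ s, ρ i x = 1 := fun x hx => by
    rw [← ρ.sum_eq_one (subset_closure hx)]
    refine (finsum_eq_sum_of_support_subset _ fun i hi => ?_).symm
    exact Finset.mem_coe.2 (hfin.mem_toFinset.2 ⟨x, hi, subset_closure hx⟩)
  have hρc : ∀ i, HasCompactSupport (ρ i) := fun i =>
    (hC i).of_isClosed_subset (isClosed_tsupport _) ((hρ i).trans (hWC i))
  have key := fun i => (h i).hasDerivAt_formIntegral e o hU hUc (ρ i).contMDiff (hρc i) (hρ i)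
  have hdecomp : ∀ (α : DiffForm (𝓡 (n + 1)) X (n + 1)) (x : X), x ∈ U →
      α x = ∑ i ∈ s, ρ i x • α x := fun α x hx => by
    rw [← Finset.sum_smul, hsum x hx, one_smul]
  have h1 : ∀ᶠ ε in 𝓝 0, action o e U (Ψ ε) = ∑ i ∈ s, formIntegral o U
      (fun x => ρ i x • formPullback (I := 𝓡 (n + 1)) (Ψ ε) e.theta x) := by
    filter_upwards [(Finset.eventually_all s).2 fun i _ => (key i).1] with ε hε
    rw [action, formIntegral_congr o hU (hdecomp _), formIntegral_sum o hU hUc s hε]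
  have h2 : formIntegral o U (omegaAlong e (Ψ 0) (velocity Ψ)) = ∑ i ∈ s, formIntegral o U
      (fun x => ρ i x • omegaAlong e (Ψ 0) (velocity Ψ) x) := by
    rw [formIntegral_congr o hU (hdecomp _), formIntegral_sum o hU hUc s fun i _ => (key i).2.1]
  have h3 : ∑ i ∈ s, formIntegral o U (fluxForm e (Ψ 0) (velocity Ψ) (differential (ρ i))) = 0 := by
    rw [← formIntegral_sum o hU hUc s fun i _ => (key i).2.2.1, formIntegral_congr o hU
      (β := fun _ => 0) fun x hx => ?_]
    · rw [formIntegral_eq]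
      simp [orientedValue, coordValue]
    · obtain ⟨i, -, hi⟩ : ∃ i ∈ s, ρ i x ≠ 0 := Finset.exists_ne_zero_of_sum_ne_zero (by
        rw [hsum x hx]
        exact one_ne_zero)
      refine (h i).sum_fluxForm_eq_zero e hU s _ ⟨hx, hρ i (subset_tsupport _ hi)⟩ ?_
      refine sum_differential_eq_zero s (fun i _ => (ρ i).contMDiff) ?_
      filter_upwards [hU.mem_nhds hx] with y hy using hsum y hy
  have h4 := HasDerivAt.fun_sum (u := s) fun i _ => (key i).2.2.2
  rw [Finset.sum_sub_distrib, h3, sub_zero, Finset.sum_neg_distrib, ← h2] at h4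
  exact h4.congr_of_eventuallyEq h1

end FirstVariation

section CriticalPoints

variable {n N K : ℕ} {X Y B FY FB : Type*}
  [TopologicalSpace X] [ChartedSpace (Euc (n + 1)) X] [IsManifold (𝓡 (n + 1)) ∞ X]
  [TopologicalSpace Y] [ChartedSpace (Euc (n + 1 + N)) Y] [IsManifold (𝓡 (n + 1 + N)) ∞ Y]
  [TopologicalSpace B] [ChartedSpace (Euc (n + 1 + N + K)) B]
  [IsManifold (𝓡 (n + 1 + N + K)) ∞ B]
  [TopologicalSpace FY] [ChartedSpace (Euc N) FY] [IsManifold (𝓡 N) ∞ FY]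
  [TopologicalSpace FB] [ChartedSpace (Euc K) FB]
  {πY : SmoothFiberBundle (n + 1 + N) (n + 1) N Y X FY}
  {πB : SmoothFiberBundle (n + 1 + N + K) (n + 1 + N) K B Y FB}

  [T2Space X] [SigmaCompactSpace X]

theorem SatisfiesPullbackEq.congr {e : EnergySection πY πB} {U : Set X} (hU : IsOpen U)
    {ψ ψ' : X → RPontryagin πY πB} (h : SatisfiesPullbackEq e U ψ) (hψ : EqOn ψ' ψ U) :
    SatisfiesPullbackEq e U ψ' := fun V hV x hx => by
  rw [formPullback_congr _ (eventually_of_mem (hU.mem_nhds hx) hψ), h V hV x hx]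

theorem isCritical_of_satisfiesPullbackEq [T2Space B] [IsManifold (𝓡 K) ∞ FB]
    (o : ManifoldOrientation (m := n + 1) X) (e : EnergySection πY πB) {U : Set X} (hU : IsOpen U)
    (hUc : IsCompact (closure U)) {ψ : X → RPontryagin πY πB} (h : SatisfiesPullbackEq e U ψ) :
    IsCritical o e U ψ := by
  intro ε₀ Ψ hΨ
  have h0 : ∀ x ∈ U, omegaAlong e (Ψ 0) (velocity Ψ) x = 0 := by
    intro x hx
    obtain ⟨κ, W, δ, g, hg, hxW, -⟩ := hΨ.exists_isLocalFamily (subset_closure hx)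
    exact (satisfiesPullbackEq_iff e).1
      (h.congr hU fun y hy => hΨ.initial (subset_closure hy)) x hx _ (hg.projX_velocity ⟨hx, hxW⟩)
  have h1 := hΨ.hasDerivAt_action o e hU hUc
  rw [formIntegral_congr o hU (β := fun _ => 0) h0, formIntegral_eq] at h1
  simpa [orientedValue, coordValue] using h1

namespace AdaptedCoords

variable (κ : AdaptedCoords πY πB)

open Classical in
/-- The variation of `ψ` that moves the points of `A` in the coordinate direction `v`, with a
cut-off function. -/
def bumpVariation (ψ : X → RPontryagin πY πB) (A : Set X) (χ : X → ℝ) (v : CoordP n N K) (ε : ℝ)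
    (x : X) : RPontryagin πY πB :=
  if x ∈ A then κ.ofCoord (κ.toCoord (ψ x) + (ε * χ x) • v) else ψ x

variable {κ} {ψ : X → RPontryagin πY πB} {A U : Set X} {χ : X → ℝ} {v : CoordP n N K} {δ : ℝ}

theorem bumpVariation_of_mem {x : X} (hx : x ∈ A) (ε : ℝ) :
    κ.bumpVariation ψ A χ v ε x = κ.ofCoord (κ.toCoord (ψ x) + (ε * χ x) • v) := if_pos hx

theorem bumpVariation_of_mul_eq_zero {ε : ℝ} {x : X}
    (hs : x ∈ A → (ψ x).proj ∈ κ.chart.source) (h : ε * χ x = 0) :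
    κ.bumpVariation ψ A χ v ε x = ψ x := by
  by_cases hx : x ∈ A
  · rw [bumpVariation_of_mem hx, h, zero_smul, add_zero, κ.ofCoord_toCoord (hs hx)]
  · exact if_neg hx

theorem contMDiffOn_bumpVariation (hv : v.1.1.1 = 0)
    (hψ : ContMDiffOn (𝓡 (n + 1)) (modelP n N K) ∞ ψ A) (hχ : ContMDiff (𝓡 (n + 1)) 𝓘(ℝ, ℝ) ∞ χ)
    (hsec : ∀ x ∈ A, projX (ψ x) = x) (hs : ∀ x ∈ A, (ψ x).proj ∈ κ.chart.source)
    (hχ1 : ∀ x, |χ x| ≤ 1)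
    (ht : ∀ s ∈ Ioo (-δ) δ, ∀ x ∈ A, (κ.toCoord (ψ x) + s • v).1 ∈ κ.chart.target) :
    (∀ p ∈ Ioo (-δ) δ ×ˢ A, (κ.toCoord (ψ p.2) + (p.1 * χ p.2) • v).1 ∈ κ.chart.target) ∧
    ContMDiffOn (𝓘(ℝ, ℝ).prod (𝓡 (n + 1))) (modelP n N K) ∞
      (fun p : ℝ × X => κ.bumpVariation ψ A χ v p.1 p.2) (Ioo (-δ) δ ×ˢ A) ∧
    ∀ p ∈ Ioo (-δ) δ ×ˢ A, projX (κ.bumpVariation ψ A χ v p.1 p.2) = p.2 := by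
  have hm : ∀ p ∈ Ioo (-δ) δ ×ˢ A,
      (κ.toCoord (ψ p.2) + (p.1 * χ p.2) • v).1 ∈ κ.chart.target := by
    intro p hp
    refine ht _ ?_ _ hp.2
    rw [mem_Ioo, ← abs_lt] at *
    rw [abs_mul]
    have h1 : |p.1| < δ := abs_lt.2 hp.1
    calc |p.1| * |χ p.2| ≤ |p.1| * 1 := mul_le_mul_of_nonneg_left (hχ1 _) (abs_nonneg _)
      _ < δ := by rwa [mul_one]
  refine ⟨hm, ?_, ?_⟩
  · have h1 : ContMDiffOn (𝓘(ℝ, ℝ).prod (𝓡 (n + 1))) 𝓘(ℝ, CoordP n N K) ∞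
        (fun p : ℝ × X => κ.toCoord (ψ p.2) + (p.1 * χ p.2) • v) (Ioo (-δ) δ ×ˢ A) := by
      have h2 : ContMDiffOn (𝓘(ℝ, ℝ).prod (𝓡 (n + 1))) 𝓘(ℝ, CoordP n N K) ∞
          (fun p : ℝ × X => κ.toCoord (ψ p.2)) (Ioo (-δ) δ ×ˢ A) :=
        (κ.contMDiffOn_toCoord.comp hψ hs).comp contMDiff_snd.contMDiffOn fun p hp => hp.2
      have h3 : ContMDiff (𝓘(ℝ, ℝ).prod (𝓡 (n + 1))) 𝓘(ℝ, ℝ) ∞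
          (fun p : ℝ × X => p.1 * χ p.2) := contMDiff_fst.mul (hχ.comp contMDiff_snd)
      exact h2.add (h3.smul contMDiff_const).contMDiffOn
    exact (κ.contMDiffOn_ofCoord.comp h1 hm).congr fun p hp => bumpVariation_of_mem hp.2 _
  · intro p hp
    rw [bumpVariation_of_mem hp.2]
    have hq := hm p hp
    refine κ.chartY.base.injOn (κ.projX_mem (κ.ofCoord_proj_mem hq)) ?_ ?_
    · have h1 := κ.projX_mem (hs _ hp.2)
      rwa [hsec _ hp.2] at h1
    · rw [κ.base_projX_ofCoord hq]
      have h1 := κ.base_projX (hs _ hp.2)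
      rw [hsec _ hp.2] at h1
      rw [h1]
      change (κ.toCoord (ψ p.2)).1.1.1 + (p.1 * χ p.2) • v.1.1.1 = _
      rw [hv, smul_zero, add_zero]

theorem isVariation_bumpVariation (hψ : IsSmoothSectionOn ψ (closure U)) (hU : IsOpen U)
    (hv : v.1.1.1 = 0) (hδ : 0 < δ) (hA : IsOpen A) (hAU : A ⊆ U)
    (hχ : ContMDiff (𝓡 (n + 1)) 𝓘(ℝ, ℝ) ∞ χ) (hχA : tsupport χ ⊆ A)
    (hs : ∀ x ∈ A, (ψ x).proj ∈ κ.chart.source) (hχ1 : ∀ x, |χ x| ≤ 1)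
    (ht : ∀ s ∈ Ioo (-δ) δ, ∀ x ∈ A, (κ.toCoord (ψ x) + s • v).1 ∈ κ.chart.target) :
    IsVariation U ψ δ (κ.bumpVariation ψ A χ v) ∧
    κ.IsLocalFamily U (κ.bumpVariation ψ A χ v) A δ
      (fun p => κ.bumpVariation ψ A χ v p.1 p.2) := by
  have hψA : ContMDiffOn (𝓡 (n + 1)) (modelP n N K) ∞ ψ A := fun x hx =>
    (isSmoothSectionOn_at hU hψ (hAU hx)).1.contMDiffWithinAt
  have hsec : ∀ x ∈ A, projX (ψ x) = x := fun x hx =>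
    (isSmoothSectionOn_at hU hψ (hAU hx)).2.self_of_nhds
  obtain ⟨hm, hsm, hpr⟩ := contMDiffOn_bumpVariation hv hψA hχ hsec hs hχ1 ht
  have hfr : ∀ x ∈ frontier U, x ∉ A := fun x hx hxA =>
    (hU.inter_frontier_eq.subset ⟨hAU hxA, hx⟩).elim
  have hfr' : ∀ ε, ∀ x ∈ frontier U, κ.bumpVariation ψ A χ v ε x = ψ x :=
    fun ε x hx => if_neg (hfr x hx)
  refine ⟨⟨hδ, ?_, fun x _ => bumpVariation_of_mul_eq_zero (hs x) (zero_mul _),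
    fun ε _ x hx => by rw [hfr' ε x hx]⟩,
    ⟨hδ, hA, hsm, hpr, fun p hp => ?_, fun ε _ x _ => rfl, fun ε _ x hx => ?_⟩⟩
  · rintro ⟨ε, x⟩ ⟨hε, hx⟩
    by_cases hxA : x ∈ A
    · exact ⟨Ioo (-δ) δ ×ˢ A, isOpen_Ioo.prod hA, ⟨hε, hxA⟩, _, hsm, hpr, fun p _ => rfl⟩
    · obtain ⟨W, hW, hxW, g, hg, hgs, hfg⟩ := hψ x hx
      refine ⟨univ ×ˢ (W ∩ (tsupport χ)ᶜ),
        isOpen_univ.prod (hW.inter (isClosed_tsupport _).isOpen_compl),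
        ⟨mem_univ _, hxW, fun h => hxA (hχA h)⟩, fun p => g p.2,
        hg.comp contMDiff_snd.contMDiffOn fun p hp => hp.2.1, fun p hp => hgs _ hp.2.1, ?_⟩
      intro p hp
      refine (bumpVariation_of_mul_eq_zero (hs p.2) ?_).trans (hfg ⟨hp.1.2, hp.2.2.1⟩)
      rw [image_eq_zero_of_notMem_tsupport hp.2.2.2, mul_zero]
  · rw [bumpVariation_of_mem hp.2]
    exact κ.ofCoord_proj_mem (hm p hp)
  · exact absurd hx.2 (hfr x hx.1)

end AdaptedCoords

end CriticalPoints

section Necessity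

variable {n N K : ℕ} {X Y B FY FB : Type*}
  [TopologicalSpace X] [ChartedSpace (Euc (n + 1)) X] [IsManifold (𝓡 (n + 1)) ∞ X]
  [TopologicalSpace Y] [ChartedSpace (Euc (n + 1 + N)) Y] [IsManifold (𝓡 (n + 1 + N)) ∞ Y]
  [TopologicalSpace B] [ChartedSpace (Euc (n + 1 + N + K)) B]
  [IsManifold (𝓡 (n + 1 + N + K)) ∞ B]
  [TopologicalSpace FY] [ChartedSpace (Euc N) FY] [IsManifold (𝓡 N) ∞ FY]
  [TopologicalSpace FB] [ChartedSpace (Euc K) FB]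
  {πY : SmoothFiberBundle (n + 1 + N) (n + 1) N Y X FY}
  {πB : SmoothFiberBundle (n + 1 + N + K) (n + 1 + N) K B Y FB}

  [T2Space X] [SigmaCompactSpace X]

theorem omegaAlong_eq_zero (e : EnergySection πY πB) {ψ : X → RPontryagin πY πB}
    {W : (x : X) → TangentSpace (modelP n N K) (ψ x)} {x : X} (h : W x = 0) :
    omegaAlong e ψ W x = 0 := by
  have h1 : ContinuousAlternatingMap.curryLeft (E := Euc (n + 1 + N + K) × Mom (n + 1) N)
      (e.omega (ψ x)) (W x) = 0 := by
    rw [h]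
    exact map_zero _
  rw [omegaAlong, h1]
  rfl

theorem velocity_eq_zero {Ψ : ℝ → X → RPontryagin πY πB} {x : X} (h : ∀ ε, Ψ ε x = Ψ 0 x) :
    velocity Ψ x = 0 := by
  have h1 : (fun ε => Ψ ε x) = fun _ => Ψ 0 x := funext h
  have h2 : HasMFDerivAt 𝓘(ℝ, ℝ) (modelP n N K) (fun ε => Ψ ε x) 0 0 := by
    rw [h1]
    exact hasMFDerivAt_const _ _
  rw [velocity, h2.mfderiv]
  rfl

namespace AdaptedCoords

variable (κ : AdaptedCoords πY πB) (e : EnergySection πY πB)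

theorem eulerLagrange_smul (q : CoordP n N K) (w : Fin (n + 1) → CoordP n N K) (V : CoordP n N K)
    (a : ℝ) : κ.eulerLagrange e q w (a • V) = a * κ.eulerLagrange e q w V := by
  unfold eulerLagrange
  rw [map_smul, mul_add, mul_sub, Finset.mul_sum, Finset.mul_sum]
  simp only [Finset.mul_sum]
  refine congrArg₂ _ (congrArg₂ _ rfl ?_) ?_ <;>
    refine Finset.sum_congr rfl fun μ _ => Finset.sum_congr rfl fun A _ => ?_
  · change a * V.2 μ A * _ = _
    ring
  · change _ * (a * V.1.1.2 A) = _
    ring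

variable {κ} {ψ : X → RPontryagin πY πB} {A U : Set X} {χ : X → ℝ} {v : CoordP n N K} {δ : ℝ}

theorem coordValue_omegaAlong_bumpVariation (hU : IsOpen U) (hAU : A ⊆ U)
    (hs : ∀ x ∈ A, (ψ x).proj ∈ κ.chart.source)
    (ht : ∀ s ∈ Ioo (-δ) δ, ∀ x ∈ A, (κ.toCoord (ψ x) + s • v).1 ∈ κ.chart.target)
    (h : κ.IsLocalFamily U (κ.bumpVariation ψ A χ v) A δ
      (fun p => κ.bumpVariation ψ A χ v p.1 p.2)) (hχ1 : ∀ x, |χ x| ≤ 1)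
    {u : Euc (n + 1)} (hu : u ∈ chartDomain κ.chartY.base A) :
    coordValue κ.chartY.base (omegaAlong e (κ.bumpVariation ψ A χ v 0)
      (velocity (κ.bumpVariation ψ A χ v))) u =
      χ (κ.chartY.base.symm u) * κ.eulerLagrange e (κ.secCoord ψ u)
        (fun μ => fderiv ℝ (κ.secCoord ψ) u (stdVec μ)) v := by
  have hu' : u ∈ chartDomain κ.chartY.base (U ∩ A) := ⟨hu.1, hAU hu.2, hu.2⟩
  have h0 : κ.bumpVariation ψ A χ v 0 = ψ := by
    ext1 x
    exact bumpVariation_of_mul_eq_zero (hs x) (zero_mul _)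
  have h1 := h.coordValue_omegaAlong e hU hu'
  simp only [← h.fderiv_secCoord hU hu' h.zero_mem] at h1
  have h9 : κ.famCoord (fun p => κ.bumpVariation ψ A χ v p.1 p.2) (0, u) =
      κ.secCoord (κ.bumpVariation ψ A χ v 0) u := rfl
  rw [h9] at h1
  have h2 : fderiv ℝ (κ.famCoord fun p => κ.bumpVariation ψ A χ v p.1 p.2) (0, u) (1, 0) =
      χ (κ.chartY.base.symm u) • v := by
    have h3 : HasDerivAt (fun t : ℝ => (t, u)) ((1 : ℝ), (0 : Euc (n + 1))) 0 :=
      (hasDerivAt_id 0).prodMk (hasDerivAt_const 0 u)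
    have h4 := (h.hasFDerivAt_famCoord h.zero_mem hu).comp_hasDerivAt (0 : ℝ) h3
    have h5 : HasDerivAt (fun t : ℝ => κ.secCoord ψ u + (t * χ (κ.chartY.base.symm u)) • v)
        (χ (κ.chartY.base.symm u) • v) 0 := by
      have h6 := (((hasDerivAt_id (0 : ℝ)).mul_const (χ (κ.chartY.base.symm u))).smul_const
        v).const_add (κ.secCoord ψ u)
      simpa using h6
    refine h4.unique (h5.congr_of_eventuallyEq ?_)
    filter_upwards [Ioo_mem_nhds h.zero_mem.1 h.zero_mem.2] with t htt
    have h7 : |t * χ (κ.chartY.base.symm u)| < δ := by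
      rw [abs_mul]
      calc |t| * |χ _| ≤ |t| * 1 := mul_le_mul_of_nonneg_left (hχ1 _) (abs_nonneg _)
        _ < δ := by rw [mul_one]; exact abs_lt.2 htt
    change κ.toCoord (κ.bumpVariation ψ A χ v t (κ.chartY.base.symm u)) = _
    have huA : κ.chartY.base.symm u ∈ A := hu.2
    rw [bumpVariation_of_mem huA, κ.toCoord_ofCoord (ht _ (abs_lt.1 h7) _ huA)]
    rfl
  rw [h1, h2, eulerLagrange_smul]
  have h8 : κ.secCoord (κ.bumpVariation ψ A χ v 0) = κ.secCoord ψ := by rw [h0]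
  rw [h8]

end AdaptedCoords

theorem satisfiesPullbackEq_of_isCritical [T2Space B] [IsManifold (𝓡 K) ∞ FB]
    (o : ManifoldOrientation (m := n + 1) X) (e : EnergySection πY πB) {U : Set X} (hU : IsOpen U)
    (hUc : IsCompact (closure U)) {ψ : X → RPontryagin πY πB}
    (hψ : IsSmoothSectionOn ψ (closure U)) (hcrit : IsCritical o e U ψ) :
    SatisfiesPullbackEq e U ψ := by
  rw [satisfiesPullbackEq_iff]
  intro x₀ hx₀ W hW
  by_contra hne
  obtain ⟨κ, hs₀⟩ := exists_adaptedCoords (πY := πY) (πB := πB) (ψ x₀).proj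
  set b := κ.chartY.base
  have hb : b.MDifferentiable (𝓡 (n + 1)) (𝓡 (n + 1)) := κ.chartY.base_mdiff
  have hsm : ∀ x ∈ U, ContMDiffAt (𝓡 (n + 1)) (modelP n N K) ∞ ψ x := fun x hx =>
    (isSmoothSectionOn_at hU hψ hx).1
  have hsec : ∀ x ∈ U, ∀ᶠ y in 𝓝 x, projX (ψ y) = y := fun x hx =>
    (isSmoothSectionOn_at hU hψ hx).2
  set A₀ := U ∩ ψ ⁻¹' {P | P.proj ∈ κ.chart.source}
  have hψc : ContinuousOn ψ U := fun x hx => (hsm x hx).continuousAt.continuousWithinAt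
  have hA₀ : IsOpen A₀ := hψc.isOpen_inter_preimage hU κ.isOpen_source
  have hsrc : ∀ x ∈ A₀, x ∈ b.source := fun x hx => by
    have h1 := κ.projX_mem hx.2
    rwa [(hsec x hx.1).self_of_nhds] at h1
  have hxx : ∀ x ∈ A₀, b.symm (b x) = x := fun x hx => b.left_inv (hsrc x hx)
  have hxA₀ : x₀ ∈ A₀ := ⟨hx₀, hs₀⟩
  set u₀ := b x₀
  set O₀ := chartDomain b A₀
  have hO₀ : IsOpen O₀ := isOpen_chartDomain b hA₀
  have hbO : ∀ x ∈ A₀, b x ∈ O₀ := fun x hx =>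
    ⟨b.map_source (hsrc x hx), by rw [mem_preimage, hxx x hx]; exact hx⟩
  set v := κ.vecCoord (ψ x₀) (W x₀) with hvdef
  have hv : v.1.1.1 = 0 := κ.vecCoord_fst_eq_zero hs₀ hW
  have hS : ContDiffOn ℝ ∞ (κ.secCoord ψ) O₀ := fun u hu =>
    (κ.contDiffAt_secCoord hu.1 (hsm _ hu.2.1) hu.2.2).contDiffWithinAt
  set f : Euc (n + 1) → ℝ := fun u => κ.eulerLagrange e (κ.secCoord ψ u)
    (fun μ => fderiv ℝ (κ.secCoord ψ) u (stdVec μ)) v with hf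
  have hfc : ContinuousOn f O₀ := κ.continuousOn_eulerLagrange e hS.continuousOn
    (fun u hu => κ.toCoord_fst_mem hu.2.2)
    (fun μ => (hS.continuousOn_fderiv_of_isOpen hO₀ (by simp)).clm_apply continuousOn_const)
    continuousOn_const
  have hf₀ : f u₀ ≠ 0 := by
    intro h0
    have hs₀' : (ψ (b.symm u₀)).proj ∈ κ.chart.source := by rwa [hxx x₀ hxA₀]
    have h1 := κ.coordValue_omegaAlong e (ψ := ψ) (u := u₀)
      (by rw [hxx x₀ hxA₀]; exact hsec x₀ hx₀) (hbO x₀ hxA₀).1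
      (by rw [hxx x₀ hxA₀]; exact hsm x₀ hx₀) hs₀' W (by rw [hxx x₀ hxA₀]; exact hW)
    rw [hxx x₀ hxA₀, ← hvdef] at h1
    have h2 := eq_zero_of_coordValue_eq_zero hb (hbO x₀ hxA₀).1 (h1.trans h0)
    rw [hxx x₀ hxA₀] at h2
    exact hne h2
  have hT : IsOpen ((univ ×ˢ A₀) ∩ (fun p : ℝ × X => κ.toCoord (ψ p.2) + p.1 • v) ⁻¹'
      {q : CoordP n N K | q.1 ∈ κ.chart.target}) := by
    refine ContinuousOn.isOpen_inter_preimage ?_ (isOpen_univ.prod hA₀) κ.isOpen_target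
    have h1 : ContinuousOn (fun x => κ.toCoord (ψ x)) A₀ :=
      κ.contMDiffOn_toCoord.continuousOn.comp (hψc.mono inter_subset_left) fun x hx => hx.2
    exact (h1.comp continuousOn_snd fun p hp => hp.2).add
      (continuous_fst.smul continuous_const).continuousOn
  obtain ⟨I, V, hI, h0I, hV, hxV, hIV⟩ := mem_nhds_prod_iff'.1 (hT.mem_nhds
    (show ((0 : ℝ), x₀) ∈ _ from ⟨⟨mem_univ _, hxA₀⟩, by
      rw [mem_preimage, zero_smul, add_zero]; exact κ.toCoord_fst_mem hs₀⟩))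
  obtain ⟨δ, hδ, hδI⟩ := Metric.mem_nhds_iff.1 (hI.mem_nhds h0I)
  rw [Real.ball_eq_Ioo, zero_sub, zero_add] at hδI
  have hcb : ContinuousAt b x₀ := b.continuousAt (hsrc x₀ hxA₀)
  have hpos : ∀ᶠ x in 𝓝 x₀, 0 < f (b x) * f u₀ :=
    (((hfc.continuousAt (hO₀.mem_nhds (hbO x₀ hxA₀))).comp_of_eq hcb rfl).mul
      continuousAt_const).eventually (lt_mem_nhds (mul_self_pos.2 hf₀))
  have hsgn := hcb.eventually (eventually_sign_coordValue_eq o κ.chartY.base_smooth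
    κ.chartY.base_symm_smooth (hbO x₀ hxA₀).1)
  obtain ⟨A, hAsub, hA, hxA⟩ := mem_nhds_iff.1 ((hA₀.eventually_mem hxA₀).and
    ((hV.eventually_mem hxV).and (hpos.and hsgn)))
  have hAA₀ : A ⊆ A₀ := fun x hx => (hAsub hx).1
  have hAU : A ⊆ U := fun x hx => (hAA₀ hx).1
  obtain ⟨χ, -, hχA⟩ := (SmoothBumpFunction.nhds_basis_tsupport (I := 𝓡 (n + 1)) x₀).mem_iff.1
    (hA.mem_nhds hxA)
  have hχ1 : ∀ x, |χ x| ≤ 1 := fun x => abs_le.2 ⟨by linarith [χ.nonneg (x := x)], χ.le_one⟩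
  have hs : ∀ x ∈ A, (ψ x).proj ∈ κ.chart.source := fun x hx => (hAA₀ hx).2
  have ht : ∀ s ∈ Ioo (-δ) δ, ∀ x ∈ A, (κ.toCoord (ψ x) + s • v).1 ∈ κ.chart.target :=
    fun s hs x hx => (hIV (show (s, x) ∈ I ×ˢ V from ⟨hδI hs, (hAsub hx).2.1⟩)).2
  obtain ⟨hvar, hfam⟩ := AdaptedCoords.isVariation_bumpVariation hψ hU hv hδ hA hAU χ.contMDiff hχA
    hs hχ1 ht
  set Ψ := κ.bumpVariation ψ A χ v
  have hzero : formIntegral o U (omegaAlong e (Ψ 0) (velocity Ψ)) = 0 :=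
    neg_eq_zero.1 ((hvar.hasDerivAt_action o e hU hUc).unique (hcrit δ Ψ hvar))
  set c := chartCutoff o b χ
  have hχb : tsupport χ ⊆ b.source := hχA.trans (hAA₀.trans hsrc)
  have hc : ContDiff ℝ ∞ c := contDiff_chartCutoff κ.chartY.base_smooth κ.chartY.base_symm_smooth
    χ.contMDiff χ.hasCompactSupport hχb
  have hcc : HasCompactSupport c := hasCompactSupport_chartCutoff χ.hasCompactSupport hχb
  have hcA : tsupport c ⊆ chartDomain b A :=
    tsupport_chartCutoff_subset_chartDomain χ.hasCompactSupport hχb hχA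
  have hcO : tsupport c ⊆ O₀ := hcA.trans fun u hu => ⟨hu.1, hAA₀ hu.2⟩
  have hα : ∀ x, x ∉ A → omegaAlong e (Ψ 0) (velocity Ψ) x = 0 := fun x hx =>
    omegaAlong_eq_zero e (velocity_eq_zero fun ε => (if_neg hx).trans (if_neg hx).symm)
  have hint := (formIntegral_of_eqOn o hU hUc hb
    (α := omegaAlong e (Ψ 0) (velocity Ψ)) (G := fun u => c u * f u)
    (fun x _ hx => hα x fun h => hx (hsrc x (hAA₀ h)))
    (integrable_cutoff_mul hc.continuous hcc hO₀ hcO hfc) fun u hu => by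
      by_cases huA : b.symm u ∈ A
      · rw [orientedValue, AdaptedCoords.coordValue_omegaAlong_bumpVariation e hU hAU hs ht hfam hχ1
          ⟨hu.1, huA⟩, ← mul_assoc]
        exact congrArg (· * f u) (chartCutoff_of_mem hu.1).symm
      · have h0 : c u = 0 := image_eq_zero_of_notMem_tsupport fun h => huA (hcA h).2
        rw [orientedValue_eq_zero o b (hα _ huA), h0, zero_mul]).2
  rw [hzero, setIntegral_eq_integral_of_forall_compl_eq_zero fun u hu => by
    rw [image_eq_zero_of_notMem_tsupport fun h => hu ⟨(hcA h).1, hAU (hcA h).2⟩, zero_mul]] at hint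
  set k : ℝ := (SignType.sign (coordValue b o.form u₀) : ℝ) * f u₀ with hk
  have hsq : (SignType.sign (coordValue b o.form u₀) : ℝ) *
      (SignType.sign (coordValue b o.form u₀) : ℝ) = 1 := by
    rcases lt_or_gt_of_ne (coordValue_form_ne_zero o hb (hbO x₀ hxA₀).1) with h | h
    · rw [sign_neg h]
      norm_num
    · rw [sign_pos h]
      norm_num
  have hval : ∀ u ∈ chartDomain b A, k * (c u * f u) = χ (b.symm u) * (f u * f u₀) := by
    intro u hu
    have h1 := (hAsub hu.2).2.2.2
    rw [b.right_inv hu.1] at h1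
    have h2 : c u = (SignType.sign (coordValue b o.form u₀) : ℝ) * χ (b.symm u) := by
      rw [← h1]
      exact chartCutoff_of_mem hu.1
    rw [h2, hk]
    linear_combination (χ (b.symm u) * f u * f u₀) * hsq
  have hcont : Continuous (fun u => k * (c u * f u)) :=
    continuous_const.mul (continuous_cutoff_mul hc.continuous hO₀ hcO hfc)
  have hposi : 0 < ∫ u, k * (c u * f u) := by
    refine hcont.integral_pos_of_hasCompactSupport_nonneg_nonzero (x := u₀) hcc.mul_right.mul_left
      (fun u => ?_) ?_
    · by_cases hu : u ∈ chartDomain b A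
      · have h1 := (hAsub hu.2).2.2.1
        rw [b.right_inv hu.1] at h1
        change 0 ≤ k * (c u * f u)
        rw [hval u hu]
        exact mul_nonneg χ.nonneg h1.le
      · have h0 : c u = 0 := image_eq_zero_of_notMem_tsupport fun h => hu (hcA h)
        change 0 ≤ k * (c u * f u)
        rw [h0, zero_mul, mul_zero]
    · have hu : u₀ ∈ chartDomain b A :=
        ⟨(hbO x₀ hxA₀).1, by rw [mem_preimage, hxx x₀ hxA₀]; exact hxA⟩
      rw [hval u₀ hu, hxx x₀ hxA₀, χ.eq_one, one_mul]
      exact (mul_self_pos.2 hf₀).ne'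
  rw [integral_const_mul, ← hint, mul_zero] at hposi
  exact lt_irrefl _ hposi

end Necessity

end CovPontryagin

end

theorem theorem5p3 {n N K : ℕ} {X Y B FY FB : Type*}
    [TopologicalSpace X] [ChartedSpace (Euc (n + 1)) X] [IsManifold (𝓡 (n + 1)) ∞ X]
    [T2Space X] [SigmaCompactSpace X]
    [TopologicalSpace Y] [ChartedSpace (Euc (n + 1 + N)) Y] [IsManifold (𝓡 (n + 1 + N)) ∞ Y]
    [T2Space Y] [SigmaCompactSpace Y]
    [TopologicalSpace B] [ChartedSpace (Euc (n + 1 + N + K)) B]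
    [IsManifold (𝓡 (n + 1 + N + K)) ∞ B] [T2Space B] [SigmaCompactSpace B]
    [TopologicalSpace FY] [ChartedSpace (Euc N) FY] [IsManifold (𝓡 N) ∞ FY]
    [TopologicalSpace FB] [ChartedSpace (Euc K) FB] [IsManifold (𝓡 K) ∞ FB]
    (o : ManifoldOrientation (m := n + 1) X)
    (πY : SmoothFiberBundle (n + 1 + N) (n + 1) N Y X FY)
    (πB : SmoothFiberBundle (n + 1 + N + K) (n + 1 + N) K B Y FB)
    (e : EnergySection πY πB)
    (U : Set X) (hU : IsOpen U) (hUc : IsCompact (closure U))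
    (ψ : X → RPontryagin πY πB) (hψ : IsSmoothSectionOn ψ (closure U)) :
    List.TFAE [IsCritical o e U ψ, SatisfiesPullbackEq e U ψ, SatisfiesLocalEq e U ψ] := by
  tfae_have 1 → 2 := satisfiesPullbackEq_of_isCritical o e hU hUc hψ
  tfae_have 2 → 1 := isCritical_of_satisfiesPullbackEq o e hU hUc
  tfae_have 2 ↔ 3 := satisfiesPullbackEq_iff_satisfiesLocalEq e hU hψ
  tfae_finish
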